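/- **Theorem 1.** Let $\gamma\ge 1$, $p(\rho)=\rho^\gamma$, and let $\varepsilon(\rho)=\rho^{\gamma-1}/(\gamma-1)$ if $\gamma>1$, $\varepsilon(\rho)=\log\rho$ if $\gamma=1$ (so that $p(\rho)=\rho^2\varepsilon'(\rho)$). Consider the compressible isentropic Euler system $$\partial_t\rho+\operatorname{div}_x(\rho v)=0,\qquad \partial_t(\rho v)+\operatorname{div}_x(\rho v\otimes v)+\nabla_x p(\rho)=0\qquad\text{on }\mathbb R^2\times[0,\infty)$$ with Riemann initial data $(\rho^0,v^0)(x)=(\rho_-,v_-)$ for $x_2<0$ and $(\rho_+,v_+)$ for $x_2>0$, where $\rho_\pm>0$ and $v_\pm=(v_{\pm1},v_{\pm2})\in\mathbb R^2$ are constants. A bounded weak solution is a pair $(\rho,v)\in L^\infty(\mathbb R^2\times(0,\infty))$, $\rho\ge0$, that satisfies these equations with the initial data in the sense of distributions, that is, against all test functions in $C_c^\infty(\mathbb R^2\times[0,\infty))$; it is admissible if, for every nonnegative $\varphi\in C_c^\infty(\mathbb R^2\times[0,\infty))$, $$\int_0^\infty\!\!\int_{\mathbb R^2}\Big[\big(\rho\varepsilon(\rho)+\tfrac12\rho|v|^2\big)\partial_t\varphi+\big(\rho\varepsilon(\rho)+\tfrac12\rho|v|^2+p(\rho)\big)v\cdot\nabla_x\varphi\Big]dx\,dt+\int_{\mathbb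 R^2}\big(\rho^0\varepsilon(\rho^0)+\tfrac12\rho^0|v^0|^2\big)\varphi(x,0)\,dx\ge0 .$$ The self-similar solution of this Riemann problem consists of an admissible 1-shock and an admissible 3-shock (shocks satisfying the Rankine–Hugoniot conditions and the entropy inequality, whose speed $s$ lies strictly between the values of $\lambda_1=v_2-\sqrt{p'(\rho)}$, respectively $\lambda_3=v_2+\sqrt{p'(\rho)}$, on the two sides, the larger value being on the left) if and only if $$v_{-1}=v_{+1}\quad\text{and}\quad v_{+2}-v_{-2}<-\sqrt{\frac{(\rho_--\rho_+)(p(\rho_-)-p(\rho_+))}{\rho_-\rho_+}} .$$ For all such data there exist infinitely many bounded admissible weak solutions, pairwise different on sets of positive measure, each of them without vacuum, i.e. with $\rho\ge c$ almost everywhere for some constant $c>0$. -/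

import Mathlib

open MeasureTheory
open scoped ContDiff

noncomputable section

namespace IsentropicEuler

/-- The spatial domain `ℝ²` with its Euclidean norm. The coordinates `x₁, x₂` of `x` are
`x 0, x 1`. -/
abbrev Plane : Type := EuclideanSpace ℝ (Fin 2)

/-- Points `(x, t)` of space-time are pairs in `ℝ² × ℝ`; this is the part `t > 0`. -/
def spaceTime : Set (Plane × ℝ) := {z | 0 < z.2}

/-- Lebesgue measure on `ℝ² × (0, ∞)`. -/
def spaceTimeMeasure : Measure (Plane × ℝ) := volume.restrict spaceTime

/-- The pressure law `p(ρ) = ρ ^ γ`. -/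
def pressure (γ r : ℝ) : ℝ := r ^ γ

/-- The specific internal energy `ε`, a primitive of `p(r) / r²`: `ε(r) = r ^ (γ - 1) / (γ - 1)`
for `γ > 1` and `ε(r) = log r` for `γ = 1`. -/
def internalEnergy (γ r : ℝ) : ℝ :=
  if γ = 1 then Real.log r else r ^ (γ - 1) / (γ - 1)

/-- The energy density `ρ ε(ρ) + ρ |v|² / 2`. -/
def energy (γ r : ℝ) (w : Plane) : ℝ :=
  r * internalEnergy γ r + r * (‖w‖ ^ 2 / 2)

/-- The speed of sound `√p'(ρ)`, where `p'(ρ) = γ ρ ^ (γ - 1)`. -/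
def soundSpeed (γ r : ℝ) : ℝ := √(γ * r ^ (γ - 1))

/-! ### Test functions on `ℝ² × [0, ∞)`

They are the restrictions to `t ≥ 0` of smooth compactly supported functions on `ℝ² × ℝ`; they need
not vanish at `t = 0`. -/

/-- Smooth compactly supported functions on `ℝ² × ℝ` with values in `F`. -/
def IsTestFunction {F : Type*} [NormedAddCommGroup F] [NormedSpace ℝ F]
    (ψ : Plane × ℝ → F) : Prop :=
  ContDiff ℝ ∞ ψ ∧ HasCompactSupport ψ

/-- The time derivative `∂ₜ ψ`. -/
def timeDeriv {F : Type*} [NormedAddCommGroup F] [NormedSpace ℝ F]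
    (ψ : Plane × ℝ → F) (z : Plane × ℝ) : F :=
  fderiv ℝ ψ z (0, 1)

/-- The spatial directional derivative `(w · ∇ₓ) ψ`. -/
def spaceDeriv {F : Type*} [NormedAddCommGroup F] [NormedSpace ℝ F]
    (ψ : Plane × ℝ → F) (z : Plane × ℝ) (w : Plane) : F :=
  fderiv ℝ ψ z (w, 0)

/-- The spatial divergence `divₓ φ = ∂₁ φ₁ + ∂₂ φ₂`. -/
def spaceDiv (φ : Plane × ℝ → Plane) (z : Plane × ℝ) : ℝ :=
  ∑ i : Fin 2, spaceDeriv φ z (EuclideanSpace.single i 1) i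

/-! ### Weak solutions -/

/-- `(ρ, v) ∈ L^∞(ℝ² × (0, ∞))`, with nonnegative density, is a weak solution of the compressible
isentropic Euler system with `p(ρ) = ρ ^ γ` and initial data `(ρ₀, v₀)`. In the momentum equation
`v ⊗ v : ∇ₓ φ = v · ((v · ∇ₓ) φ)`. -/
structure IsWeakSolution (γ : ℝ) (ρ₀ : Plane → ℝ) (v₀ : Plane → Plane)
    (ρ : Plane × ℝ → ℝ) (v : Plane × ℝ → Plane) : Prop where
  memLp_density : MemLp ρ ⊤ spaceTimeMeasure
  memLp_velocity : MemLp v ⊤ spaceTimeMeasure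
  density_nonneg : ∀ᵐ z ∂spaceTimeMeasure, 0 ≤ ρ z
  mass : ∀ ψ : Plane × ℝ → ℝ, IsTestFunction ψ →
    (∫ z, (ρ z * timeDeriv ψ z + ρ z * spaceDeriv ψ z (v z)) ∂spaceTimeMeasure)
      + ∫ x, ρ₀ x * ψ (x, 0) = 0
  momentum : ∀ φ : Plane × ℝ → Plane, IsTestFunction φ →
    (∫ z, (ρ z * inner ℝ (v z) (timeDeriv φ z) + ρ z * inner ℝ (v z) (spaceDeriv φ z (v z))
        + pressure γ (ρ z) * spaceDiv φ z) ∂spaceTimeMeasure)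
      + ∫ x, ρ₀ x * inner ℝ (v₀ x) (φ (x, 0)) = 0

/-- An admissible weak solution: a bounded weak solution which satisfies the energy inequality in
the weak form, with the initial data included. -/
structure IsAdmissibleSolution (γ : ℝ) (ρ₀ : Plane → ℝ) (v₀ : Plane → Plane)
    (ρ : Plane × ℝ → ℝ) (v : Plane × ℝ → Plane) : Prop
    extends IsWeakSolution γ ρ₀ v₀ ρ v where
  energy_ineq : ∀ φ : Plane × ℝ → ℝ, IsTestFunction φ → (∀ x t, 0 ≤ t → 0 ≤ φ (x, t)) →
    0 ≤ (∫ z, (energy γ (ρ z) (v z) * timeDeriv φ z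
        + (energy γ (ρ z) (v z) + pressure γ (ρ z)) * spaceDeriv φ z (v z)) ∂spaceTimeMeasure)
      + ∫ x, energy γ (ρ₀ x) (v₀ x) * φ (x, 0)

/-- There is no vacuum: the density is bounded away from `0` almost everywhere. -/
def HasNoVacuum (ρ : Plane × ℝ → ℝ) : Prop :=
  ∃ c : ℝ, 0 < c ∧ ∀ᵐ z ∂spaceTimeMeasure, c ≤ ρ z

/-! ### Riemann data and self-similar solutions consisting of two shocks -/

/-- Riemann data: the value is `a` for `x₂ < 0` and `b` for `x₂ > 0`. -/
def riemannData {A : Type*} (a b : A) (x : Plane) : A := if x 1 < 0 then a else b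

/-- The states `(r, w)` (left, in `x₂ < s t`) and `(r', w')` (right, in `x₂ > s t`) are connected
by an admissible shock of speed `s`: the Rankine-Hugoniot conditions for mass and both components
of momentum, and the entropy shock condition for the energy. -/
structure IsAdmissibleShock (γ r : ℝ) (w : Plane) (r' : ℝ) (w' : Plane) (s : ℝ) : Prop where
  mass : s * (r' - r) = r' * w' 1 - r * w 1
  momentum_one : s * (r' * w' 0 - r * w 0) = r' * w' 0 * w' 1 - r * w 0 * w 1
  momentum_two : s * (r' * w' 1 - r * w 1)
    = (r' * w' 1 ^ 2 + pressure γ r') - (r * w 1 ^ 2 + pressure γ r)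
  entropy : (energy γ r' w' + pressure γ r') * w' 1 - (energy γ r w + pressure γ r) * w 1
    ≤ s * (energy γ r' w' - energy γ r w)

/-- An admissible shock of the first family: the speed lies between the values of the
characteristic speed `λ₁ = v₂ - √p'(ρ)` on its two sides. -/
structure IsAdmissibleOneShock (γ r : ℝ) (w : Plane) (r' : ℝ) (w' : Plane) (s : ℝ) : Prop
    extends IsAdmissibleShock γ r w r' w' s where
  left : s < w 1 - soundSpeed γ r
  right : w' 1 - soundSpeed γ r' < s

/-- An admissible shock of the third family: the speed lies between the values of the
characteristic speed `λ₃ = v₂ + √p'(ρ)` on its two sides. -/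
structure IsAdmissibleThreeShock (γ r : ℝ) (w : Plane) (r' : ℝ) (w' : Plane) (s : ℝ) : Prop
    extends IsAdmissibleShock γ r w r' w' s where
  left : s < w 1 + soundSpeed γ r
  right : w' 1 + soundSpeed γ r' < s

/-- The self-similar solution of the Riemann problem with left state `(ρl, vl)` and right state
`(ρr, vr)` consists of an admissible 1-shock of speed `s₁` followed by an admissible 3-shock of
speed `s₃ > s₁`, with intermediate state `(ρmid, vmid)`. -/
def HasTwoShockSolution (γ ρl : ℝ) (vl : Plane) (ρr : ℝ) (vr : Plane) : Prop :=
  ∃ (ρmid : ℝ) (vmid : Plane) (s₁ s₃ : ℝ), 0 < ρmid ∧ s₁ < s₃ ∧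
    IsAdmissibleOneShock γ ρl vl ρmid vmid s₁ ∧
    IsAdmissibleThreeShock γ ρmid vmid ρr vr s₃

/-- There are infinitely many bounded admissible weak solutions without vacuum: a sequence of
them, no two of which agree almost everywhere on `ℝ² × (0, ∞)`. -/
def HasInfinitelyManySolutions (γ : ℝ) (ρ₀ : Plane → ℝ) (v₀ : Plane → Plane) : Prop :=
  ∃ (ρ : ℕ → Plane × ℝ → ℝ) (v : ℕ → Plane × ℝ → Plane),
    (∀ n, IsAdmissibleSolution γ ρ₀ v₀ (ρ n) (v n) ∧ HasNoVacuum (ρ n)) ∧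
    ∀ m n, m ≠ n → ¬ ∀ᵐ z ∂spaceTimeMeasure, ρ m z = ρ n z ∧ v m z = v n z

end IsentropicEuler

end

open Filter Topology Set

namespace IsentropicEuler

/-! ### The pressure law and the internal energy -/

/-! Two independent facts are combined. The equivalence is classical shock theory. The
Rankine-Hugoniot conditions make the normal mass flux continuous; the Lax inequalities make it
nonzero and the shock compressive. Hence the tangential velocity is continuous and the normal
velocity drops by the function `velocityJump` of densities and pressures
(`IsAdmissibleOneShock.eq_and_lt`). Conversely every compressive drop of this size is an admissible
shock (`oneShock_of_velocityJump`), with strict energy inequality because the pressure is strictly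
convex in the specific volume. As a function of the middle density the sum of the two drops is
continuous, increasing and unbounded, and at the larger outer density it equals the drop between the
outer states; this gives the threshold (`hasTwoShockSolution_iff`).

The solutions come from convex integration. Outside a sector νl t < x₂ < νr t they equal the Riemann
data; inside, the density is a constant ρ and the velocity V oscillates with |V|² = C constant. On
average the oscillation adds ρ κ₁ to the pressure in the normal direction (`IsFanSubsolution`), so
the effective pressure of the averaged state is a parameter independent of its density. The
two-shock solution is the degenerate case κ₁ = κ₂ = 0. Its energy inequalities are strict, so they
survive a small change that lowers the density, raises the effective pressure and keeps the total
velocity drop (`exists_perturbed_middle_state`, `exists_fanSubsolution`).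

Since |V|² is constant, V ⊗ V is its traceless part plus a constant matrix, the energy density is
constant and the energy flux is a constant multiple of V. All balance laws in the sector thus reduce
to the linear system div v = 0, ∂ₜ v + div u = 0, with u the traceless part of V ⊗ V. What remains
are interface terms whose coefficients are the Rankine-Hugoniot and energy defects of the
subsolution (`integral_fanField`, `IsFanVelocity.balance`).

Such V are reached from the constant averaged state, which lies in the interior of the convex hull
of the constraint set. Through every relaxed state passes a wave-cone segment of length controlled
by C - |v|² (`exists_segment_relaxedStates`). Localized high-frequency waves along these segments
raise the L² energy by a multiple of the squared deficit and are almost orthogonal to finitely many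
given functions (`IsRelaxedField.exists_perturbation`). Iterating with all earlier iterates among
those functions gives strong convergence to a field of maximal energy, so |V|² = C almost everywhere
(`exists_mem_closure_norm_sq_eq`, `maximal_limit_properties`). These limits can be taken weakly as
close as desired to the constant state, whose energy is strictly smaller, so there are infinitely
many (`exists_infinitely_many_fields`). -/

theorem pressure_tangent_le {γ a b : ℝ} (hγ : 1 ≤ γ) (ha : 0 < a) (hb : 0 < b) :
    pressure γ a + γ * a ^ (γ - 1) * (b - a) ≤ pressure γ b := by
  have h := one_add_mul_self_le_rpow_one_add (s := b / a - 1)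
    (by have := div_pos hb ha; linarith) hγ
  rw [add_sub_cancel, Real.div_rpow hb.le ha.le, le_div_iff₀ (Real.rpow_pos_of_pos ha _)] at h
  have h2 : a ^ γ = a ^ (γ - 1) * a := by
    rw [Real.rpow_sub_one ha.ne']; field_simp
  unfold pressure
  have h3 : γ * (b / a - 1) * a ^ γ = γ * a ^ (γ - 1) * (b - a) := by
    rw [h2]; field_simp
  nlinarith

theorem pressure_strictMono {γ a b : ℝ} (hγ : 1 ≤ γ) (ha : 0 < a) (hab : a < b) :
    pressure γ a < pressure γ b :=
  Real.rpow_lt_rpow ha.le hab (by linarith)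

theorem sound_sq_pos {γ a : ℝ} (hγ : 1 ≤ γ) (ha : 0 < a) : 0 < γ * a ^ (γ - 1) :=
  mul_pos (by linarith) (Real.rpow_pos_of_pos ha _)

theorem hasDerivAt_pressure {γ a : ℝ} (ha : 0 < a) :
    HasDerivAt (pressure γ) (γ * a ^ (γ - 1)) a :=
  Real.hasDerivAt_rpow_const (Or.inl ha.ne')

theorem hasDerivAt_internalEnergy {γ a : ℝ} (ha : 0 < a) :
    HasDerivAt (internalEnergy γ) (pressure γ a / a ^ 2) a := by
  unfold internalEnergy pressure
  by_cases h : γ = 1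
  · simp only [h, if_true, Real.rpow_one]
    refine (Real.hasDerivAt_log ha.ne').congr_deriv ?_
    field_simp
  · simp only [h, if_false]
    have h1 : γ - 1 ≠ 0 := sub_ne_zero.2 h
    refine ((Real.hasDerivAt_rpow_const (p := γ - 1) (Or.inl ha.ne')).div_const
      (γ - 1)).congr_deriv ?_
    rw [show γ - 1 - 1 = γ - 2 by ring, Real.rpow_sub ha, Real.rpow_two]
    field_simp

/-- In terms of the specific volume `1 / ρ` the pressure is strictly convex, so that the
trapezoidal rule overestimates the difference of the internal energies. -/
theorem internalEnergy_sub_lt {γ a b : ℝ} (hγ : 1 ≤ γ) (ha : 0 < a) (hab : a < b) :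
    internalEnergy γ b - internalEnergy γ a
      < (pressure γ a + pressure γ b) / 2 * (1 / a - 1 / b) := by
  -- Up to a constant, the error of the trapezoidal rule between `a` and `x`. Its derivative times
  -- `2 * x ^ 2` is a positive square term plus the gap in the tangent inequality at `x`.
  set h : ℝ → ℝ := fun x => (pressure γ a + pressure γ x) / 2 * (1 / a - 1 / x)
    - internalEnergy γ x with hh
  have hder : ∀ x, 0 < x → HasDerivAt h (γ * x ^ (γ - 1) / 2 * (1 / a - 1 / x)
      + (pressure γ a + pressure γ x) / 2 * (1 / x ^ 2) - pressure γ x / x ^ 2) x := by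
    intro x hx
    have h1 : HasDerivAt (fun x : ℝ => 1 / a - 1 / x) (1 / x ^ 2) x := by
      simp only [one_div]
      exact ((hasDerivAt_inv hx.ne').const_sub a⁻¹).congr_deriv (neg_neg _)
    exact ((((hasDerivAt_pressure hx).const_add _).div_const 2).mul h1).sub
      (hasDerivAt_internalEnergy hx)
  have hmono : StrictMonoOn h (Icc a b) := by
    refine strictMonoOn_of_deriv_pos (convex_Icc a b) ?_ ?_
    · intro x hx
      exact (hder x (ha.trans_le hx.1)).continuousAt.continuousWithinAt
    · intro x hx
      rw [interior_Icc] at hx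
      have hx0 : 0 < x := ha.trans hx.1
      rw [(hder x hx0).deriv]
      have ht := pressure_tangent_le hγ hx0 ha
      have hs := sound_sq_pos hγ hx0
      set c := γ * x ^ (γ - 1)
      have e : c / 2 * (1 / a - 1 / x) + (pressure γ a + pressure γ x) / 2 * (1 / x ^ 2)
          - pressure γ x / x ^ 2
          = (c * (x - a) * (x - a) / a + (pressure γ a - (pressure γ x + c * (a - x))))
            / (2 * x ^ 2) := by
        field_simp; ring
      rw [e]
      have : 0 < c * (x - a) * (x - a) / a := by
        have := sub_pos.2 hx.1
        positivity
      apply div_pos _ (by positivity)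
      linarith
  have := hmono (left_mem_Icc.2 hab.le) (right_mem_Icc.2 hab.le) hab
  simp only [hh, sub_self, mul_zero] at this
  linarith

theorem energy_eq (γ r : ℝ) (w : Plane) :
    energy γ r w = r * internalEnergy γ r + r * ((w 0 ^ 2 + w 1 ^ 2) / 2) := by
  simp [energy, EuclideanSpace.norm_sq_eq, Fin.sum_univ_two]

/-! ### Shocks -/

/-- The modulus of the jump of the normal velocity across a shock between the states with density
and pressure `(a, pa)` and `(r, q)`. -/
noncomputable def velocityJump (a pa r q : ℝ) : ℝ := √((r - a) * (q - pa) / (r * a))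

theorem velocityJump_sq {a pa r q : ℝ} (ha : 0 < a) (hr : a ≤ r) (hq : pa ≤ q) :
    velocityJump a pa r q ^ 2 * (r * a) = (r - a) * (q - pa) := by
  have hr0 := ha.trans_le hr
  rw [velocityJump, Real.sq_sqrt]
  · field_simp
  · have := sub_nonneg.2 hr
    have := sub_nonneg.2 hq
    positivity

theorem velocityJump_pos {a pa r q : ℝ} (ha : 0 < a) (hr : a < r) (hq : pa < q) :
    0 < velocityJump a pa r q := by
  have hr0 := ha.trans hr
  have := sub_pos.2 hr
  have := sub_pos.2 hq
  exact Real.sqrt_pos.2 (by positivity)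

/-- The radicand is `(1 - a / r) * (q - pa) / a`, and both factors increase. The pressure is a
variable of its own because the effective pressure of a subsolution is not `pressure γ r`. -/
theorem velocityJump_lt {a pa r q r' q' : ℝ} (ha : 0 < a) (hr : a < r') (hr' : a ≤ r)
    (hrr : r ≤ r') (hq : pa < q') (hqq : q ≤ q') (hq' : pa ≤ q) (h : r < r' ∨ q < q') :
    velocityJump a pa r q < velocityJump a pa r' q' := by
  have hr0 := ha.trans_le hr'
  have hr1 := ha.trans hr
  have e : ∀ r q : ℝ, 0 < r → (r - a) * (q - pa) / (r * a) = (1 - a / r) * (q - pa) / a := by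
    intro r q h; field_simp
  unfold velocityJump
  apply Real.sqrt_lt_sqrt
  · have := sub_nonneg.2 hr'
    have := sub_nonneg.2 hq'
    positivity
  · rw [e r q hr0, e r' q' hr1]
    have h1 : 0 ≤ 1 - a / r := sub_nonneg.2 ((div_le_one hr0).2 hr')
    have h2 : 0 < 1 - a / r' := sub_pos.2 ((div_lt_one hr1).2 hr)
    have h3 : 1 - a / r ≤ 1 - a / r' := by gcongr
    apply div_lt_div_of_pos_right _ ha
    rcases h with h | h
    · have h4 : 1 - a / r < 1 - a / r' := by gcongr
      nlinarith
    · nlinarith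

/-- Reflection exchanges the 1-shocks and the 3-shocks. -/
theorem isAdmissibleThreeShock_iff_neg {γ r r' s : ℝ} {w w' : Plane} :
    IsAdmissibleThreeShock γ r w r' w' s ↔ IsAdmissibleOneShock γ r' (-w') r (-w) (-s) := by
  have e : ∀ r w, energy γ r (-w) = energy γ r w := fun r w => by simp [energy]
  constructor
  · rintro ⟨⟨h1, h2, h3, h4⟩, h5, h6⟩
    refine ⟨⟨?_, ?_, ?_, ?_⟩, ?_, ?_⟩ <;> simp only [e, PiLp.neg_apply] <;> linarith
  · rintro ⟨⟨h1, h2, h3, h4⟩, h5, h6⟩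
    simp only [e, PiLp.neg_apply] at h1 h2 h3 h4 h5 h6
    refine ⟨⟨?_, ?_, ?_, ?_⟩, ?_, ?_⟩ <;> linarith

/-- The speed is forced by the mass balance; the momentum balance then reduces to the formula for
the square of the jump. As `q` is arbitrary, this serves genuine shocks and the interfaces of a
subsolution alike. -/
theorem rankineHugoniot_of_velocityJump {a pa r q v : ℝ} (ha : 0 < a) (hr : a < r) (hq : pa ≤ q) :
    (v - velocityJump a pa r q * (r / (r - a))) * (r - a)
        = r * (v - velocityJump a pa r q) - a * v ∧
      (v - velocityJump a pa r q * (r / (r - a))) * (r * (v - velocityJump a pa r q) - a * v)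
        = (r * (v - velocityJump a pa r q) ^ 2 + q) - (a * v ^ 2 + pa) := by
  have hJ := velocityJump_sq ha hr.le hq
  set J := velocityJump a pa r q
  have h0 : r - a ≠ 0 := (sub_pos.2 hr).ne'
  refine ⟨by field_simp; ring, ?_⟩
  have h1 : q - pa = J ^ 2 * (r * a) / (r - a) := by rw [hJ]; field_simp
  rw [show r * (v - J) ^ 2 + q - (a * v ^ 2 + pa) = r * (v - J) ^ 2 - a * v ^ 2 + (q - pa) by ring,
    h1]
  field_simp
  ring

/-- The sonic mass flux grows with the density. The Lax inequalities place the mass flux of a shock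
between the two sonic fluxes, so this monotonicity forces compression. -/
theorem mul_soundSpeed_lt {γ a b : ℝ} (hγ : 1 ≤ γ) (ha : 0 < a) (hab : a < b) :
    a * soundSpeed γ a < b * soundSpeed γ b := by
  have h1 : soundSpeed γ a ≤ soundSpeed γ b := by
    apply Real.sqrt_le_sqrt
    have := Real.rpow_le_rpow ha.le hab.le (sub_nonneg.2 hγ)
    nlinarith
  have h2 : 0 < soundSpeed γ a := Real.sqrt_pos.2 (sound_sq_pos hγ ha)
  nlinarith

/-- The mass flux `r * (w 1 - s)` is positive by the left Lax inequality. Dividing the tangential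
momentum balance by it removes the tangential jump, comparison with the sonic fluxes orders the
densities, and eliminating `s` from the remaining balances gives the size of the drop. -/
theorem IsAdmissibleOneShock.eq_and_lt {γ r r' s : ℝ} {w w' : Plane} (hγ : 1 ≤ γ) (hr : 0 < r)
    (hr' : 0 < r') (h : IsAdmissibleOneShock γ r w r' w' s) :
    w 0 = w' 0 ∧ r < r' ∧ s < w' 1 ∧
      w 1 - w' 1 = velocityJump r (pressure γ r) r' (pressure γ r') := by
  obtain ⟨⟨h1, h2, h3, -⟩, h5, h6⟩ := h
  have hc : 0 < soundSpeed γ r := Real.sqrt_pos.2 (sound_sq_pos hγ hr)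
  have hm : r' * (w' 1 - s) = r * (w 1 - s) := by linarith
  have hj : 0 < r * (w 1 - s) := mul_pos hr (by linarith)
  have h0 : r * (w 1 - s) * (w' 0 - w 0) = 0 := by
    linear_combination (-1) * h2 + w' 0 * h1
  have hlt : r < r' := by
    by_contra hcon
    have h7 : r * soundSpeed γ r < r * (w 1 - s) := by nlinarith
    have h8 : r' * (w' 1 - s) < r' * soundSpeed γ r' := by nlinarith
    rcases (not_lt.1 hcon).lt_or_eq with h9 | h9
    · have := mul_soundSpeed_lt hγ hr' h9
      linarith
    · subst h9; linarith
  have hs : 0 < w' 1 - s := by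
    by_contra hcon
    nlinarith
  have hpd : pressure γ r' - pressure γ r = r * (w 1 - s) * (w 1 - w' 1) := by
    linear_combination (-1) * h3 + w' 1 * h1
  have hp := pressure_strictMono hγ hr hlt
  have hpos : 0 ≤ w 1 - w' 1 := by
    by_contra hcon
    nlinarith
  refine ⟨?_, hlt, by linarith, ?_⟩
  · rcases mul_eq_zero.1 h0 with h | h
    · exact absurd h hj.ne'
    · linarith
  · rw [velocityJump, eq_comm, Real.sqrt_eq_iff_mul_self_eq]
    · rw [hpd]
      field_simp
      linear_combination (w 1 - w' 1) * hm
    · have := sub_pos.2 hlt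
      have := sub_pos.2 hp
      positivity
    · exact hpos

/-- Everything comes from convexity: the chord slope of the pressure lies between the two values of
p', which gives the Lax inequalities, and the dissipated energy is the mass flux times the gap in
`internalEnergy_sub_lt`. The strict energy inequality is what leaves room for a subsolution; the
position of the speed relative to `w' 1` later orders the two shocks. -/
theorem oneShock_of_velocityJump {γ r r' : ℝ} {w w' : Plane} (hγ : 1 ≤ γ) (hr : 0 < r)
    (hlt : r < r') (h0 : w 0 = w' 0)
    (h1 : w' 1 = w 1 - velocityJump r (pressure γ r) r' (pressure γ r')) :
    IsAdmissibleOneShock γ r w r' w'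
      (w 1 - velocityJump r (pressure γ r) r' (pressure γ r') * (r' / (r' - r))) ∧
    (energy γ r' w' + pressure γ r') * w' 1 - (energy γ r w + pressure γ r) * w 1
      < (w 1 - velocityJump r (pressure γ r) r' (pressure γ r') * (r' / (r' - r)))
        * (energy γ r' w' - energy γ r w) ∧
    w 1 - velocityJump r (pressure γ r) r' (pressure γ r') * (r' / (r' - r)) < w' 1 := by
  have hp := pressure_strictMono hγ hr hlt
  have hr' := hr.trans hlt
  obtain ⟨hm, hmom⟩ := rankineHugoniot_of_velocityJump (v := w 1) hr hlt hp.le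
  have hJ := velocityJump_sq hr hlt.le hp.le
  have hJp := velocityJump_pos hr hlt hp
  have hint := internalEnergy_sub_lt hγ hr hlt
  have ht1 := pressure_tangent_le hγ hr hr'
  have ht2 := pressure_tangent_le hγ hr' hr
  have hc1 := sound_sq_pos hγ hr
  have hc2 := sound_sq_pos hγ hr'
  have hd : 0 < r' - r := sub_pos.2 hlt
  set J := velocityJump r (pressure γ r) r' (pressure γ r') with hJdef
  rw [← h1] at hm hmom
  set s := w 1 - J * (r' / (r' - r)) with hs
  have hes : J * (r' / (r' - r)) = w 1 - s := by rw [hs]; ring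
  have hsw : s - w' 1 = - (J * (r / (r' - r))) := by
    rw [hs, h1]; field_simp; ring
  have hsw' : 0 < J * (r / (r' - r)) := by positivity
  have hent : (energy γ r' w' + pressure γ r') * w' 1 - (energy γ r w + pressure γ r) * w 1
      < s * (energy γ r' w' - energy γ r w) := by
    rw [energy_eq, energy_eq, h0]
    set e := internalEnergy γ r
    set e' := internalEnergy γ r'
    set p := pressure γ r
    set p' := pressure γ r'
    have hj : 0 < r * (w 1 - s) := by rw [← hes]; positivity
    have key : r * (w 1 - s) * ((p + p') / 2 * (1 / r - 1 / r') - (e' - e)) > 0 :=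
      mul_pos hj (by linarith)
    have hjj : r' * (w' 1 - s) = r * (w 1 - s) := by linarith
    have hpd : p' - p = r * (w 1 - s) * (w 1 - w' 1) := by
      linear_combination (-1) * hmom + w' 1 * hm
    have e1 : r * (w 1 - s) * (1 / r - 1 / r') = w 1 - w' 1 := by
      field_simp
      linear_combination hjj
    have : r * (w 1 - s) * ((p + p') / 2 * (1 / r - 1 / r') - (e' - e))
        = s * (r' * e' + r' * ((w' 0 ^ 2 + w' 1 ^ 2) / 2) - (r * e + r * ((w' 0 ^ 2 + w 1 ^ 2) / 2)))
          - ((r' * e' + r' * ((w' 0 ^ 2 + w' 1 ^ 2) / 2) + p') * w' 1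
            - (r * e + r * ((w' 0 ^ 2 + w 1 ^ 2) / 2) + p) * w 1) := by
      linear_combination (p + p') / 2 * e1 + (e' + (w' 0 ^ 2 + w' 1 ^ 2) / 2) * hjj
        + (w 1 + w' 1) / 2 * hpd
    linarith
  refine ⟨⟨⟨hm, ?_, hmom, hent.le⟩, ?_, ?_⟩, hent, by linarith⟩
  · rw [h0]; linear_combination w' 0 * hm
  · have : soundSpeed γ r < J * (r' / (r' - r)) := by
      apply Real.sqrt_lt' (by positivity) |>.2
      rw [mul_pow, div_pow]
      -- The squared relative speed is the chord slope of the pressure times a ratio of densities,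
      -- which exceeds 1 on this side and is below 1 on the other.
      have : J ^ 2 * (r' ^ 2 / (r' - r) ^ 2)
          = (pressure γ r' - pressure γ r) / (r' - r) * (r' / r) := by
        field_simp
        linear_combination hJ
      rw [this]
      have h3 : γ * r ^ (γ - 1) ≤ (pressure γ r' - pressure γ r) / (r' - r) := by
        rw [le_div_iff₀ hd]; linarith
      have h4 : 1 < r' / r := (one_lt_div hr).2 hlt
      nlinarith
    linarith
  · have : J * (r / (r' - r)) < soundSpeed γ r' := by
      apply Real.lt_sqrt (by positivity) |>.2
      rw [mul_pow, div_pow]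
      have : J ^ 2 * (r ^ 2 / (r' - r) ^ 2)
          = (pressure γ r' - pressure γ r) / (r' - r) * (r / r') := by
        field_simp
        linear_combination hJ
      rw [this]
      have h3 : (pressure γ r' - pressure γ r) / (r' - r) ≤ γ * r' ^ (γ - 1) := by
        rw [div_le_iff₀ hd]; linarith
      have h4 : r / r' < 1 := (div_lt_one hr').2 hlt
      have h5 : 0 < (pressure γ r' - pressure γ r) / (r' - r) := div_pos (sub_pos.2 hp) hd
      nlinarith
    linarith

/-! ### Solvability of the Riemann problem by two shocks -/

theorem velocityJump_comm (a pa r q : ℝ) : velocityJump a pa r q = velocityJump r q a pa := by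
  unfold velocityJump
  rw [show (r - a) * (q - pa) / (r * a) = (a - r) * (pa - q) / (a * r) by
    rw [mul_comm r a]; ring]

theorem velocityJump_self (a pa q : ℝ) : velocityJump a pa a q = 0 := by
  simp [velocityJump]

theorem exists_lt_velocityJump {γ a : ℝ} (hγ : 1 ≤ γ) (ha : 0 < a) (b Δ : ℝ) :
    ∃ r, a < r ∧ b < r ∧ Δ < velocityJump a (pressure γ a) r (pressure γ r) := by
  have hc := sound_sq_pos hγ ha
  set c := γ * a ^ (γ - 1) with hcdef
  -- The summand `2 * a` makes `r - a` at least `r / 2`, the summands `|b| + 1` put `r` above `b`,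
  -- and the quotient beats `Δ ^ 2` through the tangent of the pressure at `a`.
  refine ⟨2 * a + |b| + 2 * a * Δ ^ 2 / c + 1, ?_, ?_, ?_⟩
  · have : 0 ≤ 2 * a * Δ ^ 2 / c := by positivity
    have := abs_nonneg b
    linarith
  · have : 0 ≤ 2 * a * Δ ^ 2 / c := by positivity
    have := le_abs_self b
    linarith
  · set r := 2 * a + |b| + 2 * a * Δ ^ 2 / c + 1 with hr
    have h1 : 0 ≤ 2 * a * Δ ^ 2 / c := by positivity
    have h2 := abs_nonneg b
    have hr2 : 2 * a ≤ r := by linarith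
    have hr0 : 0 < r := by linarith
    have ht := pressure_tangent_le hγ ha hr0
    refine Real.lt_sqrt_of_sq_lt ?_
    rw [lt_div_iff₀ (by positivity)]
    have h3 : r / 2 * (c * (r - a)) ≤ (r - a) * (pressure γ r - pressure γ a) := by
      apply mul_le_mul <;> nlinarith
    refine lt_of_lt_of_le ?_ h3
    have h4 : 2 * a * Δ ^ 2 < c * (r - a) := by
      have : c * (2 * a * Δ ^ 2 / c) = 2 * a * Δ ^ 2 := by field_simp
      have h5 : 2 * a * Δ ^ 2 / c < r - a := by linarith
      nlinarith
    nlinarith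

theorem continuousAt_velocityJump {a pa : ℝ} (ha : 0 < a) {x : ℝ × ℝ} (hx : 0 < x.1) :
    ContinuousAt (fun x : ℝ × ℝ => velocityJump a pa x.1 x.2) x := by
  unfold velocityJump
  refine Real.continuous_sqrt.continuousAt.comp (ContinuousAt.div (by fun_prop) (by fun_prop) ?_)
  positivity

theorem continuousAt_pressure {γ r : ℝ} (hr : 0 < r) : ContinuousAt (pressure γ) r :=
  (hasDerivAt_pressure hr).continuousAt

/-- The intermediate density of the two-shock solution. -/
theorem exists_middle_density {γ a b Δ : ℝ} (hγ : 1 ≤ γ) (ha : 0 < a) (hb : 0 < b)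
    (h : velocityJump a (pressure γ a) b (pressure γ b) < Δ) :
    ∃ r, a < r ∧ b < r ∧ velocityJump a (pressure γ a) r (pressure γ r)
      + velocityJump b (pressure γ b) r (pressure γ r) = Δ := by
  wlog hab : a ≤ b generalizing a b
  · obtain ⟨r, h1, h2, h3⟩ := this hb ha (by rwa [velocityJump_comm]) (le_of_not_ge hab)
    exact ⟨r, h2, h1, by rwa [add_comm]⟩
  obtain ⟨R, haR, hbR, hR⟩ := exists_lt_velocityJump hγ ha b Δ
  set F : ℝ → ℝ := fun r => velocityJump a (pressure γ a) r (pressure γ r)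
      + velocityJump b (pressure γ b) r (pressure γ r) with hF
  have hcont : ContinuousOn F (Icc b R) := by
    intro r hr
    have hr0 : 0 < r := hb.trans_le hr.1
    have hg : ContinuousAt (fun r : ℝ => (r, pressure γ r)) r :=
      continuousAt_id.prodMk (continuousAt_pressure hr0)
    have h1 : ContinuousAt (fun r : ℝ => velocityJump a (pressure γ a) r (pressure γ r)) r :=
      ContinuousAt.comp (f := fun r : ℝ => (r, pressure γ r))
        (g := fun x : ℝ × ℝ => velocityJump a (pressure γ a) x.1 x.2)
        (continuousAt_velocityJump ha (x := (r, pressure γ r)) hr0) hg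
    have h2 : ContinuousAt (fun r : ℝ => velocityJump b (pressure γ b) r (pressure γ r)) r :=
      ContinuousAt.comp (f := fun r : ℝ => (r, pressure γ r))
        (g := fun x : ℝ × ℝ => velocityJump b (pressure γ b) x.1 x.2)
        (continuousAt_velocityJump hb (x := (r, pressure γ r)) hr0) hg
    exact (h1.add h2).continuousWithinAt
  -- At the larger outer density the second drop vanishes.
  have h1 : F b < Δ := by simpa [hF, velocityJump_self] using h
  have h2 : Δ < F R := hR.trans_le (le_add_of_nonneg_right (Real.sqrt_nonneg _))
  obtain ⟨r, hr, hr'⟩ := intermediate_value_Ioo hbR.le hcont ⟨h1, h2⟩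
  exact ⟨r, hab.trans_lt hr.1, hr.1, hr'⟩

/-- The reflection w ↦ -w together with an exchange of the two states reduces this to
`oneShock_of_velocityJump`. -/
theorem threeShock_of_velocityJump {γ r r' : ℝ} {w w' : Plane} (hγ : 1 ≤ γ) (hr' : 0 < r')
    (hlt : r' < r) (h0 : w 0 = w' 0)
    (h1 : w 1 = w' 1 + velocityJump r' (pressure γ r') r (pressure γ r)) :
    IsAdmissibleThreeShock γ r w r' w'
      (w' 1 + velocityJump r' (pressure γ r') r (pressure γ r) * (r / (r - r'))) ∧
    (energy γ r' w' + pressure γ r') * w' 1 - (energy γ r w + pressure γ r) * w 1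
      < (w' 1 + velocityJump r' (pressure γ r') r (pressure γ r) * (r / (r - r')))
        * (energy γ r' w' - energy γ r w) ∧
    w 1 < w' 1 + velocityJump r' (pressure γ r') r (pressure γ r) * (r / (r - r')) := by
  obtain ⟨h2, h3, h4⟩ := oneShock_of_velocityJump (w := -w') (w' := -w) hγ hr' hlt
    (by simp [h0]) (by simp only [PiLp.neg_apply, h1]; ring)
  have e : ∀ r w, energy γ r (-w) = energy γ r w := fun r w => by simp [energy]
  simp only [e, PiLp.neg_apply] at h2 h3 h4
  refine ⟨?_, by linarith, by linarith⟩
  rw [isAdmissibleThreeShock_iff_neg]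
  convert h2 using 1
  ring

/-- For necessity, the middle density exceeds both outer ones, so the drop from the smaller outer
density alone already beats the drop between the outer states. Sufficiency is
`exists_middle_density`. -/
theorem hasTwoShockSolution_iff {γ ρl ρr : ℝ} {vl vr : Plane} (hγ : 1 ≤ γ) (hρl : 0 < ρl)
    (hρr : 0 < ρr) :
    HasTwoShockSolution γ ρl vl ρr vr ↔ vl 0 = vr 0 ∧
      velocityJump ρl (pressure γ ρl) ρr (pressure γ ρr) < vl 1 - vr 1 := by
  constructor
  · rintro ⟨ρm, vm, s₁, s₃, hm, -, h1, h3⟩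
    obtain ⟨a0, a1, -, a2⟩ := h1.eq_and_lt hγ hρl hm
    obtain ⟨b0, b1, -, b2⟩ := (isAdmissibleThreeShock_iff_neg.1 h3).eq_and_lt hγ hρr hm
    simp only [PiLp.neg_apply, neg_inj] at b0 b2
    refine ⟨a0.trans b0.symm, ?_⟩
    have hpl := pressure_strictMono hγ hρl a1
    have hpr := pressure_strictMono hγ hρr b1
    have hl := velocityJump_pos hρl a1 hpl
    have hr := velocityJump_pos hρr b1 hpr
    rcases le_total ρl ρr with hle | hle
    · have hp : pressure γ ρl ≤ pressure γ ρr := Real.rpow_le_rpow hρl.le hle (by linarith)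
      have := velocityJump_lt hρl a1 hle b1.le hpl hpr.le hp (Or.inl b1)
      linarith
    · have hp : pressure γ ρr ≤ pressure γ ρl := Real.rpow_le_rpow hρr.le hle (by linarith)
      have := velocityJump_lt hρr b1 hle a1.le hpr hpl.le hp (Or.inl a1)
      rw [velocityJump_comm] at this
      linarith
  · rintro ⟨h0, h⟩
    obtain ⟨ρm, h1, h2, h3⟩ := exists_middle_density hγ hρl hρr h
    set J := velocityJump ρl (pressure γ ρl) ρm (pressure γ ρm) with hJ
    obtain ⟨a1, -, a2⟩ := oneShock_of_velocityJump (w := vl) (w' := !₂[vl 0, vl 1 - J]) hγ hρl h1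
      (by simp) (by simp [hJ])
    obtain ⟨b1, -, b2⟩ := threeShock_of_velocityJump (w := !₂[vl 0, vl 1 - J]) (w' := vr) hγ hρr h2
      (by simp [h0]) (by simp; linarith)
    exact ⟨ρm, _, _, _, hρl.trans h1, a2.trans b2, a1, b1⟩

theorem velocityJump_lt_iff {γ ρl ρr : ℝ} {a b : ℝ} :
    b - a < -√((ρl - ρr) * (pressure γ ρl - pressure γ ρr) / (ρl * ρr)) ↔
      velocityJump ρl (pressure γ ρl) ρr (pressure γ ρr) < a - b := by
  rw [velocityJump_comm, velocityJump]
  constructor <;> intro h <;> linarith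

/-! ### Fan subsolutions close to the two-shock solution -/

/-- A two-shock solution can be perturbed to one whose intermediate state has a slightly smaller
density and a slightly larger pressure. -/
theorem exists_perturbed_middle_state {a pa b pb r q Δ : ℝ} (ha : 0 < a) (hb : 0 < b)
    (har : a < r) (hbr : b < r) (haq : pa < q) (hbq : pb < q)
    (h : velocityJump a pa r q + velocityJump b pb r q = Δ) {N : Set (ℝ × ℝ)}
    (hN : N ∈ 𝓝 (r, q)) :
    ∃ r' q', a < r' ∧ b < r' ∧ r' < r ∧ q < q' ∧
      velocityJump a pa r' q' + velocityJump b pb r' q' = Δ ∧ (r', q') ∈ N := by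
  set F : ℝ × ℝ → ℝ := fun x => velocityJump a pa x.1 x.2 + velocityJump b pb x.1 x.2 with hF
  have hcF : ∀ x : ℝ × ℝ, 0 < x.1 → ContinuousAt F x := fun x hx =>
    (continuousAt_velocityJump ha hx).add (continuousAt_velocityJump hb hx)
  rw [nhds_prod_eq, mem_prod_iff] at hN
  obtain ⟨N₁, hN₁, N₂, hN₂, hsub⟩ := hN
  obtain ⟨r₁, hr₁, hr₁N⟩ : ∃ r₁, (a < r₁ ∧ b < r₁ ∧ r₁ < r) ∧ Icc r₁ r ⊆ N₁ := by
    obtain ⟨l, hlr, hlN⟩ := exists_Ioc_subset_of_mem_nhds hN₁ ⟨r - 1, sub_one_lt r⟩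
    refine ⟨(max l (max a b) + r) / 2, ⟨?_, ?_, ?_⟩, ?_⟩
    · have := le_max_left a b; have := le_max_right l (max a b); linarith
    · have := le_max_right a b; have := le_max_right l (max a b); linarith
    · have : max l (max a b) < r := max_lt hlr (max_lt har hbr)
      linarith
    · intro x hx
      refine hlN ⟨lt_of_lt_of_le ?_ hx.1, hx.2⟩
      have : l < r := hlr
      have := le_max_left l (max a b)
      linarith
  -- Lowering the density to `r₁` pulls the total drop strictly below `Δ`, and a slightly raised
  -- pressure does not undo this. At the density `r` the raised pressure pushes the drop above `Δ`,
  -- so some density in between restores it.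
  have h1 : F (r₁, q) < Δ := by
    rw [← h]
    have e1 := velocityJump_lt ha har hr₁.1.le hr₁.2.2.le haq le_rfl haq.le (Or.inl hr₁.2.2)
    have e2 := velocityJump_lt hb hbr hr₁.2.1.le hr₁.2.2.le hbq le_rfl hbq.le (Or.inl hr₁.2.2)
    exact add_lt_add e1 e2
  have h2 : ∀ᶠ q' in 𝓝 q, F (r₁, q') < Δ := by
    have hc : ContinuousAt (fun q' => F (r₁, q')) q :=
      ContinuousAt.comp (f := fun q' => (r₁, q')) (g := F) (hcF _ (ha.trans hr₁.1))
        (by fun_prop)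
    exact hc.eventually_lt continuousAt_const h1
  obtain ⟨q', ⟨hq1, hq2⟩, hq3⟩ :=
    (((h2.and hN₂).filter_mono nhdsWithin_le_nhds).and
      (self_mem_nhdsWithin : Ioi q ∈ 𝓝[>] q)).exists
  have hq3' : q < q' := hq3
  have h3 : Δ < F (r, q') := by
    rw [← h]
    have e1 := velocityJump_lt ha har har.le le_rfl (haq.trans hq3') hq3'.le haq.le (Or.inr hq3')
    have e2 := velocityJump_lt hb hbr hbr.le le_rfl (hbq.trans hq3') hq3'.le hbq.le (Or.inr hq3')
    exact add_lt_add e1 e2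
  have hcont : ContinuousOn (fun x => F (x, q')) (Icc r₁ r) := by
    intro x hx
    have hx0 : 0 < x := ha.trans (hr₁.1.trans_le hx.1)
    exact (ContinuousAt.comp (f := fun x => (x, q')) (g := F) (hcF _ hx0)
      (by fun_prop)).continuousWithinAt
  obtain ⟨r', hr', hr''⟩ := intermediate_value_Ioo hr₁.2.2.le hcont ⟨hq1, h3⟩
  exact ⟨r', q', hr₁.1.trans hr'.1, hr₁.2.1.trans hr'.1, hr'.2, hq3', hr'',
    hsub ⟨hr₁N ⟨hr'.1.le, hr'.2.le⟩, hq2⟩⟩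

/-- The intermediate state of an admissible fan subsolution with two interfaces of speeds `νl`,
`νr`: its density is `ρ`, its velocity is `(vl 0, β)`, and `κ₁`, `κ₂` are the diagonal
entries of the defect `C / 2 - v ⊗ v + u` in the direction of `x₂` and `x₁`. -/
structure IsFanSubsolution (γ ρl : ℝ) (vl : Plane) (ρr : ℝ) (vr : Plane)
    (ρ β κ₁ κ₂ νl νr : ℝ) : Prop where
  density_pos : 0 < ρ
  defect_one_pos : 0 < κ₁
  defect_two_pos : 0 < κ₂
  speed_lt : νl < νr
  mass_left : νl * (ρ - ρl) = ρ * β - ρl * vl 1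
  mass_right : νr * (ρr - ρ) = ρr * vr 1 - ρ * β
  momentum_left : νl * (ρ * β - ρl * vl 1)
    = (ρ * (β ^ 2 + κ₁) + pressure γ ρ) - (ρl * vl 1 ^ 2 + pressure γ ρl)
  momentum_right : νr * (ρr * vr 1 - ρ * β)
    = (ρr * vr 1 ^ 2 + pressure γ ρr) - (ρ * (β ^ 2 + κ₁) + pressure γ ρ)
  energy_left : (ρ * internalEnergy γ ρ + ρ * ((vl 0 ^ 2 + β ^ 2 + κ₁ + κ₂) / 2)
      + pressure γ ρ) * β - (energy γ ρl vl + pressure γ ρl) * vl 1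
    ≤ νl * (ρ * internalEnergy γ ρ + ρ * ((vl 0 ^ 2 + β ^ 2 + κ₁ + κ₂) / 2) - energy γ ρl vl)
  energy_right : (energy γ ρr vr + pressure γ ρr) * vr 1
      - (ρ * internalEnergy γ ρ + ρ * ((vl 0 ^ 2 + β ^ 2 + κ₁ + κ₂) / 2) + pressure γ ρ) * β
    ≤ νr * (energy γ ρr vr - (ρ * internalEnergy γ ρ
      + ρ * ((vl 0 ^ 2 + β ^ 2 + κ₁ + κ₂) / 2)))

/-- The excess of the effective pressure over `pressure γ ρ` is ρ κ₁. The Rankine-Hugoniot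
conditions hold for every pair of density and effective pressure with the right total drop, while
the energy inequalities are open conditions that hold strictly at the two-shock state, where κ₁ = κ₂
= 0. -/
theorem exists_fanSubsolution {γ ρl ρr : ℝ} {vl vr : Plane} (hγ : 1 ≤ γ) (hρl : 0 < ρl)
    (hρr : 0 < ρr) (h0 : vl 0 = vr 0)
    (h : velocityJump ρl (pressure γ ρl) ρr (pressure γ ρr) < vl 1 - vr 1) :
    ∃ ρ β κ₁ κ₂ νl νr, IsFanSubsolution γ ρl vl ρr vr ρ β κ₁ κ₂ νl νr := by
  obtain ⟨r, hl, hr, hJ⟩ := exists_middle_density hγ hρl hρr h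
  have hr0 := hρl.trans hl
  have hpl := pressure_strictMono hγ hρl hl
  have hpr := pressure_strictMono hγ hρr hr
  set pl := pressure γ ρl
  set pr := pressure γ ρr
  set q := pressure γ r with hq
  obtain ⟨-, a1, -⟩ := oneShock_of_velocityJump (w := vl)
    (w' := !₂[vl 0, vl 1 - velocityJump ρl pl r q]) hγ hρl hl (by simp) (by simp [pl, q])
  obtain ⟨-, b1, -⟩ := threeShock_of_velocityJump
    (w := !₂[vl 0, vl 1 - velocityJump ρl pl r q]) (w' := vr) hγ hρr hr
      (by simp [h0]) (by simp; linarith)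
  rw [energy_eq γ r] at a1 b1
  simp only [Matrix.cons_val_zero, Matrix.cons_val_one] at a1 b1
  set β : ℝ × ℝ → ℝ := fun x => vl 1 - velocityJump ρl pl x.1 x.2 with hβ
  set νl : ℝ × ℝ → ℝ := fun x => vl 1 - velocityJump ρl pl x.1 x.2 * (x.1 / (x.1 - ρl)) with hνl
  set νr : ℝ × ℝ → ℝ := fun x => vr 1 + velocityJump ρr pr x.1 x.2 * (x.1 / (x.1 - ρr)) with hνr
  -- The energy density in terms of density, effective pressure and κ₂, with κ₁ eliminated.
  set E : (ℝ × ℝ) × ℝ → ℝ := fun y => y.1.1 * internalEnergy γ y.1.1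
    + y.1.1 * ((vl 0 ^ 2 + β y.1 ^ 2 + (y.1.2 - pressure γ y.1.1) / y.1.1 + y.2) / 2) with hE
  have hcβ : ContinuousAt β (r, q) :=
    continuousAt_const.sub (continuousAt_velocityJump hρl hr0)
  have hcνl : ContinuousAt νl (r, q) :=
    continuousAt_const.sub ((continuousAt_velocityJump hρl hr0).mul
      (ContinuousAt.div (by fun_prop) (by fun_prop) (sub_pos.2 hl).ne'))
  have hcνr : ContinuousAt νr (r, q) :=
    continuousAt_const.add ((continuousAt_velocityJump hρr hr0).mul
      (ContinuousAt.div (by fun_prop) (by fun_prop) (sub_pos.2 hr).ne'))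
  have hcp : ContinuousAt (fun y : (ℝ × ℝ) × ℝ => pressure γ y.1.1) ((r, q), 0) :=
    ContinuousAt.comp (f := fun y : (ℝ × ℝ) × ℝ => y.1.1) (g := pressure γ)
      (continuousAt_pressure hr0) (by fun_prop)
  have hci : ContinuousAt (fun y : (ℝ × ℝ) × ℝ => internalEnergy γ y.1.1) ((r, q), 0) :=
    ContinuousAt.comp (f := fun y : (ℝ × ℝ) × ℝ => y.1.1) (g := internalEnergy γ)
      (hasDerivAt_internalEnergy hr0).continuousAt (by fun_prop)
  have hf : ContinuousAt (fun y : (ℝ × ℝ) × ℝ => y.1) ((r, q), 0) := by fun_prop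
  have hcβ' : ContinuousAt (fun y : (ℝ × ℝ) × ℝ => β y.1) ((r, q), 0) :=
    ContinuousAt.comp (f := fun y : (ℝ × ℝ) × ℝ => y.1) (g := β) hcβ hf
  have hcνl' : ContinuousAt (fun y : (ℝ × ℝ) × ℝ => νl y.1) ((r, q), 0) :=
    ContinuousAt.comp (f := fun y : (ℝ × ℝ) × ℝ => y.1) (g := νl) hcνl hf
  have hcνr' : ContinuousAt (fun y : (ℝ × ℝ) × ℝ => νr y.1) ((r, q), 0) :=
    ContinuousAt.comp (f := fun y : (ℝ × ℝ) × ℝ => y.1) (g := νr) hcνr hf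
  have hc1 : ContinuousAt (fun y : (ℝ × ℝ) × ℝ => y.1.1) ((r, q), 0) := by fun_prop
  have hcE : ContinuousAt E ((r, q), 0) := by
    refine (hc1.mul hci).add (hc1.mul (ContinuousAt.div_const ?_ 2))
    refine ((continuousAt_const.add (hcβ'.pow 2)).add (ContinuousAt.div ?_ hc1 hr0.ne')).add
      (by fun_prop)
    exact ContinuousAt.sub (by fun_prop) hcp
  have hE0 : E ((r, q), 0) = r * internalEnergy γ r + r * ((vl 0 ^ 2 + β (r, q) ^ 2) / 2) := by
    simp [hE, hq]
  have hevl : ∀ᶠ y in 𝓝 ((r, q), (0 : ℝ)), (E y + pressure γ y.1.1) * β y.1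
      - (energy γ ρl vl + pl) * vl 1 < νl y.1 * (E y - energy γ ρl vl) := by
    refine ContinuousAt.eventually_lt (((hcE.add hcp).mul hcβ').sub continuousAt_const)
      (hcνl'.mul (hcE.sub continuousAt_const)) ?_
    rw [hE0]
    exact a1
  have hevr : ∀ᶠ y in 𝓝 ((r, q), (0 : ℝ)), (energy γ ρr vr + pr) * vr 1
      - (E y + pressure γ y.1.1) * β y.1 < νr y.1 * (energy γ ρr vr - E y) := by
    refine ContinuousAt.eventually_lt (continuousAt_const.sub ((hcE.add hcp).mul hcβ'))
      (hcνr'.mul (continuousAt_const.sub hcE)) ?_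
    rw [hE0]
    exact b1
  have hev := hevl.and hevr
  rw [nhds_prod_eq] at hev
  obtain ⟨N₁, hN₁, N₂, hN₂, hsub⟩ := mem_prod_iff.1 hev
  obtain ⟨κ₂, hκ₂N, hκ₂⟩ := ((Filter.Eventually.filter_mono nhdsWithin_le_nhds hN₂ :
    ∀ᶠ κ in 𝓝[>] (0 : ℝ), κ ∈ N₂).and
    (self_mem_nhdsWithin : Ioi (0 : ℝ) ∈ 𝓝[>] (0 : ℝ))).exists
  obtain ⟨ρ, P, hlρ, hrρ, hρr', hqP, hJ', hmem⟩ :=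
    exists_perturbed_middle_state hρl hρr hl hr hpl hpr hJ hN₁
  have hρ0 := hρl.trans hlρ
  obtain ⟨e1, e2⟩ := hsub (show ((ρ, P), κ₂) ∈ N₁ ×ˢ N₂ from ⟨hmem, hκ₂N⟩)
  have hpρ := pressure_strictMono hγ hρ0 hρr'
  obtain ⟨l1, l2⟩ := rankineHugoniot_of_velocityJump (v := vl 1) hρl hlρ (hpl.trans hqP).le
  -- The right interface is a left one after reflection, hence the sign of `vr 1`.
  obtain ⟨r1, r2⟩ := rankineHugoniot_of_velocityJump (v := -vr 1) hρr hrρ (hpr.trans hqP).le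
  have hβr : β (ρ, P) = vr 1 + velocityJump ρr pr ρ P := by simp only [hβ]; linarith
  have hκ : ρ * ((P - pressure γ ρ) / ρ) = P - pressure γ ρ := by field_simp
  have hJl := velocityJump_pos hρl hlρ (hpl.trans hqP)
  have hJr := velocityJump_pos hρr hrρ (hpr.trans hqP)
  refine ⟨ρ, β (ρ, P), (P - pressure γ ρ) / ρ, κ₂, νl (ρ, P), νr (ρ, P), hρ0,
    div_pos (by linarith) hρ0, hκ₂, ?_, l1, ?_, ?_, ?_, e1.le, e2.le⟩
  -- Both interfaces move away from the middle fluid: νl < β < νr.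
  · have g1 : 1 < ρ / (ρ - ρl) := (one_lt_div (sub_pos.2 hlρ)).2 (by linarith)
    have g2 : 1 < ρ / (ρ - ρr) := (one_lt_div (sub_pos.2 hrρ)).2 (by linarith)
    have m1 := lt_mul_of_one_lt_right hJl g1
    have m2 := lt_mul_of_one_lt_right hJr g2
    simp only [hνl, hνr]
    linarith
  · rw [hβr]; simp only [hνr]; linarith
  · rw [mul_add, hκ]; simp only [hνl, hβ]; linarith
  · rw [mul_add, hκ, hβr]; simp only [hνr]; linarith

/-! ### The divergence theorem in the sector `x₂ > ν t`, `t > 0` -/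

/-- Coordinates `((a, y), t)` for the space-time point `((a, y + ν t), t)`. -/
noncomputable def movingFrame (ν : ℝ) : ((ℝ × ℝ) × ℝ) ≃L[ℝ] Plane × ℝ :=
  LinearEquiv.toContinuousLinearEquiv
    { toFun := fun p => (!₂[p.1.1, p.1.2 + ν * p.2], p.2)
      invFun := fun z => ((z.1 0, z.1 1 - ν * z.2), z.2)
      map_add' := by
        intro p q
        ext i
        · fin_cases i <;> simp; ring
        · simp
      map_smul' := by
        intro c p
        ext i
        · fin_cases i <;> simp; ring
        · simp
      left_inv := by intro p; simp
      right_inv := by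
        intro z
        ext i
        · fin_cases i <;> simp
        · simp }

theorem movingFrame_apply (ν : ℝ) (p : (ℝ × ℝ) × ℝ) :
    movingFrame ν p = (!₂[p.1.1, p.1.2 + ν * p.2], p.2) := rfl

theorem movingFrame_symm_apply (ν : ℝ) (z : Plane × ℝ) :
    (movingFrame ν).symm z = ((z.1 0, z.1 1 - ν * z.2), z.2) := rfl

theorem measurePreserving_plane :
    MeasurePreserving (fun p : ℝ × ℝ => (!₂[p.1, p.2] : Plane)) := by
  have h := (PiLp.volume_preserving_toLp (Fin 2)).comp
    ((volume_preserving_finTwoArrow ℝ).symm)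
  exact h

/-- The map is a shear: for each fixed time it is a translation by ν t in x₂. -/
theorem measurePreserving_movingFrame (ν : ℝ) : MeasurePreserving (movingFrame ν) := by
  have h1 : MeasurePreserving (fun p : ℝ × (ℝ × ℝ) => (p.1, p.2 + (0, ν * p.1))) := by
    refine MeasurePreserving.skew_product (g := fun t p => p + (0, ν * t))
      (MeasurePreserving.id volume) (by fun_prop) ?_
    exact Eventually.of_forall fun t => map_add_right_eq_self volume _
  have h2 : MeasurePreserving (Prod.swap : (ℝ × ℝ) × ℝ → ℝ × (ℝ × ℝ)) :=
    Measure.measurePreserving_swap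
  have h3 : MeasurePreserving (Prod.swap : ℝ × (ℝ × ℝ) → (ℝ × ℝ) × ℝ) :=
    Measure.measurePreserving_swap
  have h4 := (measurePreserving_plane.prod (MeasurePreserving.id (volume : Measure ℝ))).comp
    (h3.comp (h1.comp h2))
  convert h4 using 1
  · ext p <;> simp [movingFrame_apply]
  · rfl

section Slices

variable {g : (ℝ × ℝ) × ℝ → ℝ}

/-- Needed for slices of test functions, with `π` a projection, and for changes of coordinates, with
`π` the inverse map. -/
theorem hasCompactSupport_comp_of_leftInverse {X Y : Type*} [TopologicalSpace X]
    [TopologicalSpace Y] [T2Space X] {g : Y → ℝ} (hg : HasCompactSupport g) {i : X → Y} {π : Y → X}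
    (hπ : Continuous π) (h : ∀ x, π (i x) = x) : HasCompactSupport fun x => g (i x) := by
  refine HasCompactSupport.intro (hg.isCompact.image hπ) fun x hx => ?_
  by_contra hne
  exact hx ⟨i x, subset_tsupport g hne, h x⟩

theorem integrable_fderiv_apply {E : Type*} [NormedAddCommGroup E] [NormedSpace ℝ E]
    [MeasurableSpace E] [BorelSpace E] {μ : Measure E}
    [IsFiniteMeasureOnCompacts μ] {g : E → ℝ} (hg : ContDiff ℝ ∞ g)
    (hc : HasCompactSupport g) (v : E) : Integrable (fun p => fderiv ℝ g p v) μ := by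
  refine Continuous.integrable_of_hasCompactSupport ?_ (hc.fderiv_apply ℝ v)
  exact (hg.continuous_fderiv (by simp)).clm_apply continuous_const

theorem deriv_comp_eq_fderiv {E : Type*} [NormedAddCommGroup E] [NormedSpace ℝ E]
    {g : E → ℝ} (hg : ContDiff ℝ ∞ g) {i : ℝ → E} {v : E} {s : ℝ}
    (hi : HasDerivAt i v s) : deriv (fun s => g (i s)) s = fderiv ℝ g (i s) v :=
  ((hg.differentiable (by simp) (i s)).hasFDerivAt.comp_hasDerivAt s hi).deriv

theorem integral_deriv_eq_zero_of_hasCompactSupport {f : ℝ → ℝ} (hf : ContDiff ℝ ∞ f)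
    (hc : HasCompactSupport f) : ∫ x, deriv f x = 0 := by
  have hf1 : ContDiff ℝ 1 f := hf.of_le (by simp)
  refine integral_eq_zero_of_hasDerivAt_of_integrable
    (fun x => (hf.differentiable (by simp) x).hasDerivAt) ?_ ?_
  · exact (hf1.continuous_deriv le_rfl).integrable_of_hasCompactSupport hc.deriv
  · exact hf.continuous.integrable_of_hasCompactSupport hc

variable (hg : ContDiff ℝ ∞ g) (hc : HasCompactSupport g)
include hg hc

theorem setIntegral_fderiv_time (B : Set (ℝ × ℝ)) :
    ∫ p in B ×ˢ Ioi (0 : ℝ), fderiv ℝ g p (0, 1) = -∫ x in B, g (x, 0) := by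
  rw [Measure.volume_eq_prod,
    setIntegral_prod _ (integrable_fderiv_apply hg hc _).integrableOn, ← integral_neg]
  congr 1 with x
  rw [← HasCompactSupport.integral_Ioi_deriv_eq (f := fun t => g (x, t))
    ((hg.of_le (by simp)).comp (by fun_prop))
    (hasCompactSupport_comp_of_leftInverse hc continuous_snd fun _ => rfl)]
  congr 1 with t
  exact (deriv_comp_eq_fderiv hg ((hasDerivAt_const t x).prodMk (hasDerivAt_id t))).symm

/-- Time is integrated last, so that only a statement on each time slice is left. -/
theorem setIntegral_fderiv_space {B : Set (ℝ × ℝ)} (T : Set ℝ) {v : ℝ × ℝ} {I : ℝ → ℝ}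
    (h : ∀ t, ContDiff ℝ ∞ (fun x => g (x, t)) → HasCompactSupport (fun x => g (x, t)) →
      ∫ x in B, fderiv ℝ (fun x => g (x, t)) x v = I t) :
    ∫ p in B ×ˢ T, fderiv ℝ g p (v, 0) = ∫ t in T, I t := by
  rw [Measure.volume_eq_prod, ← Measure.prod_restrict, integral_prod_symm]
  · congr 1 with t
    rw [← h t (hg.comp (by fun_prop))
      (hasCompactSupport_comp_of_leftInverse hc continuous_fst fun _ => rfl)]
    congr 1 with x
    have h1 : HasFDerivAt (fun x : ℝ × ℝ => (x, t))
        ((ContinuousLinearMap.id ℝ (ℝ × ℝ)).prod 0) x :=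
      (hasFDerivAt_id x).prodMk (hasFDerivAt_const t x)
    have := (HasFDerivAt.comp x (hg.differentiable (by simp) (x, t)).hasFDerivAt h1).fderiv
    simp only [Function.comp_def] at this
    rw [this]; simp
  · rw [Measure.prod_restrict, ← Measure.volume_eq_prod]
    exact (integrable_fderiv_apply hg hc _).integrableOn

theorem setIntegral_fderiv_fst (B : Set ℝ) (T : Set ℝ) :
    ∫ p in (univ ×ˢ B) ×ˢ T, fderiv ℝ g p ((1, 0), 0) = 0 := by
  rw [setIntegral_fderiv_space hg hc T (I := fun _ => 0), integral_zero]
  intro t hgt hct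
  rw [Measure.volume_eq_prod, ← Measure.prod_restrict, integral_prod_symm]
  · refine (integral_congr_ae (ae_of_all _ fun y => ?_)).trans (integral_zero _ _)
    rw [Measure.restrict_univ]
    refine Eq.trans ?_ (integral_deriv_eq_zero_of_hasCompactSupport
      (f := fun a => g ((a, y), t)) (hgt.comp (by fun_prop))
      (hasCompactSupport_comp_of_leftInverse hct continuous_fst fun _ => rfl))
    congr 1 with a
    exact (deriv_comp_eq_fderiv hgt ((hasDerivAt_id a).prodMk (hasDerivAt_const a y))).symm
  · rw [Measure.prod_restrict, ← Measure.volume_eq_prod]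
    exact (integrable_fderiv_apply hgt hct _).integrableOn

theorem setIntegral_fderiv_snd_Ioi (T : Set ℝ) :
    ∫ p in (univ ×ˢ Ioi (0 : ℝ)) ×ˢ T, fderiv ℝ g p ((0, 1), 0)
      = -∫ t in T, ∫ a, g ((a, 0), t) := by
  rw [setIntegral_fderiv_space hg hc T (I := fun t => -∫ a, g ((a, 0), t)), integral_neg]
  intro t hgt hct
  rw [Measure.volume_eq_prod, setIntegral_prod _
    (integrable_fderiv_apply hgt hct _).integrableOn, Measure.restrict_univ, ← integral_neg]
  congr 1 with a
  rw [← HasCompactSupport.integral_Ioi_deriv_eq (f := fun y => g ((a, y), t))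
    ((hgt.of_le (by simp)).comp (by fun_prop))
    (hasCompactSupport_comp_of_leftInverse hct continuous_snd fun _ => rfl)]
  congr 1 with y
  exact (deriv_comp_eq_fderiv hgt ((hasDerivAt_const y a).prodMk (hasDerivAt_id y))).symm

theorem setIntegral_fderiv_snd_univ (T : Set ℝ) :
    ∫ p in (univ ×ˢ univ) ×ˢ T, fderiv ℝ g p ((0, 1), 0) = 0 := by
  rw [setIntegral_fderiv_space hg hc T (I := fun _ => 0), integral_zero]
  intro t hgt hct
  rw [Measure.volume_eq_prod, setIntegral_prod _
    (integrable_fderiv_apply hgt hct _).integrableOn, Measure.restrict_univ]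
  refine (integral_congr_ae (ae_of_all _ fun a => ?_)).trans (integral_zero _ _)
  refine Eq.trans ?_ (integral_deriv_eq_zero_of_hasCompactSupport (f := fun y => g ((a, y), t))
    (hgt.comp (by fun_prop))
    (hasCompactSupport_comp_of_leftInverse hct continuous_snd fun _ => rfl))
  congr 1 with y
  exact (deriv_comp_eq_fderiv hgt ((hasDerivAt_const y a).prodMk (hasDerivAt_id y))).symm

end Slices

/-- The integral of `ψ` over the plane `x₂ = ν t`, `t > 0`. -/
noncomputable def interfaceIntegral (ν : ℝ) (ψ : Plane × ℝ → ℝ) : ℝ :=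
  ∫ t in Ioi (0 : ℝ), ∫ a, ψ (!₂[a, ν * t], t)

theorem interfaceIntegral_nonneg {ν : ℝ} {ψ : Plane × ℝ → ℝ} (h : ∀ x t, 0 ≤ t → 0 ≤ ψ (x, t)) :
    0 ≤ interfaceIntegral ν ψ :=
  setIntegral_nonneg measurableSet_Ioi fun _ ht => integral_nonneg fun _ => h _ _ (le_of_lt ht)

theorem IsTestFunction.comp_movingFrame {ψ : Plane × ℝ → ℝ} (hψ : IsTestFunction ψ) (ν : ℝ) :
    ContDiff ℝ ∞ (fun p => ψ (movingFrame ν p)) ∧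
      HasCompactSupport (fun p => ψ (movingFrame ν p)) :=
  ⟨hψ.1.comp (movingFrame ν).contDiff,
    hasCompactSupport_comp_of_leftInverse hψ.2 (movingFrame ν).symm.continuous
      (movingFrame ν).symm_apply_apply⟩

/-- In the moving frame the component of `G` across the interface is `G.1 1 - ν * G.2`, which later
becomes the Rankine-Hugoniot defect. -/
theorem fderiv_movingFrame {ψ : Plane × ℝ → ℝ} (hψ : IsTestFunction ψ) (ν : ℝ) (G : Plane × ℝ)
    (p : (ℝ × ℝ) × ℝ) :
    fderiv ℝ ψ (movingFrame ν p) G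
      = G.1 0 * fderiv ℝ (fun p => ψ (movingFrame ν p)) p ((1, 0), 0)
        + (G.1 1 - ν * G.2) * fderiv ℝ (fun p => ψ (movingFrame ν p)) p ((0, 1), 0)
        + G.2 * fderiv ℝ (fun p => ψ (movingFrame ν p)) p (0, 1) := by
  have h : fderiv ℝ (fun p => ψ (movingFrame ν p)) p
      = (fderiv ℝ ψ (movingFrame ν p)).comp (movingFrame ν : ((ℝ × ℝ) × ℝ) →L[ℝ] Plane × ℝ) :=
    ((hψ.1.differentiable (by simp) _).hasFDerivAt.comp p (movingFrame ν).hasFDerivAt).fderiv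
  have hG : G = movingFrame ν (G.1 0 • ((1, 0), 0) + (G.1 1 - ν * G.2) • ((0, 1), 0)
      + G.2 • (0, 1)) := by
    rw [← (movingFrame ν).symm_apply_eq, movingFrame_symm_apply]
    simp
  conv_lhs => rw [hG]
  simp only [h, map_add, map_smul, smul_eq_mul, ContinuousLinearMap.comp_apply,
    ContinuousLinearEquiv.coe_coe]

theorem setIntegral_fderiv_movingFrame {ψ : Plane × ℝ → ℝ} (hψ : IsTestFunction ψ) (ν : ℝ)
    (G : Plane × ℝ) (S : Set ((ℝ × ℝ) × ℝ)) :
    ∫ z in (movingFrame ν).symm ⁻¹' S, fderiv ℝ ψ z G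
      = G.1 0 * (∫ p in S, fderiv ℝ (fun p => ψ (movingFrame ν p)) p ((1, 0), 0))
        + (G.1 1 - ν * G.2) * (∫ p in S, fderiv ℝ (fun p => ψ (movingFrame ν p)) p ((0, 1), 0))
        + G.2 * ∫ p in S, fderiv ℝ (fun p => ψ (movingFrame ν p)) p (0, 1) := by
  obtain ⟨h1, h2⟩ := hψ.comp_movingFrame ν
  have e := (measurePreserving_movingFrame ν).setIntegral_preimage_emb
    (movingFrame ν).toHomeomorph.measurableEmbedding (fun z => fderiv ℝ ψ z G)
    ((movingFrame ν).symm ⁻¹' S)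
  have e2 : (movingFrame ν) ⁻¹' ((movingFrame ν).symm ⁻¹' S) = S := by
    ext p; simp
  rw [← e, e2]
  simp_rw [fderiv_movingFrame hψ]
  have i1 := fun v => (integrable_fderiv_apply (μ := volume) h1 h2 v).integrableOn (s := S)
  rw [integral_add, integral_add, integral_const_mul, integral_const_mul, integral_const_mul]
  · exact (i1 _).const_mul _
  · exact (i1 _).const_mul _
  · exact ((i1 _).const_mul _).add ((i1 _).const_mul _)
  · exact (i1 _).const_mul _

theorem setIntegral_plane (f : Plane → ℝ) (S : Set Plane) :
    ∫ p in (fun p : ℝ × ℝ => (!₂[p.1, p.2] : Plane)) ⁻¹' S, f !₂[p.1, p.2] = ∫ x in S, f x := by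
  refine measurePreserving_plane.setIntegral_preimage_emb ?_ f S
  exact (MeasurableEquiv.measurableEmbedding
    (MeasurableEquiv.finTwoArrow.symm.trans (MeasurableEquiv.toLp 2 (Fin 2 → ℝ))))

/-- The moving frame turns the sector into a product of half-lines and a line, with only two faces:
`t = 0` and the interface. -/
theorem setIntegral_sector {ψ : Plane × ℝ → ℝ} (hψ : IsTestFunction ψ) (ν : ℝ) (G : Plane × ℝ) :
    (∫ z in {z : Plane × ℝ | 0 < z.2 ∧ ν * z.2 < z.1 1}, fderiv ℝ ψ z G)
      + G.2 * ∫ x in {x : Plane | 0 < x 1}, ψ (x, 0)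
      = (ν * G.2 - G.1 1) * interfaceIntegral ν ψ := by
  obtain ⟨h1, h2⟩ := hψ.comp_movingFrame ν
  have e : {z : Plane × ℝ | 0 < z.2 ∧ ν * z.2 < z.1 1}
      = (movingFrame ν).symm ⁻¹' ((univ ×ˢ Ioi 0) ×ˢ Ioi 0) := by
    ext z
    simp [movingFrame_symm_apply, and_comm]
  rw [e, setIntegral_fderiv_movingFrame hψ, setIntegral_fderiv_fst h1 h2,
    setIntegral_fderiv_snd_Ioi h1 h2, setIntegral_fderiv_time h1 h2]
  have e2 : ∫ x in univ ×ˢ Ioi (0 : ℝ), ψ (movingFrame ν (x, 0))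
      = ∫ x in {x : Plane | 0 < x 1}, ψ (x, 0) := by
    rw [← setIntegral_plane (fun x => ψ (x, 0))]
    have : (fun p : ℝ × ℝ => (!₂[p.1, p.2] : Plane)) ⁻¹' {x | 0 < x 1} = univ ×ˢ Ioi 0 := by
      ext p; simp
    rw [this]
    simp [movingFrame_apply]
  rw [e2]
  simp only [movingFrame_apply, zero_add, interfaceIntegral]
  ring

theorem setIntegral_halfSpace {ψ : Plane × ℝ → ℝ} (hψ : IsTestFunction ψ) (G : Plane × ℝ) :
    (∫ z in spaceTime, fderiv ℝ ψ z G) + G.2 * ∫ x, ψ (x, 0) = 0 := by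
  obtain ⟨h1, h2⟩ := hψ.comp_movingFrame 0
  have e : spaceTime = (movingFrame 0).symm ⁻¹' ((univ ×ˢ univ) ×ˢ Ioi 0) := by
    ext z
    simp [movingFrame_symm_apply, spaceTime]
  rw [e, setIntegral_fderiv_movingFrame hψ, setIntegral_fderiv_fst h1 h2,
    setIntegral_fderiv_snd_univ h1 h2, setIntegral_fderiv_time h1 h2]
  have e2 : ∫ x in univ ×ˢ univ, ψ (movingFrame 0 (x, 0)) = ∫ x, ψ (x, 0) := by
    rw [← setIntegral_univ (f := fun x : Plane => ψ (x, 0)),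
      ← setIntegral_plane (fun x => ψ (x, 0))]
    simp [movingFrame_apply]
  rw [e2]
  ring

/-! ### Weak balance of piecewise constant fluxes -/

/-- A field with three constant values, separated by the planes `x₂ = νl t` and `x₂ = νr t`. -/
noncomputable def fanField {A : Type*} (νl νr : ℝ) (a b c : A) (z : Plane × ℝ) : A :=
  if z.1 1 ≤ νl * z.2 then a else if z.1 1 ≤ νr * z.2 then b else c

theorem measurableSet_sector (ν : ℝ) :
    MeasurableSet {z : Plane × ℝ | ν * z.2 < z.1 1} :=
  (isOpen_lt (by fun_prop) (by fun_prop)).measurableSet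

theorem riemannData_ae_eq (a b : ℝ) : riemannData a b =ᵐ[volume]
    fun x => a + {x : Plane | 0 < x 1}.indicator (fun _ => b - a) x := by
  have h0 : volume {x : Plane | x 1 = 0} = 0 := by
    have := Measure.addHaar_submodule (volume : Measure Plane)
      (LinearMap.ker (EuclideanSpace.proj (𝕜 := ℝ) (1 : Fin 2) : Plane →L[ℝ] ℝ).toLinearMap) ?_
    · convert this using 2
      ext x; simp
    · intro h
      have : (EuclideanSpace.single 1 1 : Plane) ∈ (⊤ : Submodule ℝ Plane) := trivial
      rw [← h] at this
      simp at this
  have : ∀ᵐ x : Plane, x 1 ≠ 0 := by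
    rw [ae_iff]; simpa using h0
  filter_upwards [this] with x hx
  rcases lt_or_gt_of_ne hx with h | h
  · simp [riemannData, h, h.not_gt]
  · simp [riemannData, h, h.not_gt]

/-- The field is `A`, plus `B - A` on x₂ > νl t, plus `C - B` on x₂ > νr t. The half-space and
sector formulas add up, their faces at `t = 0` cancel the initial data, and the interface terms are
the Rankine-Hugoniot defects. -/
theorem integral_fanField {ψ : Plane × ℝ → ℝ} (hψ : IsTestFunction ψ) {νl νr : ℝ}
    (hν : νl < νr) (A B C : Plane × ℝ) :
    (∫ z, fderiv ℝ ψ z (fanField νl νr A B C z) ∂spaceTimeMeasure)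
      + ∫ x, riemannData A.2 C.2 x * ψ (x, 0)
      = (νl * (B.2 - A.2) - (B.1 1 - A.1 1)) * interfaceIntegral νl ψ
        + (νr * (C.2 - B.2) - (C.1 1 - B.1 1)) * interfaceIntegral νr ψ := by
  have hint := fun v => (integrable_fderiv_apply (μ := volume) hψ.1 hψ.2 v)
  have hi0 : Integrable (fun x : Plane => ψ (x, 0)) :=
    (hψ.1.continuous.comp (by fun_prop)).integrable_of_hasCompactSupport
      (hasCompactSupport_comp_of_leftInverse hψ.2 continuous_fst fun _ => rfl)
  have hm : MeasurableSet {x : Plane | 0 < x 1} :=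
    (isOpen_lt (by fun_prop) (by fun_prop)).measurableSet
  have hmS : MeasurableSet spaceTime := (isOpen_lt (by fun_prop) (by fun_prop)).measurableSet
  have e0 : ∫ x, riemannData A.2 C.2 x * ψ (x, 0)
      = A.2 * (∫ x, ψ (x, 0)) + (C.2 - A.2) * ∫ x in {x : Plane | 0 < x 1}, ψ (x, 0) := by
    rw [← integral_const_mul, ← integral_const_mul, ← integral_indicator hm, ← integral_add]
    · refine integral_congr_ae ?_
      filter_upwards [riemannData_ae_eq A.2 C.2] with x hx
      rw [hx]
      by_cases h : x ∈ {x : Plane | 0 < x 1}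
      · simp only [indicator_of_mem h]; ring
      · simp only [indicator_of_notMem h]; ring
    · exact hi0.const_mul _
    · exact (hi0.const_mul _).indicator hm
  have e1 : ∫ z, fderiv ℝ ψ z (fanField νl νr A B C z) ∂spaceTimeMeasure
      = (∫ z in spaceTime, fderiv ℝ ψ z A)
        + (∫ z in {z : Plane × ℝ | 0 < z.2 ∧ νl * z.2 < z.1 1}, fderiv ℝ ψ z (B - A))
        + ∫ z in {z : Plane × ℝ | 0 < z.2 ∧ νr * z.2 < z.1 1}, fderiv ℝ ψ z (C - B) := by
    have hset : ∀ ν v, ∫ z in {z : Plane × ℝ | 0 < z.2 ∧ ν * z.2 < z.1 1}, fderiv ℝ ψ z v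
        = ∫ z in spaceTime, {z : Plane × ℝ | ν * z.2 < z.1 1}.indicator
          (fun z => fderiv ℝ ψ z v) z := by
      intro ν v
      rw [integral_indicator (measurableSet_sector ν), Measure.restrict_restrict
        (measurableSet_sector ν)]
      congr 2
      ext z; simp [spaceTime, and_comm]
    rw [hset, hset, spaceTimeMeasure, ← integral_add, ← integral_add]
    · refine setIntegral_congr_fun hmS fun z hz => ?_
      have hz' : 0 < z.2 := hz
      have hlr : νl * z.2 < νr * z.2 := mul_lt_mul_of_pos_right hν hz'
      simp only [fanField, indicator_apply, mem_ofPred_eq]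
      split_ifs <;> first | linarith | simp
    · exact (hint _).integrableOn.add ((hint _).integrableOn.indicator (measurableSet_sector _))
    · exact (hint _).integrableOn.indicator (measurableSet_sector _)
    · exact (hint _).integrableOn
    · exact (hint _).integrableOn.indicator (measurableSet_sector _)
  have s0 := setIntegral_halfSpace hψ A
  have s1 := setIntegral_sector hψ νl (B - A)
  have s2 := setIntegral_sector hψ νr (C - B)
  simp only [Prod.fst_sub, Prod.snd_sub, PiLp.sub_apply] at s1 s2
  rw [e0, e1, ← s1, ← s2]
  linear_combination s0

/-! ### Strong limits of almost orthogonal perturbations in a Hilbert space -/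

section Hilbert

variable {H : Type*} [NormedAddCommGroup H] [InnerProductSpace ℝ H]

open scoped RealInnerProductSpace

/-- If every element of a set `X` in a ball of a Hilbert space can be perturbed inside `X`, almost
orthogonally to finitely many given vectors, with a gain in the norm that is controlled by the
distance to the maximal norm, then near every element of `X` in the weak topology there is a strong
limit of elements of `X` which has the maximal norm. -/
theorem exists_mem_closure_norm_sq_eq [CompleteSpace H] {X : Set H} {M c : ℝ} (hc : 0 < c)
    (hM : ∀ u ∈ X, ‖u‖ ^ 2 ≤ M)
    (hstep : ∀ u ∈ X, ∀ F : Finset H, ∀ ε > 0, ∃ u' ∈ X, (∀ f ∈ F, |⟪f, u' - u⟫| ≤ ε) ∧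
      ‖u‖ ^ 2 + c * (M - ‖u‖ ^ 2) ^ 2 ≤ ‖u'‖ ^ 2)
    {u₀ : H} (hu₀ : u₀ ∈ X) (F : Finset H) {ε : ℝ} (hε : 0 < ε) :
    ∃ u ∈ closure X, ‖u‖ ^ 2 = M ∧ ∀ f ∈ F, |⟪f, u - u₀⟫| ≤ ε := by
  classical
  choose! next hnX hnF hn using hstep
  -- The second component collects the vectors to test against: `F`, `u₀` and all later iterates.
  -- The tolerances are ε / 2 ^ (n + 1), so the errors telescope.
  let S : ℕ → H × Finset H := fun n => Nat.rec (u₀, insert u₀ F)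
    (fun n p => (next p.1 p.2 (ε / 2 / 2 ^ n),
      insert (next p.1 p.2 (ε / 2 / 2 ^ n)) p.2)) n
  have hS1 : ∀ n, (S (n + 1)).1 = next (S n).1 (S n).2 (ε / 2 / 2 ^ n) := fun n => rfl
  have hS2 : ∀ n, (S (n + 1)).2 = insert (S (n + 1)).1 (S n).2 := fun n => rfl
  have hpos : ∀ n : ℕ, 0 < ε / 2 / 2 ^ n := fun n => by positivity
  have hX : ∀ n, (S n).1 ∈ X := by
    intro n
    induction n with
    | zero => exact hu₀
    | succ n ih => rw [hS1]; exact hnX _ ih _ _ (hpos n)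
  have hmono : ∀ m n, m ≤ n → (S m).2 ⊆ (S n).2 := by
    intro m n h
    induction n, h using Nat.le_induction with
    | base => exact subset_rfl
    | succ n _ ih => rw [hS2]; exact ih.trans (Finset.subset_insert _ _)
  have hself : ∀ n, (S n).1 ∈ (S n).2 := by
    intro n
    cases n with
    | zero => exact Finset.mem_insert_self _ _
    | succ n => rw [hS2]; exact Finset.mem_insert_self _ _
  have horth : ∀ m n, m ≤ n → ∀ f ∈ (S m).2,
      |⟪f, (S n).1 - (S m).1⟫| ≤ ε / 2 ^ m - ε / 2 ^ n := by
    intro m n h f hf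
    induction n, h using Nat.le_induction with
    | base => simp
    | succ n hmn ih =>
      have h1 := hnF _ (hX n) (S n).2 _ (hpos n) f (hmono m n hmn hf)
      rw [← hS1] at h1
      have h2 : (S (n + 1)).1 - (S m).1
          = ((S (n + 1)).1 - (S n).1) + ((S n).1 - (S m).1) := by abel
      rw [h2, inner_add_right]
      have h3 := abs_add_le ⟪f, (S (n + 1)).1 - (S n).1⟫ ⟪f, (S n).1 - (S m).1⟫
      have h4 : ε / 2 ^ n - ε / 2 ^ (n + 1) = ε / 2 / 2 ^ n := by
        rw [pow_succ]; field_simp; ring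
      linarith
  have hgain : ∀ n, ‖(S n).1‖ ^ 2 + c * (M - ‖(S n).1‖ ^ 2) ^ 2 ≤ ‖(S (n + 1)).1‖ ^ 2 := by
    intro n
    rw [hS1]
    exact hn _ (hX n) _ _ (hpos n)
  set a : ℕ → ℝ := fun n => ‖(S n).1‖ ^ 2 with ha
  have hamono : Monotone a := monotone_nat_of_le_succ fun n => by
    have := hgain n
    have : 0 ≤ c * (M - ‖(S n).1‖ ^ 2) ^ 2 := by positivity
    simp only [ha]; linarith
  have habdd : BddAbove (range a) := ⟨M, by rintro _ ⟨n, rfl⟩; exact hM _ (hX n)⟩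
  have halim := tendsto_atTop_ciSup hamono habdd
  -- Almost orthogonality of the increment to the earlier iterate turns distances into differences
  -- of squared norms, and these norms converge by monotonicity.
  have hdist : ∀ m n, m ≤ n → ‖(S n).1 - (S m).1‖ ^ 2 ≤ (a n + 0) - a m + 2 * (ε / 2 ^ m) := by
    intro m n h
    have h1 := horth m n h _ (hself m)
    have h2 : ‖(S n).1 - (S m).1‖ ^ 2
        = a n - a m - 2 * ⟪(S m).1, (S n).1 - (S m).1⟫ := by
      rw [inner_sub_right, real_inner_self_eq_norm_sq, @norm_sub_sq_real,
        real_inner_comm]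
      simp only [ha]; ring
    have h3 := (abs_le.1 h1).1
    have h4 : 0 < ε / 2 ^ n := by positivity
    rw [h2]; linarith
  have hcauchy : CauchySeq fun n => (S n).1 := by
    rw [Metric.cauchySeq_iff']
    intro δ hδ
    have hl2 : Tendsto (fun m : ℕ => (⨆ i, a i) - a m + 2 * (ε / 2 ^ m)) atTop
        (𝓝 ((⨆ i, a i) - (⨆ i, a i) + 2 * 0)) := by
      refine (tendsto_const_nhds.sub halim).add (Tendsto.const_mul _ ?_)
      exact tendsto_const_nhds.div_atTop (tendsto_pow_atTop_atTop_of_one_lt one_lt_two)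
    have := (hl2.eventually (gt_mem_nhds (show (⨆ i, a i) - (⨆ i, a i) + 2 * 0 < δ ^ 2 by
      simp; positivity))).exists
    obtain ⟨N, hN⟩ := this
    refine ⟨N, fun n hn => ?_⟩
    rw [dist_eq_norm]
    refine lt_of_pow_lt_pow_left₀ 2 hδ.le ?_
    have h1 := hdist N n hn
    have h2 := le_ciSup habdd n
    linarith
  obtain ⟨u, hu⟩ := cauchySeq_tendsto_of_complete hcauchy
  refine ⟨u, mem_closure_of_tendsto hu (Eventually.of_forall hX), ?_, ?_⟩
  · have hna : Tendsto a atTop (𝓝 (‖u‖ ^ 2)) := (hu.norm).pow 2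
    have h1 : Tendsto (fun n => a n + c * (M - a n) ^ 2) atTop
        (𝓝 (‖u‖ ^ 2 + c * (M - ‖u‖ ^ 2) ^ 2)) :=
      hna.add (((tendsto_const_nhds.sub hna).pow 2).const_mul c)
    have h2 := le_of_tendsto_of_tendsto' h1 (hna.comp (tendsto_add_atTop_nat 1)) hgain
    -- In the limit the gain inequality leaves no room for a deficit.
    have h3 : (M - ‖u‖ ^ 2) ^ 2 ≤ 0 := by
      by_contra hcon
      have := mul_pos hc (not_le.1 hcon)
      linarith
    have := pow_eq_zero_iff (two_ne_zero) |>.1 (le_antisymm h3 (sq_nonneg _))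
    linarith
  · intro f hf
    have h1 : Tendsto (fun n => |⟪f, (S n).1 - u₀⟫|) atTop (𝓝 |⟪f, u - u₀⟫|) :=
      (tendsto_const_nhds.inner (hu.sub_const u₀)).abs
    refine le_of_tendsto' h1 fun n => ?_
    have h2 := horth 0 n (Nat.zero_le n) f (Finset.mem_insert_of_mem hf)
    have h3 : 0 < ε / 2 ^ n := by positivity
    simp only [pow_zero, div_one] at h2
    exact h2.trans (by linarith)

end Hilbert

/-! ### The relaxed constraint set -/

/-- The interior of the convex hull of the set of states `(v, z)` with `|v|² = C`, `z = v²`. Here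
`z` stands for twice the traceless symmetric matrix with first row `(Re z / 2, Im z / 2)`. -/
def relaxedStates (C : ℝ) : Set (ℂ × ℂ) := {U | ‖U.1‖ ^ 2 + ‖U.1 ^ 2 - U.2‖ < C}

theorem isOpen_relaxedStates (C : ℝ) : IsOpen (relaxedStates C) :=
  isOpen_lt (by fun_prop) (by fun_prop)

/-- A polar form whose phase is a square: moving the velocity along `e` changes its square in the
direction `e ^ 2`, parallel to `q`. -/
theorem exists_unit_sq_mul (q : ℂ) : ∃ e : ℂ, ‖e‖ = 1 ∧ q = -(‖q‖ : ℂ) * e ^ 2 := by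
  by_cases hq : q = 0
  · exact ⟨1, by simp, by simp [hq]⟩
  · obtain ⟨e, he⟩ := IsAlgClosed.exists_pow_nat_eq (-q / ‖q‖) two_pos
    have hq' : (‖q‖ : ℂ) ≠ 0 := by simpa using hq
    refine ⟨e, ?_, ?_⟩
    · have h1 : ‖e‖ * ‖e‖ = 1 := by
        rw [← norm_mul, ← pow_two, he, norm_div, norm_neg, Complex.norm_real, norm_norm, div_self]
        simpa using hq
      nlinarith [norm_nonneg e]
    · rw [he]; field_simp

/-- Through every relaxed state there passes a segment in a direction of the wave cone that stays
in the set of relaxed states and whose length is controlled by `C - |v|²`. -/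
theorem exists_segment_relaxedStates {C : ℝ} {U : ℂ × ℂ} (hU : U ∈ relaxedStates C) :
    ∃ (d : ℂ) (r : ℝ), ‖d‖ ^ 2 = (C - ‖U.1‖ ^ 2) ^ 2 / (64 * C) ∧ d ≠ 0 ∧
      ∀ s : ℝ, |s| ≤ 1 → U + s • (d, Complex.I * r * d ^ 2) ∈ relaxedStates C := by
  obtain ⟨v, z⟩ := U
  simp only [relaxedStates, mem_ofPred_eq] at hU ⊢
  set q := v ^ 2 - z with hq
  obtain ⟨e, he, hqe⟩ := exists_unit_sq_mul q
  set g := C - ‖v‖ ^ 2 with hg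
  have hgq : ‖q‖ < g := by rw [hg]; linarith
  have hg0 : 0 < g := (norm_nonneg q).trans_lt hgq
  have hgC : g ≤ C := by rw [hg]; have := sq_nonneg ‖v‖; linarith
  have hC : 0 < C := hg0.trans_le hgC
  -- Short enough that the change `σ` of |v|² along the segment stays below `g / 2`.
  set t := g / (8 * √C) with ht
  have hsC : 0 < √C := Real.sqrt_pos.2 hC
  have hsC2 : √C ^ 2 = C := Real.sq_sqrt hC.le
  have ht0 : 0 < t := by positivity
  have htsq : t ^ 2 = g ^ 2 / (64 * C) := by
    rw [ht, div_pow, mul_pow, hsC2]; norm_num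
  have he0 : e ≠ 0 := by intro h; simp [h] at he
  have hd0 : (t : ℂ) * e ≠ 0 := mul_ne_zero (by exact_mod_cast ht0.ne') he0
  have hdn : ‖(t : ℂ) * e‖ = t := by simp [he, abs_of_pos ht0]
  -- The phase `e` makes d² antiparallel to `q`, and r = 2 Im (v / d) cancels the part of 2 v d
  -- transversal to d². Hence `q` stays on its own real line: along the segment |v|² becomes |v|² +
  -- σ and |q| becomes |σ - |q||.
  refine ⟨t * e, 2 * (v / (t * e)).im, by rw [hdn, htsq], hd0, fun s hs => ?_⟩
  set d : ℂ := t * e with hd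
  set x := (v / d).re with hx
  set y := (v / d).im with hy
  have hv : v = ((x : ℂ) + y * Complex.I) * d := by
    rw [hx, hy, Complex.re_add_im]; field_simp
  set σ := (2 * s * x + s ^ 2) * t ^ 2 with hσ
  have h1 : ‖v + s * d‖ ^ 2 = ‖v‖ ^ 2 + σ := by
    have e1 : v + s * d = ((x + s : ℝ) + (y : ℝ) * Complex.I) * d := by
      conv_lhs => rw [hv]
      push_cast; ring
    have e2 : ‖v‖ ^ 2 = (x ^ 2 + y ^ 2) * t ^ 2 := by
      conv_lhs => rw [hv]
      rw [norm_mul, mul_pow, hdn, ← Complex.normSq_eq_norm_sq, Complex.normSq_add_mul_I]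
    rw [e1, e2, norm_mul, mul_pow, hdn, ← Complex.normSq_eq_norm_sq, Complex.normSq_add_mul_I]
    rw [hσ]; ring
  have h2 : (v + s * d) ^ 2 - (z + s * (Complex.I * ((2 * y : ℝ) : ℂ) * d ^ 2))
      = ((σ - ‖q‖ : ℝ) : ℂ) * e ^ 2 := by
    have e1 : (v + s * d) ^ 2 - (z + s * (Complex.I * ((2 * y : ℝ) : ℂ) * d ^ 2))
        = q + (2 * s * x + s ^ 2) * d ^ 2 := by
      rw [hq]
      have : 2 * v * s * d = 2 * s * (x + y * Complex.I) * d ^ 2 := by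
        conv_lhs => rw [hv]
        ring
      push_cast
      linear_combination this
    rw [e1, hqe, hσ, hd]
    simp only [norm_mul, norm_neg, Complex.norm_real, norm_norm, norm_pow, he]
    push_cast
    ring
  have h3 : ‖(((σ - ‖q‖ : ℝ) : ℂ) * e ^ 2)‖ = |σ - ‖q‖| := by
    rw [norm_mul, norm_pow, he, Complex.norm_real]; simp
  have hvt : |x| * t ≤ ‖v‖ := by
    have : ‖v / d‖ * t = ‖v‖ := by rw [norm_div, hdn]; field_simp
    rw [← this]
    exact mul_le_mul_of_nonneg_right (Complex.abs_re_le_norm _) ht0.le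
  have hvC : ‖v‖ ≤ √C := Real.le_sqrt_of_sq_le (by linarith)
  have hσg : σ < g / 2 := by
    have e1 : s * x ≤ |x| := by
      calc s * x ≤ |s * x| := le_abs_self _
        _ = |s| * |x| := abs_mul _ _
        _ ≤ 1 * |x| := by gcongr
        _ = |x| := one_mul _
    have e2 : s ^ 2 ≤ 1 := by
      rw [← sq_abs]; nlinarith [abs_nonneg s]
    have e3 : |x| * t ^ 2 ≤ g / 8 := by
      have : √C * t = g / 8 := by rw [ht]; field_simp
      nlinarith
    have e4 : t ^ 2 ≤ g / 64 := by
      rw [htsq, div_le_div_iff₀ (by positivity) (by norm_num)]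
      nlinarith
    have : σ ≤ 2 * (|x| * t ^ 2) + t ^ 2 := by
      rw [hσ]; nlinarith [sq_nonneg t]
    linarith
  have key : ‖v + s * d‖ ^ 2 + ‖(v + s * d) ^ 2
      - (z + s * (Complex.I * ((2 * y : ℝ) : ℂ) * d ^ 2))‖ < C := by
    rw [h2, h3, h1]
    -- The sum is |v|² + 2 σ - |q|, below `C` because σ < g / 2, or else it is unchanged.
    rcases abs_cases (σ - ‖q‖) with ⟨h, -⟩ | ⟨h, -⟩ <;> rw [h]
    · have : 0 ≤ ‖q‖ := norm_nonneg q
      linarith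
    · linarith
  simpa [Complex.real_smul] using key

/-! ### Localized plane waves -/

section DirDeriv

variable {E : Type*} [NormedAddCommGroup E] [NormedSpace ℝ E]

/-- The derivative of a function in a fixed direction. -/
noncomputable def dirDeriv (v : E) (f : E → ℝ) (x : E) : ℝ := fderiv ℝ f x v

theorem contDiff_dirDeriv {f : E → ℝ} (hf : ContDiff ℝ ∞ f) (v : E) :
    ContDiff ℝ ∞ (dirDeriv v f) :=
  (hf.fderiv_right (m := ∞) (by simp)).clm_apply contDiff_const

theorem hasCompactSupport_dirDeriv {f : E → ℝ} (hf : HasCompactSupport f) (v : E) :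
    HasCompactSupport (dirDeriv v f) :=
  hf.fderiv_apply ℝ v

theorem tsupport_dirDeriv_subset (f : E → ℝ) (v : E) : tsupport (dirDeriv v f) ⊆ tsupport f :=
  tsupport_fderiv_apply_subset ℝ v

theorem dirDeriv_comm {f : E → ℝ} (hf : ContDiff ℝ ∞ f) (v w : E) :
    dirDeriv v (dirDeriv w f) = dirDeriv w (dirDeriv v f) := by
  ext x
  have h : ∀ a b : E, dirDeriv a (dirDeriv b f) x = fderiv ℝ (fderiv ℝ f) x a b := by
    intro a b
    unfold dirDeriv
    rw [fderiv_clm_apply]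
    · simp
    · exact ((hf.fderiv_right (m := ∞) (by simp)).differentiable (by simp)) x
    · simp
  rw [h, h]
  exact (hf.contDiffAt.isSymmSndFDerivAt
    (by rw [minSmoothness_of_isRCLikeNormedField]; exact WithTop.coe_le_coe.2 (le_top : (2 : ℕ∞) ≤ ⊤))) v w

theorem dirDeriv_add {f g : E → ℝ} (hf : ContDiff ℝ ∞ f) (hg : ContDiff ℝ ∞ g) (v : E) :
    dirDeriv v (fun x => f x + g x) = fun x => dirDeriv v f x + dirDeriv v g x := by
  ext x
  unfold dirDeriv
  rw [fderiv_fun_add (hf.differentiable (by simp) x) (hg.differentiable (by simp) x)]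
  rfl

theorem dirDeriv_mul {f g : E → ℝ} (hf : ContDiff ℝ ∞ f) (hg : ContDiff ℝ ∞ g) (v : E) :
    dirDeriv v (fun x => f x * g x) = fun x => dirDeriv v f x * g x + f x * dirDeriv v g x := by
  ext x
  unfold dirDeriv
  rw [fderiv_fun_mul (hf.differentiable (by simp) x) (hg.differentiable (by simp) x)]
  simp; ring

theorem dirDeriv_const_mul {f : E → ℝ} (hf : ContDiff ℝ ∞ f) (c : ℝ) (v : E) :
    dirDeriv v (fun x => c * f x) = fun x => c * dirDeriv v f x := by
  ext x
  unfold dirDeriv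
  rw [fderiv_const_mul (hf.differentiable (by simp) x)]
  simp

theorem dirDeriv_cos (ℓ : E →L[ℝ] ℝ) (N : ℝ) (v : E) :
    dirDeriv v (fun x => Real.cos (N * ℓ x)) = fun x => -(N * ℓ v) * Real.sin (N * ℓ x) := by
  ext x
  unfold dirDeriv
  have h : HasFDerivAt (fun x => N * ℓ x) (N • ℓ) x := (ℓ.hasFDerivAt).const_mul N
  rw [h.cos.fderiv]
  simp; ring

theorem dirDeriv_sin (ℓ : E →L[ℝ] ℝ) (N : ℝ) (v : E) :
    dirDeriv v (fun x => Real.sin (N * ℓ x)) = fun x => N * ℓ v * Real.cos (N * ℓ x) := by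
  ext x
  unfold dirDeriv
  have h : HasFDerivAt (fun x => N * ℓ x) (N • ℓ) x := (ℓ.hasFDerivAt).const_mul N
  rw [h.sin.fderiv]
  simp; ring

theorem contDiff_cos_clm (ℓ : E →L[ℝ] ℝ) (N : ℝ) : ContDiff ℝ ∞ fun x => Real.cos (N * ℓ x) :=
  Real.contDiff_cos.comp (contDiff_const.mul ℓ.contDiff)

theorem contDiff_sin_clm (ℓ : E →L[ℝ] ℝ) (N : ℝ) : ContDiff ℝ ∞ fun x => Real.sin (N * ℓ x) :=
  Real.contDiff_sin.comp (contDiff_const.mul ℓ.contDiff)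

/-- A wave with amplitude `χ`, phase `N ℓ` and size `N⁻³`. -/
noncomputable def wavePotential (χ : E → ℝ) (ℓ : E →L[ℝ] ℝ) (N : ℝ) (x : E) : ℝ :=
  (N ^ 3)⁻¹ * (χ x * Real.cos (N * ℓ x))

theorem contDiff_wavePotential {χ : E → ℝ} (hχ : ContDiff ℝ ∞ χ) (ℓ : E →L[ℝ] ℝ) (N : ℝ) :
    ContDiff ℝ ∞ (wavePotential χ ℓ N) :=
  contDiff_const.mul (hχ.mul (contDiff_cos_clm ℓ N))

theorem tsupport_wavePotential_subset (χ : E → ℝ) (ℓ : E →L[ℝ] ℝ) (N : ℝ) :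
    tsupport (wavePotential χ ℓ N) ⊆ tsupport χ := by
  refine closure_mono fun x hx => ?_
  contrapose! hx
  simp only [Function.mem_support, ne_eq, not_not] at hx ⊢
  simp [wavePotential, hx]

/-- Leibniz expansion in powers of 1 / N: the prefactor N⁻³ balances three derivatives on the
cosine, and the third derivative of the cosine is the sine. -/
theorem dirDeriv_dirDeriv_dirDeriv_wavePotential {χ : E → ℝ} (hχ : ContDiff ℝ ∞ χ)
    (ℓ : E →L[ℝ] ℝ) {N : ℝ} (hN : N ≠ 0) (a b c : E) (x : E) :
    dirDeriv a (dirDeriv b (dirDeriv c (wavePotential χ ℓ N))) x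
      = ℓ a * ℓ b * ℓ c * (χ x * Real.sin (N * ℓ x))
        + N⁻¹ * (-(ℓ b * ℓ a * dirDeriv c χ x + ℓ c * ℓ a * dirDeriv b χ x
            + ℓ c * ℓ b * dirDeriv a χ x) * Real.cos (N * ℓ x)
          - N⁻¹ * ((ℓ a * dirDeriv b (dirDeriv c χ) x + ℓ b * dirDeriv a (dirDeriv c χ) x
            + ℓ c * dirDeriv a (dirDeriv b χ) x) * Real.sin (N * ℓ x)
          - N⁻¹ * (dirDeriv a (dirDeriv b (dirDeriv c χ)) x * Real.cos (N * ℓ x)))) := by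
  have hs := contDiff_sin_clm ℓ N
  have hc := contDiff_cos_clm ℓ N
  have hχ1 := fun v => contDiff_dirDeriv hχ v
  have hχ2 := fun v w => contDiff_dirDeriv (contDiff_dirDeriv hχ w) v
  have d1 : ∀ v, dirDeriv v (wavePotential χ ℓ N) = fun x => (N ^ 3)⁻¹ *
      (dirDeriv v χ x * Real.cos (N * ℓ x) + (-(N * ℓ v)) * (χ x * Real.sin (N * ℓ x))) := by
    intro v
    unfold wavePotential
    rw [dirDeriv_const_mul (hχ.mul hc), dirDeriv_mul hχ hc, dirDeriv_cos]
    ext x; ring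
  have m1 : ∀ (f : E → ℝ), ContDiff ℝ ∞ f → ∀ v, dirDeriv v (fun x => f x * Real.cos (N * ℓ x))
      = fun x => dirDeriv v f x * Real.cos (N * ℓ x)
        + (-(N * ℓ v)) * (f x * Real.sin (N * ℓ x)) := by
    intro f hf v
    rw [dirDeriv_mul hf hc, dirDeriv_cos]
    ext x; ring
  have m2 : ∀ (f : E → ℝ), ContDiff ℝ ∞ f → ∀ v, dirDeriv v (fun x => f x * Real.sin (N * ℓ x))
      = fun x => dirDeriv v f x * Real.sin (N * ℓ x)
        + (N * ℓ v) * (f x * Real.cos (N * ℓ x)) := by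
    intro f hf v
    rw [dirDeriv_mul hf hs, dirDeriv_sin]
    ext x; ring
  have c1 : ∀ (f : E → ℝ), ContDiff ℝ ∞ f → ContDiff ℝ ∞ fun x => f x * Real.cos (N * ℓ x) :=
    fun f hf => hf.mul hc
  have c2 : ∀ (f : E → ℝ), ContDiff ℝ ∞ f → ContDiff ℝ ∞ fun x => f x * Real.sin (N * ℓ x) :=
    fun f hf => hf.mul hs
  have c3 : ∀ (f : E → ℝ) (k : ℝ), ContDiff ℝ ∞ f → ContDiff ℝ ∞ fun x => k * f x :=
    fun f k hf => contDiff_const.mul hf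
  have d2 : dirDeriv b (dirDeriv c (wavePotential χ ℓ N)) = fun x => (N ^ 3)⁻¹ *
      ((dirDeriv b (dirDeriv c χ) x * Real.cos (N * ℓ x)
        + (-(N * ℓ b)) * (dirDeriv c χ x * Real.sin (N * ℓ x)))
      + (-(N * ℓ c)) * (dirDeriv b χ x * Real.sin (N * ℓ x)
        + (N * ℓ b) * (χ x * Real.cos (N * ℓ x)))) := by
    rw [d1, dirDeriv_const_mul ((c1 _ (hχ1 _)).add (c3 _ _ (c2 _ hχ))),
      dirDeriv_add (c1 _ (hχ1 _)) (c3 _ _ (c2 _ hχ)), dirDeriv_const_mul (c2 _ hχ),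
      m1 _ (hχ1 _), m2 _ hχ]
  rw [d2, dirDeriv_const_mul (((c1 _ (hχ2 _ _)).add (c3 _ _ (c2 _ (hχ1 _)))).add
      (c3 _ _ ((c2 _ (hχ1 _)).add (c3 _ _ (c1 _ hχ))))),
    dirDeriv_add ((c1 _ (hχ2 _ _)).add (c3 _ _ (c2 _ (hχ1 _))))
      (c3 _ _ ((c2 _ (hχ1 _)).add (c3 _ _ (c1 _ hχ)))),
    dirDeriv_add (c1 _ (hχ2 _ _)) (c3 _ _ (c2 _ (hχ1 _))),
    dirDeriv_const_mul (c2 _ (hχ1 _)), dirDeriv_const_mul ((c2 _ (hχ1 _)).add (c3 _ _ (c1 _ hχ))),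
    dirDeriv_add (c2 _ (hχ1 _)) (c3 _ _ (c1 _ hχ)), dirDeriv_const_mul (c1 _ hχ),
    m1 _ (hχ2 _ _), m1 _ hχ, m2 _ (hχ1 _), m2 _ (hχ1 _)]
  field_simp
  ring

theorem exists_bound_wavePotential {χ : E → ℝ} (hχ : ContDiff ℝ ∞ χ)
    (hc : HasCompactSupport χ) (ℓ : E →L[ℝ] ℝ) (a b c : E) :
    ∃ K, 0 ≤ K ∧ ∀ N : ℝ, 1 ≤ N → ∀ x,
      |dirDeriv a (dirDeriv b (dirDeriv c (wavePotential χ ℓ N))) x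
        - ℓ a * ℓ b * ℓ c * (χ x * Real.sin (N * ℓ x))| ≤ K / N := by
  have hχ1 := fun v => contDiff_dirDeriv hχ v
  have hχ2 := fun v w => contDiff_dirDeriv (contDiff_dirDeriv hχ w) v
  have hc1 := fun v => hasCompactSupport_dirDeriv hc v
  have hc2 := fun v w => hasCompactSupport_dirDeriv (hasCompactSupport_dirDeriv hc w) v
  obtain ⟨A, hA⟩ := Continuous.bounded_above_of_compact_support
    (f := fun x => -(ℓ b * ℓ a * dirDeriv c χ x + ℓ c * ℓ a * dirDeriv b χ x
            + ℓ c * ℓ b * dirDeriv a χ x))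
    (((((hχ1 c).continuous.const_mul _).add ((hχ1 b).continuous.const_mul _)).add
      ((hχ1 a).continuous.const_mul _)).neg)
    (((((hc1 c).mul_left).add ((hc1 b).mul_left)).add ((hc1 a).mul_left)).comp_left neg_zero)
  obtain ⟨B, hB⟩ := Continuous.bounded_above_of_compact_support
    (f := fun x => ℓ a * dirDeriv b (dirDeriv c χ) x + ℓ b * dirDeriv a (dirDeriv c χ) x
            + ℓ c * dirDeriv a (dirDeriv b χ) x)
    ((((hχ2 b c).continuous.const_mul _).add ((hχ2 a c).continuous.const_mul _)).add
      ((hχ2 a b).continuous.const_mul _))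
    ((((hc2 b c).mul_left).add ((hc2 a c).mul_left)).add ((hc2 a b).mul_left))
  obtain ⟨D, hD⟩ := Continuous.bounded_above_of_compact_support
    (contDiff_dirDeriv (hχ2 b c) a).continuous (hasCompactSupport_dirDeriv (hc2 b c) a)
  refine ⟨|A| + (|B| + |D|), by positivity, fun N hN x => ?_⟩
  have hN0 : 0 < N := by linarith
  rw [dirDeriv_dirDeriv_dirDeriv_wavePotential hχ ℓ hN0.ne', add_sub_cancel_left, abs_mul,
    div_eq_inv_mul, abs_of_pos (inv_pos.2 hN0)]
  have hA' := (hA x).trans (le_abs_self A)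
  have hB' := (hB x).trans (le_abs_self B)
  have hD' := (hD x).trans (le_abs_self D)
  rw [Real.norm_eq_abs] at hA' hB' hD'
  have hinv : |N⁻¹| ≤ 1 := by rw [abs_of_pos (inv_pos.2 hN0)]; exact inv_le_one_of_one_le₀ hN
  have trig : ∀ {u M t : ℝ}, |u| ≤ M → |t| ≤ 1 → |u * t| ≤ M := by
    intro u M t hu ht
    rw [abs_mul]
    exact (mul_le_of_le_one_right (abs_nonneg _) ht).trans hu
  have trig' : ∀ {u M t : ℝ}, |u| ≤ M → |t| ≤ 1 → |t * u| ≤ M := by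
    intro u M t hu ht
    rw [mul_comm]; exact trig hu ht
  refine mul_le_mul_of_nonneg_left ?_ (inv_pos.2 hN0).le
  refine (abs_sub _ _).trans (add_le_add (trig hA' (Real.abs_cos_le_one _)) (trig' ?_ hinv))
  exact (abs_sub _ _).trans (add_le_add (trig hB' (Real.abs_sin_le_one _))
    (trig' (trig hD' (Real.abs_cos_le_one _)) hinv))

theorem integral_mul_dirDeriv [FiniteDimensional ℝ E] [MeasurableSpace E] [BorelSpace E]
    {μ : Measure E} [μ.IsAddHaarMeasure]
    {f g : E → ℝ} (hf : ContDiff ℝ ∞ f) (hg : ContDiff ℝ ∞ g) (hc : HasCompactSupport f) (v : E) :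
    ∫ x, f x * dirDeriv v g x ∂μ = -∫ x, dirDeriv v f x * g x ∂μ := by
  have h1 := (contDiff_dirDeriv hf v).continuous
  have h2 := (contDiff_dirDeriv hg v).continuous
  refine integral_mul_fderiv_eq_neg_fderiv_mul_of_integrable ?_ ?_ ?_
    (fun x _ => hf.differentiable (by simp) x) (fun x _ => hg.differentiable (by simp) x)
  · exact (h1.mul hg.continuous).integrable_of_hasCompactSupport
      (hasCompactSupport_dirDeriv hc v).mul_right
  · exact (hf.continuous.mul h2).integrable_of_hasCompactSupport hc.mul_right
  · exact (hf.continuous.mul hg.continuous).integrable_of_hasCompactSupport hc.mul_right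

end DirDeriv

/-! ### The linear system for velocity and stress -/

/-- The coordinate directions of space-time. -/
noncomputable def dirOne : Plane × ℝ := (EuclideanSpace.single 0 1, 0)
/-- The coordinate directions of space-time. -/
noncomputable def dirTwo : Plane × ℝ := (EuclideanSpace.single 1 1, 0)
/-- The coordinate directions of space-time. -/
noncomputable def dirTime : Plane × ℝ := (0, 1)

theorem eq_sum_dir (G : Plane × ℝ) :
    G = G.1 0 • dirOne + G.1 1 • dirTwo + G.2 • dirTime := by
  ext i
  · fin_cases i <;> simp [dirOne, dirTwo, dirTime]
  · simp [dirOne, dirTwo, dirTime]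

theorem fderiv_eq_sum_dirDeriv (ψ : Plane × ℝ → ℝ) (y G : Plane × ℝ) :
    fderiv ℝ ψ y G = G.1 0 * dirDeriv dirOne ψ y + G.1 1 * dirDeriv dirTwo ψ y
      + G.2 * dirDeriv dirTime ψ y := by
  conv_lhs => rw [eq_sum_dir G]
  simp [dirDeriv]

/-- The space-time fluxes of the linear system `div v = 0`, `∂ₜ v + div u = 0`, where `v` is the
vector `(Re w.1, Im w.1)` and `2 u` the traceless symmetric matrix with first row
`(Re w.2, Im w.2)`. -/
noncomputable def stressFlux (k : Fin 3) (w : ℂ × ℂ) : Plane × ℝ :=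
  ![(!₂[w.1.re, w.1.im], 0), (!₂[w.2.re / 2, w.2.im / 2], w.1.re),
    (!₂[w.2.im / 2, -(w.2.re / 2)], w.1.im)] k

theorem stressFlux_add (k : Fin 3) (w w' : ℂ × ℂ) :
    stressFlux k (w + w') = stressFlux k w + stressFlux k w' := by
  ext i
  · fin_cases k <;> fin_cases i <;> simp [stressFlux] <;> ring
  · fin_cases k <;> simp [stressFlux]

theorem continuous_stressFlux (k : Fin 3) : Continuous (stressFlux k) := by
  fin_cases k <;> simp only <;>
    exact ((PiLp.continuous_toLp 2 _).comp (continuous_pi fun i => by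
      fin_cases i <;> simp <;> fun_prop)).prodMk (by fun_prop)

theorem stressFlux_zero (k : Fin 3) : stressFlux k 0 = 0 := by
  have := stressFlux_add k 0 0
  rw [add_zero] at this
  exact left_eq_add.1 this

/-- The weak form of the linear system `div v = 0`, `∂ₜ v + div u = 0` in all of space-time. -/
def IsWeaklyDivFree (W : Plane × ℝ → ℂ × ℂ) : Prop :=
  ∀ (k : Fin 3) (ψ : Plane × ℝ → ℝ), IsTestFunction ψ →
    ∫ y, fderiv ℝ ψ y (stressFlux k (W y)) = 0

/-- The solution of the linear system that is generated by a scalar potential `φ`: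
`v = ∇^⊥ Δ φ`. -/
noncomputable def potentialState (φ : Plane × ℝ → ℝ) (y : Plane × ℝ) : ℂ × ℂ :=
  (⟨-(dirDeriv dirTwo (dirDeriv dirOne (dirDeriv dirOne φ)) y
      + dirDeriv dirTwo (dirDeriv dirTwo (dirDeriv dirTwo φ)) y),
    dirDeriv dirOne (dirDeriv dirOne (dirDeriv dirOne φ)) y
      + dirDeriv dirOne (dirDeriv dirTwo (dirDeriv dirTwo φ)) y⟩,
   ⟨4 * dirDeriv dirTime (dirDeriv dirOne (dirDeriv dirTwo φ)) y,
    -(2 * (dirDeriv dirTime (dirDeriv dirOne (dirDeriv dirOne φ)) y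
      - dirDeriv dirTime (dirDeriv dirTwo (dirDeriv dirTwo φ)) y))⟩)

theorem continuous_complex_mk {X : Type*} [TopologicalSpace X] {f g : X → ℝ} (hf : Continuous f)
    (hg : Continuous g) : Continuous fun x => (⟨f x, g x⟩ : ℂ) :=
  Complex.equivRealProdCLM.symm.continuous.comp (hf.prodMk hg)

instance isAddHaarMeasure_volume_spaceTime :
    (volume : Measure (Plane × ℝ)).IsAddHaarMeasure :=
  Measure.prod.instIsAddHaarMeasure _ _

theorem integral_linear_combination {X : Type*} [MeasurableSpace X] {μ : Measure X}
    {f₁ f₂ f₃ f₄ f₅ : X → ℝ} (h₁ : Integrable f₁ μ) (h₂ : Integrable f₂ μ) (h₃ : Integrable f₃ μ)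
    (h₄ : Integrable f₄ μ) (h₅ : Integrable f₅ μ) (c₁ c₂ c₃ c₄ c₅ : ℝ) :
    ∫ x, (c₁ * f₁ x + c₂ * f₂ x + c₃ * f₃ x + c₄ * f₄ x + c₅ * f₅ x) ∂μ
      = c₁ * (∫ x, f₁ x ∂μ) + c₂ * (∫ x, f₂ x ∂μ) + c₃ * (∫ x, f₃ x ∂μ) + c₄ * (∫ x, f₄ x ∂μ)
        + c₅ * ∫ x, f₅ x ∂μ := by
  have i₁ := h₁.const_mul c₁
  have i₂ := h₂.const_mul c₂
  have i₃ := h₃.const_mul c₃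
  have i₄ := h₄.const_mul c₄
  have i₅ := h₅.const_mul c₅
  rw [integral_add (((i₁.fun_add i₂).fun_add i₃).fun_add i₄) i₅,
    integral_add ((i₁.fun_add i₂).fun_add i₃) i₄, integral_add (i₁.fun_add i₂) i₃,
    integral_add i₁ i₂]
  simp only [integral_const_mul]

section Potential

variable {φ : Plane × ℝ → ℝ} (hφ : ContDiff ℝ ∞ φ)
include hφ

theorem continuous_potentialState : Continuous (potentialState φ) := by
  have h : ∀ a b c : Plane × ℝ, Continuous (dirDeriv a (dirDeriv b (dirDeriv c φ))) :=
    fun a b c => (contDiff_dirDeriv (contDiff_dirDeriv (contDiff_dirDeriv hφ c) b) a).continuous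
  exact (continuous_complex_mk ((h _ _ _).add (h _ _ _)).neg ((h _ _ _).add (h _ _ _))).prodMk
    (continuous_complex_mk ((h _ _ _).const_mul _) (((h _ _ _).sub (h _ _ _)).const_mul _).neg)

/-- After integration by parts each term is a fourth derivative of φ against ψ. Such terms are
symmetric in the four directions, and the coefficients of equal ones cancel. -/
theorem isWeaklyDivFree_potentialState (hc : HasCompactSupport φ) :
    IsWeaklyDivFree (potentialState φ) := by
  intro k ψ hψ
  have h3 : ∀ a b c : Plane × ℝ, ContDiff ℝ ∞ (dirDeriv a (dirDeriv b (dirDeriv c φ))) :=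
    fun a b c => contDiff_dirDeriv (contDiff_dirDeriv (contDiff_dirDeriv hφ c) b) a
  have s3 : ∀ a b c : Plane × ℝ, HasCompactSupport (dirDeriv a (dirDeriv b (dirDeriv c φ))) :=
    fun a b c => hasCompactSupport_dirDeriv (hasCompactSupport_dirDeriv
      (hasCompactSupport_dirDeriv hc c) b) a
  have hI : ∀ a b c d : Plane × ℝ, Integrable fun y =>
      dirDeriv a (dirDeriv b (dirDeriv c φ)) y * dirDeriv d ψ y := fun a b c d =>
    ((h3 a b c).continuous.mul (contDiff_dirDeriv hψ.1 d).continuous).integrable_of_hasCompactSupport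
      (s3 a b c).mul_right
  let T : (Plane × ℝ) → (Plane × ℝ) → (Plane × ℝ) → (Plane × ℝ) → ℝ := fun a b c d =>
    ∫ y, dirDeriv a (dirDeriv b (dirDeriv c φ)) y * dirDeriv d ψ y
  have hT : ∀ a b c d, T a b c d
      = -∫ y, dirDeriv d (dirDeriv a (dirDeriv b (dirDeriv c φ))) y * ψ y := fun a b c d =>
    integral_mul_dirDeriv (h3 a b c) hψ.1 (s3 a b c) d
  have t1 : ∀ a b c d, T a b c d = T d b c a := by
    intro a b c d
    rw [hT, hT, dirDeriv_comm (contDiff_dirDeriv (contDiff_dirDeriv hφ c) b)]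
  have t2 : ∀ a b c d, T a b c d = T b a c d := by
    intro a b c d
    simp only [T]
    rw [dirDeriv_comm (contDiff_dirDeriv hφ c)]
  have t3 : ∀ a b c d, T a b c d = T a c b d := by
    intro a b c d
    simp only [T]
    rw [dirDeriv_comm hφ]
  fin_cases k
  · have e : ∀ y, fderiv ℝ ψ y (stressFlux 0 (potentialState φ y))
        = (-1) * (dirDeriv dirTwo (dirDeriv dirOne (dirDeriv dirOne φ)) y * dirDeriv dirOne ψ y)
          + (-1) * (dirDeriv dirTwo (dirDeriv dirTwo (dirDeriv dirTwo φ)) y * dirDeriv dirOne ψ y)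
          + (1) * (dirDeriv dirOne (dirDeriv dirOne (dirDeriv dirOne φ)) y * dirDeriv dirTwo ψ y)
          + (1) * (dirDeriv dirOne (dirDeriv dirTwo (dirDeriv dirTwo φ)) y * dirDeriv dirTwo ψ y)
          + (0) * (dirDeriv dirOne (dirDeriv dirTwo (dirDeriv dirTwo φ)) y * dirDeriv dirTwo ψ y) := by
      intro y
      rw [fderiv_eq_sum_dirDeriv]
      simp [stressFlux, potentialState]
      ring
    refine (integral_congr_ae (ae_of_all _ e)).trans ((integral_linear_combination
      (hI dirTwo dirOne dirOne dirOne)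
      (hI dirTwo dirTwo dirTwo dirOne)
      (hI dirOne dirOne dirOne dirTwo)
      (hI dirOne dirTwo dirTwo dirTwo)
      (hI dirOne dirTwo dirTwo dirTwo)
      (-1) (-1) (1) (1) (0)).trans ?_)
    change (-1) * T dirTwo dirOne dirOne dirOne
      + (-1) * T dirTwo dirTwo dirTwo dirOne
      + (1) * T dirOne dirOne dirOne dirTwo
      + (1) * T dirOne dirTwo dirTwo dirTwo
      + (0) * T dirOne dirTwo dirTwo dirTwo = 0
    rw [t1 dirTwo dirOne dirOne dirOne, t1 dirTwo dirTwo dirTwo dirOne]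
    ring
  · have e : ∀ y, fderiv ℝ ψ y (stressFlux 1 (potentialState φ y))
        = (2) * (dirDeriv dirTime (dirDeriv dirOne (dirDeriv dirTwo φ)) y * dirDeriv dirOne ψ y)
          + (-1) * (dirDeriv dirTime (dirDeriv dirOne (dirDeriv dirOne φ)) y * dirDeriv dirTwo ψ y)
          + (1) * (dirDeriv dirTime (dirDeriv dirTwo (dirDeriv dirTwo φ)) y * dirDeriv dirTwo ψ y)
          + (-1) * (dirDeriv dirTwo (dirDeriv dirOne (dirDeriv dirOne φ)) y * dirDeriv dirTime ψ y)
          + (-1) * (dirDeriv dirTwo (dirDeriv dirTwo (dirDeriv dirTwo φ)) y * dirDeriv dirTime ψ y) := by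
      intro y
      rw [fderiv_eq_sum_dirDeriv]
      simp [stressFlux, potentialState]
      ring
    refine (integral_congr_ae (ae_of_all _ e)).trans ((integral_linear_combination
      (hI dirTime dirOne dirTwo dirOne)
      (hI dirTime dirOne dirOne dirTwo)
      (hI dirTime dirTwo dirTwo dirTwo)
      (hI dirTwo dirOne dirOne dirTime)
      (hI dirTwo dirTwo dirTwo dirTime)
      (2) (-1) (1) (-1) (-1)).trans ?_)
    change (2) * T dirTime dirOne dirTwo dirOne
      + (-1) * T dirTime dirOne dirOne dirTwo
      + (1) * T dirTime dirTwo dirTwo dirTwo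
      + (-1) * T dirTwo dirOne dirOne dirTime
      + (-1) * T dirTwo dirTwo dirTwo dirTime = 0
    rw [t1 dirTwo dirOne dirOne dirTime, t1 dirTwo dirTwo dirTwo dirTime,
      t1 dirTime dirOne dirTwo dirOne, t3 dirOne dirOne dirTwo dirTime,
      t2 dirOne dirTwo dirOne dirTime, t1 dirTwo dirOne dirOne dirTime]
    ring
  · have e : ∀ y, fderiv ℝ ψ y (stressFlux 2 (potentialState φ y))
        = (1) * (dirDeriv dirTime (dirDeriv dirTwo (dirDeriv dirTwo φ)) y * dirDeriv dirOne ψ y)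
          + (-1) * (dirDeriv dirTime (dirDeriv dirOne (dirDeriv dirOne φ)) y * dirDeriv dirOne ψ y)
          + (-2) * (dirDeriv dirTime (dirDeriv dirOne (dirDeriv dirTwo φ)) y * dirDeriv dirTwo ψ y)
          + (1) * (dirDeriv dirOne (dirDeriv dirOne (dirDeriv dirOne φ)) y * dirDeriv dirTime ψ y)
          + (1) * (dirDeriv dirOne (dirDeriv dirTwo (dirDeriv dirTwo φ)) y * dirDeriv dirTime ψ y) := by
      intro y
      rw [fderiv_eq_sum_dirDeriv]
      simp [stressFlux, potentialState]
      ring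
    refine (integral_congr_ae (ae_of_all _ e)).trans ((integral_linear_combination
      (hI dirTime dirTwo dirTwo dirOne)
      (hI dirTime dirOne dirOne dirOne)
      (hI dirTime dirOne dirTwo dirTwo)
      (hI dirOne dirOne dirOne dirTime)
      (hI dirOne dirTwo dirTwo dirTime)
      (1) (-1) (-2) (1) (1)).trans ?_)
    change (1) * T dirTime dirTwo dirTwo dirOne
      + (-1) * T dirTime dirOne dirOne dirOne
      + (-2) * T dirTime dirOne dirTwo dirTwo
      + (1) * T dirOne dirOne dirOne dirTime
      + (1) * T dirOne dirTwo dirTwo dirTime = 0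
    rw [t1 dirOne dirOne dirOne dirTime, t1 dirOne dirTwo dirTwo dirTime,
      t1 dirTime dirOne dirTwo dirTwo, t2 dirTwo dirOne dirTwo dirTime,
      t1 dirOne dirTwo dirTwo dirTime]
    ring

omit hφ in
theorem potentialState_eq_zero {y : Plane × ℝ} (hy : y ∉ tsupport φ) :
    potentialState φ y = 0 := by
  have h : ∀ a b c : Plane × ℝ, dirDeriv a (dirDeriv b (dirDeriv c φ)) y = 0 := by
    intro a b c
    refine image_eq_zero_of_notMem_tsupport fun hcon => hy ?_
    exact tsupport_dirDeriv_subset _ _ (tsupport_dirDeriv_subset _ _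
      (tsupport_dirDeriv_subset _ _ hcon))
  simp [potentialState, h]
  rfl

end Potential

theorem norm_complex_le (z : ℂ) : ‖z‖ ≤ |z.re| + |z.im| := Complex.norm_le_abs_re_add_abs_im z

/-- With ξ = `ℓ dirOne` + i `ℓ dirTwo` and τ = `ℓ dirTime`, the amplitude is (i |ξ|² ξ, -2 i τ ξ²),
the symbol of `potentialState`. -/
theorem exists_bound_potentialState {χ : Plane × ℝ → ℝ} (hχ : ContDiff ℝ ∞ χ)
    (hc : HasCompactSupport χ) (ℓ : Plane × ℝ →L[ℝ] ℝ) :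
    ∃ K, 0 ≤ K ∧ ∀ N : ℝ, 1 ≤ N → ∀ y,
      ‖potentialState (wavePotential χ ℓ N) y - (χ y * Real.sin (N * ℓ y)) •
        ((⟨-(ℓ dirTwo * (ℓ dirOne ^ 2 + ℓ dirTwo ^ 2)),
            ℓ dirOne * (ℓ dirOne ^ 2 + ℓ dirTwo ^ 2)⟩ : ℂ),
          (⟨4 * ℓ dirTime * ℓ dirOne * ℓ dirTwo,
            -(2 * ℓ dirTime * (ℓ dirOne ^ 2 - ℓ dirTwo ^ 2))⟩ : ℂ))‖ ≤ K / N := by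
  choose K hK0 hK using fun a b c => exists_bound_wavePotential hχ hc ℓ a b c
  set k1 := K dirTwo dirOne dirOne
  set k2 := K dirTwo dirTwo dirTwo
  set k3 := K dirOne dirOne dirOne
  set k4 := K dirOne dirTwo dirTwo
  set k5 := K dirTime dirOne dirTwo
  set k6 := K dirTime dirOne dirOne
  set k7 := K dirTime dirTwo dirTwo
  have p1 : 0 ≤ k1 := hK0 _ _ _
  have p2 : 0 ≤ k2 := hK0 _ _ _
  have p3 : 0 ≤ k3 := hK0 _ _ _
  have p4 : 0 ≤ k4 := hK0 _ _ _
  have p5 : 0 ≤ k5 := hK0 _ _ _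
  have p6 : 0 ≤ k6 := hK0 _ _ _
  have p7 : 0 ≤ k7 := hK0 _ _ _
  refine ⟨k1 + k2 + (k3 + k4) + (4 * k5 + 2 * (k6 + k7)), by positivity, fun N hN y => ?_⟩
  have hN0 : 0 < N := by linarith
  have b1 := abs_le.1 (hK dirTwo dirOne dirOne N hN y)
  have b2 := abs_le.1 (hK dirTwo dirTwo dirTwo N hN y)
  have b3 := abs_le.1 (hK dirOne dirOne dirOne N hN y)
  have b4 := abs_le.1 (hK dirOne dirTwo dirTwo N hN y)
  have b5 := abs_le.1 (hK dirTime dirOne dirTwo N hN y)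
  have b6 := abs_le.1 (hK dirTime dirOne dirOne N hN y)
  have b7 := abs_le.1 (hK dirTime dirTwo dirTwo N hN y)
  have q1 := div_nonneg p1 hN0.le
  have q2 := div_nonneg p2 hN0.le
  have q3 := div_nonneg p3 hN0.le
  have q4 := div_nonneg p4 hN0.le
  have q5 := div_nonneg p5 hN0.le
  have q6 := div_nonneg p6 hN0.le
  have q7 := div_nonneg p7 hN0.le
  simp only [add_div, mul_div_assoc]
  set S := χ y * Real.sin (N * ℓ y)
  rw [Prod.norm_def]
  refine max_le ?_ ?_
  · refine (norm_complex_le _).trans ?_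
    simp only [potentialState, Prod.fst_sub, Prod.smul_fst, Complex.sub_re, Complex.sub_im,
      Complex.smul_re, Complex.smul_im, smul_eq_mul]
    refine le_trans (b := (k1 / N + k2 / N) + (k3 / N + k4 / N)) (add_le_add ?_ ?_) (by linarith)
    · rw [abs_le]; constructor <;> linarith
    · rw [abs_le]; constructor <;> linarith
  · refine (norm_complex_le _).trans ?_
    simp only [potentialState, Prod.snd_sub, Prod.smul_snd, Complex.sub_re, Complex.sub_im,
      Complex.smul_re, Complex.smul_im, smul_eq_mul]
    refine le_trans (b := 4 * (k5 / N) + 2 * (k6 / N + k7 / N)) (add_le_add ?_ ?_) (by linarith)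
    · rw [abs_le]; constructor <;> linarith
    · rw [abs_le]; constructor <;> linarith

/-- Localized high-frequency solutions of the linear system in a direction of the wave cone. -/
theorem exists_localized_wave {χ : Plane × ℝ → ℝ} (hχ : ContDiff ℝ ∞ χ)
    (hc : HasCompactSupport χ) {d : ℂ} (hd : d ≠ 0) (r : ℝ) :
    ∃ (ℓ : Plane × ℝ →L[ℝ] ℝ) (K : ℝ) (W : ℕ → Plane × ℝ → ℂ × ℂ), ℓ ≠ 0 ∧ 0 ≤ K ∧
      (∀ n, Continuous (W n)) ∧ (∀ n, IsWeaklyDivFree (W n)) ∧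
      (∀ n, ∀ y ∉ tsupport χ, W n y = 0) ∧
      ∀ n y, ‖W n y - (χ y * Real.sin ((n + 1) * ℓ y)) • (d, Complex.I * r * d ^ 2)‖
        ≤ K / (n + 1) := by
  set D := d.re ^ 2 + d.im ^ 2 with hD
  have hD0 : 0 < D := by
    have := Complex.normSq_pos.2 hd
    rw [Complex.normSq_apply] at this
    rw [hD]; linarith
  -- The covector ξ = -i d turns the velocity amplitude i |ξ|² ξ into D d and the stress amplitude
  -- into 2 i τ d². So τ = r D / 2 gives D times the wanted direction, and the cutoff is divided by
  -- D.
  set ℓ : Plane × ℝ →L[ℝ] ℝ :=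
    (d.im • (EuclideanSpace.proj (0 : Fin 2) : Plane →L[ℝ] ℝ)
      - d.re • (EuclideanSpace.proj (1 : Fin 2) : Plane →L[ℝ] ℝ)).comp
        (ContinuousLinearMap.fst ℝ Plane ℝ)
      + (r * D / 2) • ContinuousLinearMap.snd ℝ Plane ℝ with hℓ
  have l1 : ℓ dirOne = d.im := by simp [hℓ, dirOne]
  have l2 : ℓ dirTwo = -d.re := by simp [hℓ, dirTwo]
  have l3 : ℓ dirTime = r * D / 2 := by simp [hℓ, dirTime]
  have hχ' : ContDiff ℝ ∞ fun y => D⁻¹ * χ y := contDiff_const.mul hχ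
  have hc' : HasCompactSupport fun y => D⁻¹ * χ y := hc.mul_left
  obtain ⟨K, hK0, hK⟩ := exists_bound_potentialState hχ' hc' ℓ
  have hts : ∀ n : ℕ, tsupport (wavePotential (fun y => D⁻¹ * χ y) ℓ (n + 1)) ⊆ tsupport χ :=
    fun n => (tsupport_wavePotential_subset _ _ _).trans tsupport_mul_subset_right
  have hcw : ∀ n : ℕ, HasCompactSupport (wavePotential (fun y => D⁻¹ * χ y) ℓ (n + 1)) :=
    fun n => hc.of_isClosed_subset (isClosed_tsupport _) (hts n)
  refine ⟨ℓ, K, fun n => potentialState (wavePotential (fun y => D⁻¹ * χ y) ℓ (n + 1)), ?_, hK0,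
    fun n => continuous_potentialState (contDiff_wavePotential hχ' ℓ _),
    fun n => isWeaklyDivFree_potentialState (contDiff_wavePotential hχ' ℓ _) (hcw n),
    fun n y hy => potentialState_eq_zero fun h => hy (hts n h), fun n y => ?_⟩
  · intro h
    rw [h] at l1 l2
    apply hd
    apply Complex.ext
    · simpa using l2.symm
    · simpa using l1.symm
  · have h := hK (n + 1) (by have : (0 : ℝ) ≤ n := n.cast_nonneg
                             linarith) y
    convert h using 2
    have hV : ((⟨-(-d.re * (d.im ^ 2 + (-d.re) ^ 2)), d.im * (d.im ^ 2 + (-d.re) ^ 2)⟩ : ℂ),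
        (⟨4 * (r * D / 2) * d.im * -d.re,
          -(2 * (r * D / 2) * (d.im ^ 2 - (-d.re) ^ 2))⟩ : ℂ))
        = D • (d, Complex.I * r * d ^ 2) := by
      refine Prod.ext (Complex.ext ?_ ?_) (Complex.ext ?_ ?_)
      · simp [hD, pow_two]; ring
      · simp [hD, pow_two]; ring
      · simp [hD, pow_two]; ring
      · simp [hD, pow_two]; ring
    rw [l1, l2, l3, hV, smul_smul]
    congr 2
    field_simp

/-! ### The Riemann-Lebesgue lemma for absolutely continuous measures -/

section RiemannLebesgue

variable {E : Type*} [NormedAddCommGroup E] [NormedSpace ℝ E] [FiniteDimensional ℝ E]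
  [MeasurableSpace E] [BorelSpace E]

/-- The Radon-Nikodym density moves the integral to Haar measure, and the covectors `c n • ℓ` leave
every compact set of the dual because ℓ ≠ 0. -/
theorem tendsto_integral_exp_mul {ν μ : Measure E} [ν.IsAddHaarMeasure] [SigmaFinite μ]
    (hμ : μ ≪ ν) (f : E → ℝ) {ℓ : E →L[ℝ] ℝ} (hℓ : ℓ ≠ 0) {c : ℕ → ℝ} (hc : Tendsto c atTop atTop) :
    Tendsto (fun n : ℕ => ∫ x, Complex.exp (↑(-(c n * ℓ x)) * Complex.I) * f x ∂μ)
      atTop (𝓝 0) := by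
  have h1 := tendsto_integral_exp_smul_cocompact
    (fun x => ((μ.rnDeriv ν x).toReal : ℂ) * f x) ν
  have h2 : Tendsto (fun n : ℕ => (c n / (2 * Real.pi)) • ℓ) atTop
      (cocompact (StrongDual ℝ E)) := by
    have : ProperSpace (StrongDual ℝ E) := FiniteDimensional.proper ℝ _
    rw [← Metric.cobounded_eq_cocompact, ← tendsto_norm_atTop_iff_cobounded]
    simp_rw [norm_smul]
    exact (tendsto_abs_atTop_atTop.comp (hc.atTop_div_const (by positivity))).atTop_mul_const
      (norm_pos_iff.2 hℓ)
  have h3 := h1.comp h2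
  refine h3.congr fun n => ?_
  rw [Function.comp_apply, ← integral_rnDeriv_smul hμ]
  congr 1 with x
  rw [Circle.smul_def, Real.fourierChar_apply, Complex.real_smul, smul_eq_mul]
  have : (2 * Real.pi * -(((c n / (2 * Real.pi)) • ℓ) x) : ℝ) = -(c n * ℓ x) := by
    simp; field_simp
  rw [← mul_assoc, ← mul_assoc, mul_comm (Complex.exp _)]
  congr 4
  rw [this]

omit [FiniteDimensional ℝ E] in
theorem integrable_exp_mul {μ : Measure E} {f : E → ℝ} (hf : Integrable f μ) (ℓ : E →L[ℝ] ℝ)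
    (c : ℝ) : Integrable (fun x => Complex.exp (↑(-(c * ℓ x)) * Complex.I) * f x) μ := by
  refine hf.ofReal.bdd_mul (c := 1) (Continuous.aestronglyMeasurable (by fun_prop))
    (ae_of_all _ fun x => ?_)
  rw [Complex.norm_exp_ofReal_mul_I]

theorem tendsto_integral_mul_cos {ν μ : Measure E} [ν.IsAddHaarMeasure] [SigmaFinite μ]
    (hμ : μ ≪ ν) {f : E → ℝ} (hf : Integrable f μ) {ℓ : E →L[ℝ] ℝ} (hℓ : ℓ ≠ 0) {c : ℕ → ℝ}
    (hc : Tendsto c atTop atTop) :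
    Tendsto (fun n : ℕ => ∫ x, f x * Real.cos (c n * ℓ x) ∂μ) atTop (𝓝 0) := by
  have h := (Complex.continuous_re.tendsto _).comp (tendsto_integral_exp_mul hμ f hℓ hc)
  refine h.congr fun n => ?_
  rw [Function.comp_apply]
  refine (integral_re (integrable_exp_mul hf ℓ (c n))).symm.trans ?_
  congr 1 with x
  change (_ : ℂ).re = _
  rw [Complex.re_mul_ofReal, Complex.exp_ofReal_mul_I_re, Real.cos_neg, mul_comm]

theorem tendsto_integral_mul_sin {ν μ : Measure E} [ν.IsAddHaarMeasure] [SigmaFinite μ]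
    (hμ : μ ≪ ν) {f : E → ℝ} (hf : Integrable f μ) {ℓ : E →L[ℝ] ℝ} (hℓ : ℓ ≠ 0) {c : ℕ → ℝ}
    (hc : Tendsto c atTop atTop) :
    Tendsto (fun n : ℕ => ∫ x, f x * Real.sin (c n * ℓ x) ∂μ) atTop (𝓝 0) := by
  have h := ((Complex.continuous_im.tendsto _).comp (tendsto_integral_exp_mul hμ f hℓ hc)).neg
  simp only [Complex.zero_im, neg_zero] at h
  refine h.congr fun n => ?_
  rw [Function.comp_apply]
  refine (congrArg Neg.neg (integral_im (integrable_exp_mul hf ℓ (c n))).symm).trans ?_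
  rw [← integral_neg]
  congr 1 with x
  change -(_ : ℂ).im = _
  rw [Complex.im_mul_ofReal, Complex.exp_ofReal_mul_I_im, Real.sin_neg]
  ring

/-- Write sin² as half of one minus the cosine of the doubled phase; the cosine averages out. -/
theorem tendsto_integral_mul_sin_sq {ν μ : Measure E} [ν.IsAddHaarMeasure] [SigmaFinite μ]
    (hμ : μ ≪ ν) {f : E → ℝ} (hf : Integrable f μ) {ℓ : E →L[ℝ] ℝ} (hℓ : ℓ ≠ 0) {c : ℕ → ℝ}
    (hc : Tendsto c atTop atTop) :
    Tendsto (fun n : ℕ => ∫ x, f x * Real.sin (c n * ℓ x) ^ 2 ∂μ) atTop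
      (𝓝 (2⁻¹ * ∫ x, f x ∂μ)) := by
  have h := (tendsto_integral_mul_cos hμ (hf.const_mul 2⁻¹) hℓ
    (hc.const_mul_atTop two_pos)).const_sub (2⁻¹ * ∫ x, f x ∂μ)
  rw [sub_zero] at h
  refine h.congr fun n => ?_
  rw [← integral_const_mul, ← integral_sub (hf.const_mul _)]
  · congr 1 with x
    rw [Real.sin_sq_eq_half_sub, mul_assoc 2 (c n)]
    ring
  · refine (hf.const_mul 2⁻¹).mul_bdd (c := 1) (by fun_prop) (ae_of_all _ fun x => ?_)
    exact Real.abs_cos_le_one _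

end RiemannLebesgue

/-! ### Perturbations in a ball -/

theorem integrable_fderiv_stressFlux {W : Plane × ℝ → ℂ × ℂ} (hW : Continuous W)
    {ψ : Plane × ℝ → ℝ} (hψ : IsTestFunction ψ) (k : Fin 3) :
    Integrable fun y => fderiv ℝ ψ y (stressFlux k (W y)) := by
  refine Continuous.integrable_of_hasCompactSupport ?_ ?_
  · exact (hψ.1.continuous_fderiv (by simp)).clm_apply ((continuous_stressFlux k).comp hW)
  · refine (hψ.2.fderiv ℝ).mono' fun y hy => subset_tsupport _ ?_
    contrapose! hy
    simp only [Function.mem_support, ne_eq, not_not] at hy ⊢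
    rw [hy]; rfl

theorem IsWeaklyDivFree.add {W W' : Plane × ℝ → ℂ × ℂ} (h : IsWeaklyDivFree W)
    (h' : IsWeaklyDivFree W') (hW : Continuous W) (hW' : Continuous W') :
    IsWeaklyDivFree fun y => W y + W' y := by
  intro k ψ hψ
  simp only [stressFlux_add, map_add]
  rw [integral_add (integrable_fderiv_stressFlux hW hψ k) (integrable_fderiv_stressFlux hW' hψ k),
    h k ψ hψ, h' k ψ hψ, add_zero]

/-- Continuous solutions of the linear system with values in the relaxed states that are
constant outside `Ω`. -/
structure IsRelaxedField (C : ℝ) (U₀ : ℂ × ℂ) (Ω : Set (Plane × ℝ)) (U : Plane × ℝ → ℂ × ℂ) :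
    Prop where
  continuous : Continuous U
  mem : ∀ y, U y ∈ relaxedStates C
  eq_off : ∀ y ∉ Ω, U y = U₀
  divFree : IsWeaklyDivFree fun y => U y - U₀

theorem isRelaxedField_const {C : ℝ} {U₀ : ℂ × ℂ} (h : U₀ ∈ relaxedStates C)
    (Ω : Set (Plane × ℝ)) : IsRelaxedField C U₀ Ω fun _ => U₀ :=
  ⟨continuous_const, fun _ => h, fun _ _ => rfl, fun k ψ _ => by
    simp [stressFlux_zero]⟩

theorem norm_sq_lt_of_mem_relaxedStates {C : ℝ} {U : ℂ × ℂ} (h : U ∈ relaxedStates C) :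
    ‖U.1‖ ^ 2 < C :=
  lt_of_le_of_lt (le_add_of_nonneg_right (norm_nonneg _)) h

theorem norm_le_sqrt_of_mem_relaxedStates {C : ℝ} {U : ℂ × ℂ} (h : U ∈ relaxedStates C) :
    ‖U.1‖ ≤ √C :=
  Real.le_sqrt_of_sq_le (norm_sq_lt_of_mem_relaxedStates h).le

section Local

variable {μ : Measure (Plane × ℝ)} [IsFiniteMeasure μ]

/-- Spheres are null, so smaller closed balls exhaust the mass. A cutoff equal to one on the smaller
ball loses at most half of it. -/
theorem exists_closedBall_half_measure (hμ : μ ≪ volume) (x : Plane × ℝ) {r : ℝ} (hr : 0 < r) :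
    ∃ r', 0 < r' ∧ r' < r ∧
      μ.real (Metric.closedBall x r) / 2 ≤ μ.real (Metric.closedBall x r') := by
  rcases (measureReal_nonneg (μ := μ) (s := Metric.closedBall x r)).eq_or_lt with h | h
  · exact ⟨r / 2, by linarith, by linarith, by rw [← h]; simp⟩
  · have hsphere : μ (Metric.sphere x r) = 0 := hμ (Measure.addHaar_sphere _ _ _)
    have hball : μ.real (Metric.ball x r) = μ.real (Metric.closedBall x r) := by
      have : Metric.ball x r =ᵐ[μ] Metric.closedBall x r := by
        rw [← Metric.ball_union_sphere]
        exact (union_ae_eq_left_of_ae_eq_empty (ae_eq_empty.2 hsphere)).symm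
      exact measureReal_congr this
    set s : ℕ → Set (Plane × ℝ) := fun n => Metric.closedBall x (r - r / (n + 2)) with hs
    have hmono : Monotone s := by
      intro m n hmn
      apply Metric.closedBall_subset_closedBall
      gcongr
    have hU : ⋃ n, s n = Metric.ball x r := by
      ext y
      simp only [mem_iUnion, hs, Metric.mem_closedBall, Metric.mem_ball]
      constructor
      · rintro ⟨n, hn⟩
        have : 0 < r / ((n : ℝ) + 2) := by positivity
        linarith
      · intro hy
        obtain ⟨n, hn⟩ := exists_nat_gt (r / (r - dist y x))
        refine ⟨n, ?_⟩
        have h1 : 0 < r - dist y x := by linarith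
        rw [div_lt_iff₀ h1] at hn
        have h2 : r / ((n : ℝ) + 2) ≤ r - dist y x := by
          rw [div_le_iff₀ (by positivity)]
          nlinarith
        linarith
    have hlim : Tendsto (fun n => μ.real (s n)) atTop (𝓝 (μ.real (Metric.closedBall x r))) := by
      rw [← hball, ← hU]
      exact (ENNReal.tendsto_toReal (measure_ne_top _ _)).comp
        (tendsto_measure_iUnion_atTop hmono)
    obtain ⟨n, hn⟩ := (hlim.eventually (lt_mem_nhds (half_lt_self h))).exists
    refine ⟨r - r / (n + 2), ?_, ?_, hn.le⟩
    · have : r / ((n : ℝ) + 2) < r := by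
        apply div_lt_self hr
        have : (0 : ℝ) ≤ n := n.cast_nonneg
        linarith
      linarith
    · have : 0 < r / ((n : ℝ) + 2) := by positivity
      linarith

theorem tendsto_integral_of_dominated_error {X : Type*} [MeasurableSpace X] {μ : Measure X}
    {g h : ℕ → X → ℝ} {G : X → ℝ} {e : ℕ → ℝ} {L : ℝ}
    (hg : ∀ n, Integrable (g n) μ) (hh : ∀ n, Integrable (h n) μ) (hG : Integrable G μ)
    (he : Tendsto e atTop (𝓝 0)) (hle : ∀ n x, |h n x - g n x| ≤ e n * G x)
    (hL : Tendsto (fun n => ∫ x, g n x ∂μ) atTop (𝓝 L)) :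
    Tendsto (fun n => ∫ x, h n x ∂μ) atTop (𝓝 L) := by
  have h0 : Tendsto (fun n => ∫ x, (h n x - g n x) ∂μ) atTop (𝓝 0) := by
    refine squeeze_zero_norm (a := fun n => e n * ∫ x, G x ∂μ) (fun n => ?_) ?_
    · rw [← integral_const_mul]
      exact norm_integral_le_of_norm_le (hG.const_mul _) (ae_of_all _ (hle n))
    · simpa using he.mul_const (∫ x, G x ∂μ)
  have := hL.add h0
  rw [add_zero] at this
  refine this.congr fun n => ?_
  rw [integral_sub (hh n) (hg n)]; ring

open scoped RealInnerProductSpace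

/-- Perturbation of a relaxed field in a ball by a high-frequency wave: the perturbation is almost
orthogonal to given functions and increases the energy. -/
theorem IsRelaxedField.exists_local_perturbation (hμ : μ ≪ volume) {C : ℝ} {U₀ : ℂ × ℂ}
    {Ω : Set (Plane × ℝ)} {U : Plane × ℝ → ℂ × ℂ} (hU : IsRelaxedField C U₀ Ω U)
    {x : Plane × ℝ} {r : ℝ} (hr : 0 < r) (hB : Metric.closedBall x r ⊆ Ω) {d : ℂ} {b δ : ℝ}
    (hd : d ≠ 0) (hδ : 0 < δ)
    (hseg : ∀ y ∈ Metric.closedBall x r, ∀ s : ℝ, |s| ≤ 1 → ∀ w : ℂ × ℂ, ‖w‖ ≤ δ →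
      U y + s • (d, Complex.I * b * d ^ 2) + w ∈ relaxedStates C)
    (F : Finset (Lp ℂ 2 μ)) {ε : ℝ} (hε : 0 < ε) :
    ∃ U', IsRelaxedField C U₀ Ω U' ∧ (∀ y ∉ Metric.closedBall x r, U' y = U y) ∧
      (∀ f ∈ F, |∫ y, ⟪f y, (U' y).1 - (U y).1⟫ ∂μ| ≤ ε) ∧
      ∫ y, ‖(U y).1‖ ^ 2 ∂μ + ‖d‖ ^ 2 / 8 * μ.real (Metric.closedBall x r)
        ≤ ∫ y, ‖(U' y).1‖ ^ 2 ∂μ := by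
  rcases (measureReal_nonneg (μ := μ) (s := Metric.closedBall x r)).eq_or_lt with h0 | hpos
  · refine ⟨U, hU, fun _ _ => rfl, fun f _ => ?_, by rw [← h0]; simp⟩
    simp [hε.le]
  obtain ⟨r', hr'0, hr'r, hr'⟩ := exists_closedBall_half_measure hμ x hr
  let χ : ContDiffBump x := ⟨r', r, hr'0, hr'r⟩
  have hχ1 : ∀ y, |χ y| ≤ 1 := fun y => by rw [abs_of_nonneg χ.nonneg]; exact χ.le_one
  have hχc : Continuous χ := χ.continuous
  obtain ⟨ℓ, K, W, hℓ, hK, hWc, hWd, hW0, hW⟩ :=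
    exists_localized_wave (χ := χ) χ.contDiff χ.hasCompactSupport hd b
  rw [χ.tsupport_eq] at hW0
  set S : ℕ → Plane × ℝ → ℝ := fun n y => χ y * Real.sin ((n + 1) * ℓ y) with hS
  have hSc : ∀ n, Continuous (S n) := fun n => hχc.mul (by fun_prop)
  have hS1 : ∀ n y, |S n y| ≤ 1 := by
    intro n y
    rw [hS, abs_mul]
    exact mul_le_one₀ (hχ1 y) (abs_nonneg _) (Real.abs_sin_le_one _)
  have hfreq : Tendsto (fun n : ℕ => (n : ℝ) + 1) atTop atTop :=
    tendsto_atTop_add_const_right _ _ tendsto_natCast_atTop_atTop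
  have herr : Tendsto (fun n : ℕ => K / ((n : ℝ) + 1)) atTop (𝓝 0) :=
    tendsto_const_nhds.div_atTop hfreq
  have herrK : ∀ n : ℕ, K / ((n : ℝ) + 1) ≤ K := fun n =>
    div_le_self hK (by have : (0 : ℝ) ≤ n := n.cast_nonneg
                       linarith)
  have hW1 : ∀ n y, ‖(W n y).1 - S n y • d‖ ≤ K / ((n : ℝ) + 1) := fun n y =>
    (norm_fst_le (W n y - S n y • (d, Complex.I * b * d ^ 2))).trans (hW n y)
  have hWb : ∀ n y, ‖(W n y).1‖ ≤ ‖d‖ + K := by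
    intro n y
    have h1 : ‖S n y • d‖ ≤ ‖d‖ := by
      rw [norm_smul]; exact mul_le_of_le_one_left (norm_nonneg _) (hS1 n y)
    have h2 := norm_sub_norm_le (W n y).1 (S n y • d)
    have h3 := hW1 n y
    have h4 := herrK n
    linarith
  have hWm : ∀ n, AEStronglyMeasurable (fun y => (W n y).1) μ := fun n =>
    (continuous_fst.comp (hWc n)).aestronglyMeasurable
  have hWi : ∀ n, Integrable (fun y => (W n y).1) μ := fun n =>
    Integrable.of_bound (hWm n) (‖d‖ + K) (ae_of_all _ (hWb n))
  have horth : ∀ f : Plane × ℝ → ℂ, Integrable f μ →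
      Tendsto (fun n => ∫ y, ⟪f y, (W n y).1⟫ ∂μ) atTop (𝓝 0) := by
    intro f hf
    have hfd : Integrable (fun y => ⟪f y, d⟫ * χ y) μ :=
      (hf.inner_const d).mul_bdd (c := 1) hχc.aestronglyMeasurable (ae_of_all _ hχ1)
    refine tendsto_integral_of_dominated_error (g := fun n y => ⟪f y, S n y • d⟫)
      (G := fun y => ‖f y‖) (e := fun n => K / ((n : ℝ) + 1)) ?_ ?_ hf.norm herr ?_ ?_
    · intro n
      have : Integrable (fun y => ⟪f y, d⟫ * S n y) μ :=
        (hf.inner_const d).mul_bdd (c := 1) (hSc n).aestronglyMeasurable (ae_of_all _ (hS1 n))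
      refine this.congr (ae_of_all _ fun y => ?_)
      simp only [real_inner_smul_right]; ring
    · intro n
      refine Integrable.mono' (hf.norm.mul_const (‖d‖ + K)) (hf.1.inner (hWm n))
        (ae_of_all _ fun y => ?_)
      exact (norm_inner_le_norm _ _).trans (mul_le_mul_of_nonneg_left (hWb n y) (norm_nonneg _))
    · intro n y
      rw [← inner_sub_right, mul_comm]
      exact (abs_real_inner_le_norm _ _).trans
        (mul_le_mul_of_nonneg_left (hW1 n y) (norm_nonneg _))
    · refine (tendsto_integral_mul_sin hμ hfd hℓ hfreq).congr fun n => ?_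
      congr 1 with y
      rw [hS, real_inner_smul_right]; ring
  have hχ2 : Integrable (fun y => ‖d‖ ^ 2 * χ y ^ 2) μ :=
    Integrable.of_bound (by fun_prop) (‖d‖ ^ 2) (ae_of_all _ fun y => by
      rw [norm_mul, Real.norm_of_nonneg (by positivity), norm_pow, Real.norm_eq_abs]
      exact mul_le_of_le_one_right (by positivity) (pow_le_one₀ (abs_nonneg _) (hχ1 y)))
  have hen : Tendsto (fun n => ∫ y, ‖(W n y).1‖ ^ 2 ∂μ) atTop
      (𝓝 (2⁻¹ * ∫ y, ‖d‖ ^ 2 * χ y ^ 2 ∂μ)) := by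
    refine tendsto_integral_of_dominated_error (g := fun n y => ‖S n y • d‖ ^ 2)
      (G := fun _ => 2 * ‖d‖ + K) (e := fun n => K / ((n : ℝ) + 1)) ?_ ?_ (integrable_const _)
      herr ?_ ?_
    · intro n
      refine Integrable.of_bound (Continuous.aestronglyMeasurable
        ((((hSc n).smul continuous_const).norm).pow 2)) (‖d‖ ^ 2) (ae_of_all _ fun y => ?_)
      rw [norm_pow, norm_norm, norm_smul]
      exact pow_le_pow_left₀ (by positivity)
        (mul_le_of_le_one_left (norm_nonneg _) (hS1 n y)) 2
    · intro n
      refine Integrable.of_bound ((hWm n).norm.pow 2) ((‖d‖ + K) ^ 2) (ae_of_all _ fun y => ?_)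
      rw [norm_pow, norm_norm]
      exact pow_le_pow_left₀ (norm_nonneg _) (hWb n y) 2
    · intro n y
      have h1 : ‖S n y • d‖ ≤ ‖d‖ := by
        rw [norm_smul]; exact mul_le_of_le_one_left (norm_nonneg _) (hS1 n y)
      have h2 := (abs_norm_sub_norm_le (W n y).1 (S n y • d)).trans (hW1 n y)
      rw [sq_sub_sq, abs_mul, mul_comm, abs_of_nonneg (a := ‖(W n y).1‖ + _) (by positivity)]
      have := hWb n y
      exact mul_le_mul h2 (by linarith) (by positivity) (by positivity)
    · refine (tendsto_integral_mul_sin_sq hμ hχ2 hℓ hfreq).congr fun n => ?_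
      congr 1 with y
      rw [hS, norm_smul, mul_pow, Real.norm_eq_abs, sq_abs]; ring
  have hUm : AEStronglyMeasurable (fun y => (U y).1) μ :=
    (continuous_fst.comp hU.continuous).aestronglyMeasurable
  have hUi : Integrable (fun y => (U y).1) μ :=
    Integrable.of_bound hUm (√C) (ae_of_all _ fun y => norm_le_sqrt_of_mem_relaxedStates (hU.mem y))
  have hUi2 : Integrable (fun y => ‖(U y).1‖ ^ 2) μ :=
    Integrable.of_bound (hUm.norm.pow 2) C (ae_of_all _ fun y => by
      rw [norm_pow, norm_norm]; exact (norm_sq_lt_of_mem_relaxedStates (hU.mem y)).le)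
  have hWi2 : ∀ n, Integrable (fun y => ‖(W n y).1‖ ^ 2) μ := fun n =>
    Integrable.of_bound ((hWm n).norm.pow 2) ((‖d‖ + K) ^ 2) (ae_of_all _ fun y => by
      rw [norm_pow, norm_norm]
      exact pow_le_pow_left₀ (norm_nonneg _) (hWb n y) 2)
  have hcross : ∀ n, Integrable (fun y => 2 * ⟪(U y).1, (W n y).1⟫) μ := fun n => by
    refine Integrable.const_mul (Integrable.mono' (hUi.norm.mul_const (‖d‖ + K))
      (hUm.inner (hWm n)) (ae_of_all _ fun y => ?_)) 2
    exact (norm_inner_le_norm _ _).trans (mul_le_mul_of_nonneg_left (hWb n y) (norm_nonneg _))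
  -- The cross term disappears in the limit, so the energies of the field and of the wave add.
  have htot : Tendsto (fun n => ∫ y, ‖(U y + W n y).1‖ ^ 2 ∂μ) atTop
      (𝓝 (∫ y, ‖(U y).1‖ ^ 2 ∂μ + 2 * 0 + 2⁻¹ * ∫ y, ‖d‖ ^ 2 * χ y ^ 2 ∂μ)) := by
    refine ((tendsto_const_nhds.add ((horth _ hUi).const_mul 2)).add hen).congr fun n => ?_
    rw [← integral_const_mul, ← integral_add hUi2 (hcross n),
      ← integral_add (hUi2.fun_add (hcross n)) (hWi2 n)]
    congr 1 with y
    rw [Prod.fst_add, norm_add_sq_real]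
  have hχint : ‖d‖ ^ 2 * (μ.real (Metric.closedBall x r) / 2) ≤ ∫ y, ‖d‖ ^ 2 * χ y ^ 2 ∂μ := by
    rw [integral_const_mul]
    refine mul_le_mul_of_nonneg_left (hr'.trans ?_) (by positivity)
    rw [← integral_indicator_one Metric.isClosed_closedBall.measurableSet]
    refine integral_mono_of_nonneg (ae_of_all _ fun y => indicator_nonneg (by simp) y) ?_
      (ae_of_all _ fun y => ?_)
    · exact Integrable.of_bound (by fun_prop) 1 (ae_of_all _ fun y => by
        rw [norm_pow, Real.norm_eq_abs]
        exact pow_le_one₀ (abs_nonneg _) (hχ1 y))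
    · by_cases hy : y ∈ Metric.closedBall x r'
      · simp [hy, χ.one_of_mem_closedBall hy]
      · simp only [indicator_of_notMem hy]; positivity
  have hdpos : 0 < ‖d‖ ^ 2 := pow_pos (norm_pos_iff.2 hd) 2
  -- Averaging sin² costs one factor 1/2 and the cutoff another: the limiting gain is at least ‖d‖²
  -- / 4 times the measure of the ball, so the factor 1/8 is reached for large `n`.
  have hgoal : ∀ᶠ n in atTop, ∫ y, ‖(U y).1‖ ^ 2 ∂μ
      + ‖d‖ ^ 2 / 8 * μ.real (Metric.closedBall x r) ≤ ∫ y, ‖(U y + W n y).1‖ ^ 2 ∂μ := by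
    refine (htot.eventually (lt_mem_nhds ?_)).mono fun n hn => le_of_lt hn
    have : 0 < ‖d‖ ^ 2 * μ.real (Metric.closedBall x r) := mul_pos hdpos hpos
    linarith
  have horthF : ∀ᶠ n in atTop, ∀ f ∈ F, |∫ y, ⟪f y, (W n y).1⟫ ∂μ| ≤ ε := by
    refine (Filter.eventually_all_finset F).2 fun f _ => ?_
    have := (horth f ((Lp.memLp f).integrable one_le_two)).abs
    rw [abs_zero] at this
    exact (this.eventually (gt_mem_nhds hε)).mono fun n hn => le_of_lt hn
  obtain ⟨n, hn1, hn2, hn3⟩ := (hgoal.and (horthF.and (herr.eventually (gt_mem_nhds hδ)))).exists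
  refine ⟨fun y => U y + W n y, ⟨hU.continuous.add (hWc n), fun y => ?_, fun y hy => ?_, ?_⟩,
    fun y hy => ?_, fun f hf => ?_, hn1⟩
  · by_cases hy : y ∈ Metric.closedBall x r
    · have := hseg y hy (S n y) (hS1 n y) (W n y - S n y • (d, Complex.I * b * d ^ 2))
        ((hW n y).trans hn3.le)
      rwa [add_assoc, add_sub_cancel] at this
    · rw [hW0 n y hy, add_zero]; exact hU.mem y
  · rw [hW0 n y fun h => hy (hB h), add_zero, hU.eq_off y hy]
  · have := hU.divFree.add (hWd n) (hU.continuous.sub continuous_const) (hWc n)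
    convert this using 2
    abel
  · simp only [hW0 n y hy, add_zero]
  · simpa using hn2 f hf

end Local

/-! ### Perturbations with a global gain of energy -/

section Global

variable {μ : Measure (Plane × ℝ)} [IsFiniteMeasure μ]

open scoped RealInnerProductSpace

omit [IsFiniteMeasure μ] in
theorem IsRelaxedField.aestronglyMeasurable {C : ℝ} {U₀ : ℂ × ℂ} {Ω : Set (Plane × ℝ)}
    {U : Plane × ℝ → ℂ × ℂ} (hU : IsRelaxedField C U₀ Ω U) :
    AEStronglyMeasurable (fun y => (U y).1) μ :=
  (continuous_fst.comp hU.continuous).aestronglyMeasurable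

theorem IsRelaxedField.memLp {C : ℝ} {U₀ : ℂ × ℂ} {Ω : Set (Plane × ℝ)}
    {U : Plane × ℝ → ℂ × ℂ} (hU : IsRelaxedField C U₀ Ω U) :
    MemLp (fun y => (U y).1) 2 μ :=
  MemLp.of_bound hU.aestronglyMeasurable (√C)
    (ae_of_all _ fun y => norm_le_sqrt_of_mem_relaxedStates (hU.mem y))

theorem IsRelaxedField.integrable_norm_sq {C : ℝ} {U₀ : ℂ × ℂ} {Ω : Set (Plane × ℝ)}
    {U : Plane × ℝ → ℂ × ℂ} (hU : IsRelaxedField C U₀ Ω U) :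
    Integrable (fun y => ‖(U y).1‖ ^ 2) μ :=
  Integrable.of_bound (hU.aestronglyMeasurable.norm.pow 2) C (ae_of_all _ fun y => by
    rw [norm_pow, norm_norm]; exact (norm_sq_lt_of_mem_relaxedStates (hU.mem y)).le)

theorem IsRelaxedField.integrable_inner_sub {C : ℝ} {U₀ : ℂ × ℂ} {Ω : Set (Plane × ℝ)}
    {U U' : Plane × ℝ → ℂ × ℂ} (hU : IsRelaxedField C U₀ Ω U) (hU' : IsRelaxedField C U₀ Ω U')
    (f : Lp ℂ 2 μ) : Integrable (fun y => ⟪f y, (U' y).1 - (U y).1⟫) μ := by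
  refine Integrable.mono' (((Lp.memLp f).integrable one_le_two).norm.mul_const (√C + √C))
    ((Lp.aestronglyMeasurable f).inner (hU'.aestronglyMeasurable.sub hU.aestronglyMeasurable))
    (ae_of_all _ fun y => ?_)
  exact (norm_inner_le_norm _ _).trans (mul_le_mul_of_nonneg_left ((norm_sub_le _ _).trans
    (add_le_add (norm_le_sqrt_of_mem_relaxedStates (hU'.mem y))
      (norm_le_sqrt_of_mem_relaxedStates (hU.mem y)))) (norm_nonneg _))

/-- Perturbation of a relaxed field in finitely many disjoint balls. -/
theorem IsRelaxedField.exists_finset_perturbation (hμ : μ ≪ volume) {C : ℝ} {U₀ : ℂ × ℂ}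
    {Ω : Set (Plane × ℝ)} {U : Plane × ℝ → ℂ × ℂ} (hU : IsRelaxedField C U₀ Ω U)
    (r : Plane × ℝ → ℝ) (d : Plane × ℝ → ℂ) (b δ : Plane × ℝ → ℝ) (F : Finset (Lp ℂ 2 μ))
    (t : Finset (Plane × ℝ))
    (ht : ∀ x ∈ t, 0 < r x ∧ Metric.closedBall x (r x) ⊆ Ω ∧ d x ≠ 0 ∧ 0 < δ x ∧
      ∀ y ∈ Metric.closedBall x (r x), ∀ s : ℝ, |s| ≤ 1 → ∀ w : ℂ × ℂ, ‖w‖ ≤ δ x →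
        U y + s • (d x, Complex.I * b x * d x ^ 2) + w ∈ relaxedStates C)
    (hdisj : (t : Set (Plane × ℝ)).PairwiseDisjoint fun x => Metric.closedBall x (r x)) :
    ∀ ε > 0, ∃ U', IsRelaxedField C U₀ Ω U' ∧
      (∀ y, (∀ x ∈ t, y ∉ Metric.closedBall x (r x)) → U' y = U y) ∧
      (∀ f ∈ F, |∫ y, ⟪f y, (U' y).1 - (U y).1⟫ ∂μ| ≤ ε) ∧
      ∫ y, ‖(U y).1‖ ^ 2 ∂μ + ∑ x ∈ t, ‖d x‖ ^ 2 / 8 * μ.real (Metric.closedBall x (r x))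
        ≤ ∫ y, ‖(U' y).1‖ ^ 2 ∂μ := by
  classical
  induction t using Finset.induction_on with
  | empty =>
    intro ε hε
    exact ⟨U, hU, fun _ _ => rfl, fun f _ => by simp [hε.le], by simp⟩
  | insert a t ha ih =>
    intro ε hε
    obtain ⟨U₁, hU₁, heq, horth, hgain⟩ := ih
      (fun x hx => ht x (Finset.mem_insert_of_mem hx))
      (hdisj.subset (by simp)) (ε / 2) (half_pos hε)
    obtain ⟨ha1, ha2, ha3, ha4, ha5⟩ := ht a (Finset.mem_insert_self _ _)
    -- By disjointness the field is still untouched on the new ball, so the perturbation data chosen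
    -- for `U` remain valid.
    have heqa : ∀ y ∈ Metric.closedBall a (r a), U₁ y = U y := by
      intro y hy
      refine heq y fun x hx hyx => ?_
      have hne : a ≠ x := fun h => ha (h ▸ hx)
      exact Set.disjoint_left.1 (hdisj (by simp) (by simp [hx]) hne) hy hyx
    obtain ⟨U₂, hU₂, heq₂, horth₂, hgain₂⟩ := hU₁.exists_local_perturbation hμ ha1 ha2 ha3 ha4
      (fun y hy => by rw [heqa y hy]; exact ha5 y hy) F (half_pos hε)
    refine ⟨U₂, hU₂, fun y hy => ?_, fun f hf => ?_, ?_⟩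
    · rw [heq₂ y (hy a (Finset.mem_insert_self _ _)),
        heq y fun x hx => hy x (Finset.mem_insert_of_mem hx)]
    · have e : ∫ y, ⟪f y, (U₂ y).1 - (U y).1⟫ ∂μ
          = ∫ y, ⟪f y, (U₂ y).1 - (U₁ y).1⟫ ∂μ + ∫ y, ⟪f y, (U₁ y).1 - (U y).1⟫ ∂μ := by
        rw [← integral_add (hU₁.integrable_inner_sub hU₂ f) (hU.integrable_inner_sub hU₁ f)]
        congr 1 with y
        rw [← inner_add_right, sub_add_sub_cancel]
      rw [e]
      have := abs_add_le (∫ y, ⟪f y, (U₂ y).1 - (U₁ y).1⟫ ∂μ) (∫ y, ⟪f y, (U₁ y).1 - (U y).1⟫ ∂μ)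
      have := horth f hf
      have := horth₂ f hf
      linarith
    · rw [Finset.sum_insert ha]
      linarith

/-- Around every point, a relaxed field can be perturbed in all sufficiently small balls. -/
theorem IsRelaxedField.exists_perturbation_data {C : ℝ} {U₀ : ℂ × ℂ}
    {Ω : Set (Plane × ℝ)} (hΩ : IsOpen Ω) {U : Plane × ℝ → ℂ × ℂ} (hU : IsRelaxedField C U₀ Ω U)
    {x : Plane × ℝ} (hx : x ∈ Ω) :
    ∃ (d : ℂ) (b δ R : ℝ), ‖d‖ ^ 2 = (C - ‖(U x).1‖ ^ 2) ^ 2 / (64 * C) ∧ d ≠ 0 ∧ 0 < δ ∧ 0 < R ∧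
      Metric.closedBall x R ⊆ Ω ∧ (∀ y ∈ Metric.closedBall x R,
        C - ‖(U y).1‖ ^ 2 ≤ 2 * (C - ‖(U x).1‖ ^ 2) ∧
        ∀ s : ℝ, |s| ≤ 1 → ∀ w : ℂ × ℂ, ‖w‖ ≤ δ →
          U y + s • (d, Complex.I * b * d ^ 2) + w ∈ relaxedStates C) := by
  obtain ⟨d, b, hd, hd0, hseg⟩ := exists_segment_relaxedStates (hU.mem x)
  have hcomp : IsCompact ((fun s : ℝ => U x + s • (d, Complex.I * b * d ^ 2)) '' Icc (-1) 1) :=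
    isCompact_Icc.image (by fun_prop)
  -- A compact segment in an open set has room around it; half is spent on the variation of `U` over
  -- the ball, half on the error `w`.
  obtain ⟨δ, hδ, hthick⟩ := hcomp.exists_cthickening_subset_open (isOpen_relaxedStates C) (by
    rintro _ ⟨s, hs, rfl⟩
    exact hseg s (abs_le.2 hs))
  have hg : 0 < C - ‖(U x).1‖ ^ 2 := sub_pos.2 (norm_sq_lt_of_mem_relaxedStates (hU.mem x))
  have hcont := hU.continuous
  have e1 : ∀ᶠ y in 𝓝 x, ‖U y - U x‖ < δ / 2 := by
    have : Tendsto (fun y => ‖U y - U x‖) (𝓝 x) (𝓝 ‖U x - U x‖) :=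
      ((hcont.sub continuous_const).norm).tendsto x
    rw [sub_self, norm_zero] at this
    exact this.eventually (gt_mem_nhds (half_pos hδ))
  have e2 : ∀ᶠ y in 𝓝 x, C - ‖(U y).1‖ ^ 2 < 2 * (C - ‖(U x).1‖ ^ 2) := by
    have : Tendsto (fun y => C - ‖(U y).1‖ ^ 2) (𝓝 x) (𝓝 (C - ‖(U x).1‖ ^ 2)) :=
      (continuous_const.sub ((continuous_fst.comp hcont).norm.pow 2)).tendsto x
    exact this.eventually (gt_mem_nhds (by linarith))
  obtain ⟨R, hR, hball⟩ := Metric.nhds_basis_closedBall.mem_iff.1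
    ((e1.and e2).and (hΩ.mem_nhds hx))
  refine ⟨d, b, δ / 2, R, hd, hd0, half_pos hδ, hR, fun y hy => (hball hy).2, fun y hy => ?_⟩
  obtain ⟨⟨h1, h2⟩, -⟩ := hball hy
  refine ⟨le_of_lt h2, fun s hs w hw => hthick ?_⟩
  refine Metric.mem_cthickening_of_dist_le _ (U x + s • (d, Complex.I * b * d ^ 2)) _ _
    ⟨s, abs_le.1 hs, rfl⟩ ?_
  rw [dist_eq_norm]
  have : U y + s • (d, Complex.I * b * d ^ 2) + w - (U x + s • (d, Complex.I * b * d ^ 2))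
      = (U y - U x) + w := by abel
  rw [this]
  have h1' : ‖U y - U x‖ < δ / 2 := h1
  exact (norm_add_le _ _).trans (by linarith)

/-- The Cauchy-Schwarz inequality, obtained by integrating a square; the `+ 1` keeps the denominator
positive for the zero measure. -/
theorem sq_integral_le {X : Type*} [MeasurableSpace X] {μ : Measure X} [IsFiniteMeasure μ]
    {g : X → ℝ} (hg : Integrable g μ) (hg2 : Integrable (fun x => g x ^ 2) μ) :
    (∫ x, g x ∂μ) ^ 2 / (μ.real univ + 1) ≤ ∫ x, g x ^ 2 ∂μ := by
  set G := ∫ x, g x ∂μ with hG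
  set m := μ.real univ with hm
  have hm0 : 0 ≤ m := measureReal_nonneg
  set t := G / (m + 1) with ht
  have h0 : 0 ≤ ∫ x, (g x - t) ^ 2 ∂μ := integral_nonneg fun x => sq_nonneg _
  have e : ∫ x, (g x - t) ^ 2 ∂μ = ∫ x, g x ^ 2 ∂μ - 2 * t * G + t ^ 2 * m := by
    have : ∀ x, (g x - t) ^ 2 = g x ^ 2 - 2 * t * g x + t ^ 2 := fun x => by ring
    simp_rw [this]
    have hs : Integrable (fun x => g x ^ 2 - 2 * t * g x) μ := hg2.sub (hg.const_mul _)
    rw [integral_add hs (integrable_const _),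
      integral_sub hg2 (hg.const_mul _), integral_const_mul, integral_const, smul_eq_mul,
      mul_comm (μ.real univ)]
  have h1 : G = t * (m + 1) := by rw [ht]; field_simp
  have h2 : G ^ 2 / (m + 1) = t ^ 2 * (m + 1) := by rw [h1]; field_simp
  rw [h2]
  rw [e, h1] at h0
  nlinarith [sq_nonneg t]

/-- Perturbation of a relaxed field with a gain of energy that is controlled by the distance to the
maximal energy. -/
theorem IsRelaxedField.exists_perturbation (hμ : μ ≪ volume) {C : ℝ} {U₀ : ℂ × ℂ}
    {Ω : Set (Plane × ℝ)} (hΩ : IsOpen Ω) (hΩμ : μ Ωᶜ = 0) {U : Plane × ℝ → ℂ × ℂ}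
    (hU : IsRelaxedField C U₀ Ω U) (F : Finset (Lp ℂ 2 μ)) {ε : ℝ} (hε : 0 < ε) :
    ∃ U', IsRelaxedField C U₀ Ω U' ∧
      (∀ f ∈ F, |∫ y, ⟪f y, (U' y).1 - (U y).1⟫ ∂μ| ≤ ε) ∧
      ∫ y, ‖(U y).1‖ ^ 2 ∂μ + (4096 * C * (μ.real univ + 1))⁻¹
        * (C * μ.real univ - ∫ y, ‖(U y).1‖ ^ 2 ∂μ) ^ 2 ≤ ∫ y, ‖(U' y).1‖ ^ 2 ∂μ := by
  classical
  have hC : 0 < C := lt_of_le_of_lt (sq_nonneg _) (norm_sq_lt_of_mem_relaxedStates (hU.mem 0))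
  set g : Plane × ℝ → ℝ := fun y => C - ‖(U y).1‖ ^ 2 with hg
  have hg0 : ∀ y, 0 < g y := fun y => sub_pos.2 (norm_sq_lt_of_mem_relaxedStates (hU.mem y))
  have hgC : ∀ y, g y ≤ C := fun y => by
    have := sq_nonneg ‖(U y).1‖
    simp only [hg]; linarith
  have hgi : Integrable g μ := (integrable_const C).sub hU.integrable_norm_sq
  have hgi2 : Integrable (fun y => g y ^ 2) μ :=
    Integrable.of_bound (hgi.1.pow 2) (C ^ 2) (ae_of_all _ fun y => by
      rw [norm_pow, Real.norm_of_nonneg (hg0 y).le]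
      exact pow_le_pow_left₀ (hg0 y).le (hgC y) 2)
  have hdata := fun x (hx : x ∈ Ω) => hU.exists_perturbation_data hΩ hx
  choose! d b δ R hd hd0 hδ hR hRΩ hdat using hdata
  -- A Besicovitch covering: disjoint balls, as small as the perturbation data require, fill `Ω` up
  -- to a null set.
  obtain ⟨t, r, htc, htΩ, hr, hcov, hdisj⟩ := Besicovitch.exists_disjoint_closedBall_covering_ae μ
    (fun x => Ioc 0 (R x)) Ω (fun x hx η hη => ⟨min (R x) (η / 2), by
      have := hR x hx
      refine ⟨⟨lt_min this (half_pos hη), min_le_left _ _⟩, lt_min this (half_pos hη), ?_⟩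
      exact (min_le_right _ _).trans_lt (half_lt_self hη)⟩) (fun _ => 1) (fun _ _ => one_pos)
  have hr0 : ∀ x ∈ t, 0 < r x ∧ r x ≤ R x := fun x hx => (hr x hx).1
  have hsub : ∀ x ∈ t, Metric.closedBall x (r x) ⊆ Metric.closedBall x (R x) := fun x hx =>
    Metric.closedBall_subset_closedBall (hr0 x hx).2
  have : Countable t := htc.to_subtype
  have hsum := hasSum_integral_iUnion (μ := μ) (f := fun y => g y ^ 2)
    (s := fun x : t => Metric.closedBall (x : Plane × ℝ) (r x))
    (fun x => Metric.isClosed_closedBall.measurableSet)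
    (fun x y hxy => hdisj x.2 y.2 fun h => hxy (Subtype.ext h)) hgi2.integrableOn
  have hall : ∫ y in ⋃ x : t, Metric.closedBall (x : Plane × ℝ) (r x), g y ^ 2 ∂μ
      = ∫ y, g y ^ 2 ∂μ := by
    have : (⋃ x : t, Metric.closedBall (x : Plane × ℝ) (r x)) =ᵐ[μ] univ := by
      rw [ae_eq_univ]
      refine measure_mono_null (t := Ωᶜ ∪ (Ω \ ⋃ x ∈ t, Metric.closedBall x (r x))) ?_
        (measure_union_null hΩμ hcov)
      intro y hy
      by_cases hyΩ : y ∈ Ω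
      · refine Or.inr ⟨hyΩ, fun h => hy ?_⟩
        rw [← biUnion_eq_iUnion (s := t) (t := fun x _ => Metric.closedBall x (r x))]
        exact h
      · exact Or.inl hyΩ
    rw [setIntegral_congr_set this, setIntegral_univ]
  rw [hall] at hsum
  -- Finitely many balls carry half of the integral, since only finitely many perturbations can be
  -- superposed.
  obtain ⟨s, hs⟩ : ∃ s : Finset t, (∫ y, g y ^ 2 ∂μ) / 2
      ≤ ∑ x ∈ s, ∫ y in Metric.closedBall (x : Plane × ℝ) (r x), g y ^ 2 ∂μ := by
    rcases (integral_nonneg fun y => sq_nonneg (g y) : 0 ≤ ∫ y, g y ^ 2 ∂μ).eq_or_lt with h | h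
    · exact ⟨∅, by rw [← h]; simp⟩
    · obtain ⟨s, hs⟩ := (hsum.eventually (lt_mem_nhds (half_lt_self h))).exists
      exact ⟨s, le_of_lt hs⟩
  have hmem : ∀ x ∈ s.map (Function.Embedding.subtype _), x ∈ t := by
    intro x hx
    obtain ⟨y, -, rfl⟩ := Finset.mem_map.1 hx
    exact y.2
  obtain ⟨U', hU', -, horth, hgain⟩ := hU.exists_finset_perturbation hμ r d b δ F
    (s.map (Function.Embedding.subtype _)) (fun x hx => by
      have hx' := hmem x hx
      have hxΩ := htΩ hx'
      exact ⟨(hr0 x hx').1, (hsub x hx').trans (hRΩ x hxΩ), hd0 x hxΩ, hδ x hxΩ,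
        fun y hy => (hdat x hxΩ y (hsub x hx' hy)).2⟩)
    (hdisj.subset fun x hx => hmem x hx) ε hε
  refine ⟨U', hU', horth, le_trans (add_le_add le_rfl ?_) hgain⟩
  have hG : C * μ.real univ - ∫ y, ‖(U y).1‖ ^ 2 ∂μ = ∫ y, g y ∂μ := by
    rw [hg, integral_sub (integrable_const _) hU.integrable_norm_sq, integral_const, smul_eq_mul,
      mul_comm]
  rw [hG, Finset.sum_map]
  -- On a ball `g` is at most twice its value at the centre, a factor 4 for squares; with the 64 in
  -- ‖d‖² and the 8 of the local gain this makes 2048.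
  have hball : ∀ x ∈ s, (∫ y in Metric.closedBall (x : Plane × ℝ) (r x), g y ^ 2 ∂μ) / (2048 * C)
      ≤ ‖d x‖ ^ 2 / 8 * μ.real (Metric.closedBall (x : Plane × ℝ) (r x)) := by
    intro x _
    have hxΩ := htΩ x.2
    have h1 : ∫ y in Metric.closedBall (x : Plane × ℝ) (r x), g y ^ 2 ∂μ
        ≤ ∫ y in Metric.closedBall (x : Plane × ℝ) (r x), (2 * g x) ^ 2 ∂μ := by
      refine setIntegral_mono_on hgi2.integrableOn (integrable_const _).integrableOn
        Metric.isClosed_closedBall.measurableSet fun y hy => ?_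
      exact pow_le_pow_left₀ (hg0 y).le (hdat x hxΩ y (hsub x x.2 hy)).1 2
    rw [setIntegral_const, smul_eq_mul] at h1
    rw [hd x hxΩ, div_le_iff₀ (by positivity)]
    refine h1.trans (le_of_eq ?_)
    simp only [hg]
    field_simp
    ring
  have hfin := Finset.sum_le_sum hball
  rw [← Finset.sum_div] at hfin
  have hcs := sq_integral_le hgi hgi2
  have h1 : (∫ y, g y ^ 2 ∂μ) / (4096 * C)
      ≤ (∑ x ∈ s, ∫ y in Metric.closedBall (x : Plane × ℝ) (r x), g y ^ 2 ∂μ) / (2048 * C) := by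
    rw [div_le_div_iff₀ (by positivity) (by positivity)]
    nlinarith
  refine le_trans ?_ (h1.trans hfin)
  have h2 := div_le_div_of_nonneg_right hcs (c := 4096 * C) (by positivity)
  refine le_trans (le_of_eq ?_) h2
  have : 0 ≤ μ.real univ := measureReal_nonneg
  field_simp

end Global

/-! ### Fields with maximal energy -/

section Limit

open scoped RealInnerProductSpace

/-- Relaxed states are bounded because |z| ≤ |v|² + |v² - z|. This supplies the majorant for limits
of fluxes. -/
theorem exists_bound_stressFlux (C : ℝ) (U₀ : ℂ × ℂ) (k : Fin 3) :
    ∃ B, ∀ U ∈ relaxedStates C, ‖stressFlux k (U - U₀)‖ ≤ B := by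
  obtain ⟨B, hB⟩ := (isCompact_closedBall (0 : ℂ × ℂ) (√C + 2 * C)).exists_bound_of_continuousOn
    (f := fun U => stressFlux k (U - U₀))
    ((continuous_stressFlux k).comp (continuous_id.sub continuous_const)).continuousOn
  refine ⟨B, fun U hU => hB U ?_⟩
  have h1 := norm_le_sqrt_of_mem_relaxedStates hU
  have h2 := norm_sq_lt_of_mem_relaxedStates hU
  have h3 : ‖U.1‖ ^ 2 + ‖U.1 ^ 2 - U.2‖ < C := hU
  have h4 : ‖U.2‖ ≤ ‖U.1 ^ 2‖ + ‖U.1 ^ 2 - U.2‖ := by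
    have := norm_sub_le (U.1 ^ 2) (U.1 ^ 2 - U.2)
    rwa [sub_sub_cancel] at this
  rw [norm_pow] at h4
  have h5 := sq_nonneg ‖U.1‖
  have h6 := Real.sqrt_nonneg C
  rw [mem_closedBall_zero_iff, Prod.norm_def]
  exact max_le (by linarith) (by linarith)

variable {μ : Measure (Plane × ℝ)} [IsFiniteMeasure μ]

omit [IsFiniteMeasure μ] in
theorem norm_toLp_sq {f : Plane × ℝ → ℂ} (hf : MemLp f 2 μ) :
    ‖hf.toLp f‖ ^ 2 = ∫ y, ‖f y‖ ^ 2 ∂μ := by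
  rw [← real_inner_self_eq_norm_sq, L2.inner_def]
  refine integral_congr_ae ?_
  filter_upwards [hf.coeFn_toLp] with y hy
  rw [hy, real_inner_self_eq_norm_sq]

omit [IsFiniteMeasure μ] in
theorem norm_Lp_sq (u : Lp ℂ 2 μ) : ‖u‖ ^ 2 = ∫ y, ‖u y‖ ^ 2 ∂μ := by
  rw [← real_inner_self_eq_norm_sq, L2.inner_def]
  simp only [real_inner_self_eq_norm_sq]

/-- Near every relaxed state in the weak topology, there is a strong limit of relaxed fields with
maximal energy. -/
theorem exists_maximal_limit (hμ : μ ≪ volume) {C : ℝ} {U₀ : ℂ × ℂ}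
    {Ω : Set (Plane × ℝ)} (hΩ : IsOpen Ω) (hΩμ : μ Ωᶜ = 0) (hU₀ : U₀ ∈ relaxedStates C)
    (F : Finset (Lp ℂ 2 μ)) {ε : ℝ} (hε : 0 < ε) (u₀ : Lp ℂ 2 μ) (hu₀ : u₀ =ᵐ[μ] fun _ => U₀.1) :
    ∃ u ∈ closure {u : Lp ℂ 2 μ | ∃ U, IsRelaxedField C U₀ Ω U ∧ u =ᵐ[μ] fun y => (U y).1},
      ‖u‖ ^ 2 = C * μ.real univ ∧ ∀ f ∈ F, |⟪f, u - u₀⟫| ≤ ε := by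
  have hC : 0 < C := lt_of_le_of_lt (sq_nonneg _) (norm_sq_lt_of_mem_relaxedStates hU₀)
  have hnorm : ∀ (u : Lp ℂ 2 μ) (U : Plane × ℝ → ℂ × ℂ), u =ᵐ[μ] (fun y => (U y).1) →
      ‖u‖ ^ 2 = ∫ y, ‖(U y).1‖ ^ 2 ∂μ := by
    intro u U h
    rw [norm_Lp_sq]
    exact integral_congr_ae (h.mono fun y hy => by simp only [hy])
  refine exists_mem_closure_norm_sq_eq (X := {u : Lp ℂ 2 μ | ∃ U, IsRelaxedField C U₀ Ω U ∧
    u =ᵐ[μ] fun y => (U y).1}) (u₀ := u₀) (c := (4096 * C * (μ.real univ + 1))⁻¹) ?_ ?_ ?_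
    ⟨fun _ => U₀, isRelaxedField_const hU₀ Ω, hu₀⟩ F hε
  · have : 0 ≤ μ.real univ := measureReal_nonneg
    positivity
  · rintro u ⟨U, hU, hu⟩
    rw [hnorm u U hu, mul_comm, ← smul_eq_mul, ← integral_const]
    exact integral_mono hU.integrable_norm_sq (integrable_const _) fun y =>
      (norm_sq_lt_of_mem_relaxedStates (hU.mem y)).le
  · rintro u ⟨U, hU, hu⟩ F ε hε
    obtain ⟨U', hU', h1, h2⟩ := hU.exists_perturbation hμ hΩ hΩμ F hε
    refine ⟨hU'.memLp.toLp _, ⟨U', hU', hU'.memLp.coeFn_toLp⟩, fun f hf => ?_, ?_⟩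
    · convert h1 f hf using 2
      rw [L2.inner_def]
      refine integral_congr_ae ?_
      filter_upwards [hU'.memLp.coeFn_toLp, hu, Lp.coeFn_sub (hU'.memLp.toLp _) u] with y h3 h4 h5
      rw [h5, Pi.sub_apply, h3, h4]
    · rw [hnorm u U hu, norm_toLp_sq]
      exact h2

/-- Properties of the strong limits with maximal energy. -/
theorem maximal_limit_properties {Ω : Set (Plane × ℝ)} {C : ℝ} {U₀ : ℂ × ℂ}
    (hμΩ : ae μ = ae (volume.restrict Ω)) {u : Lp ℂ 2 μ}
    (hu : u ∈ closure {u : Lp ℂ 2 μ | ∃ U, IsRelaxedField C U₀ Ω U ∧ u =ᵐ[μ] fun y => (U y).1})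
    (hnorm : ‖u‖ ^ 2 = C * μ.real univ) :
    (∀ᵐ y ∂volume.restrict Ω, ‖u y‖ ^ 2 = C) ∧
      ∀ (k : Fin 3) (ψ : Plane × ℝ → ℝ), IsTestFunction ψ →
        ∫ y in Ω, fderiv ℝ ψ y (stressFlux k ((u y, u y ^ 2) - U₀)) = 0 := by
  obtain ⟨v, hvX, hv⟩ := mem_closure_iff_seq_limit.1 hu
  choose U hU hvU using hvX
  -- Strong convergence gives convergence almost everywhere along a subsequence, so pointwise
  -- constraints survive.
  obtain ⟨ns, -, hae⟩ := (tendstoInMeasure_of_tendsto_Lp hv).exists_seq_tendsto_ae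
  have hlim : ∀ᵐ y ∂μ, Tendsto (fun n => (U (ns n) y).1) atTop (𝓝 (u y)) := by
    filter_upwards [hae, ae_all_iff.2 hvU] with y h1 h2
    exact h1.congr fun n => h2 (ns n)
  have hle : ∀ᵐ y ∂μ, ‖u y‖ ^ 2 ≤ C := by
    filter_upwards [hlim] with y hy
    exact le_of_tendsto' (hy.norm.pow 2) fun n =>
      (norm_sq_lt_of_mem_relaxedStates ((hU (ns n)).mem y)).le
  have hi : Integrable (fun y => ‖u y‖ ^ 2) μ := (Lp.memLp u).integrable_norm_pow two_ne_zero
  -- The pointwise bound by `C` is saturated in the integral, hence almost everywhere.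
  have heq : ∀ᵐ y ∂μ, ‖u y‖ ^ 2 = C := by
    have h0 : ∫ y, (C - ‖u y‖ ^ 2) ∂μ = 0 := by
      rw [integral_sub (integrable_const _) hi, ← norm_Lp_sq, hnorm, integral_const, smul_eq_mul,
        mul_comm, sub_self]
    have := (integral_eq_zero_iff_of_nonneg_ae (hle.mono fun y hy => sub_nonneg.2 hy)
      ((integrable_const _).sub hi)).1 h0
    filter_upwards [this] with y hy
    have : C - ‖u y‖ ^ 2 = 0 := hy
    linarith
  -- For relaxed states |v² - z| is dominated by C - |v|², so saturation of the velocity forces z →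
  -- v²: the nonlinear constraint appears in the limit.
  have hlim2 : ∀ᵐ y ∂μ, Tendsto (fun n => U (ns n) y) atTop (𝓝 (u y, u y ^ 2)) := by
    filter_upwards [hlim, heq] with y h1 h2
    have h3 : Tendsto (fun n => (U (ns n) y).1 ^ 2 - (U (ns n) y).2) atTop (𝓝 0) := by
      refine squeeze_zero_norm (a := fun n => C - ‖(U (ns n) y).1‖ ^ 2) (fun n => ?_) ?_
      · have : ‖(U (ns n) y).1‖ ^ 2 + ‖(U (ns n) y).1 ^ 2 - (U (ns n) y).2‖ < C :=
          (hU (ns n)).mem y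
        linarith
      · have := (h1.norm.pow 2).const_sub C
        rwa [h2, sub_self] at this
    have h4 := (h1.pow 2).sub h3
    simp only [sub_sub_cancel, sub_zero] at h4
    exact h1.prodMk_nhds h4
  rw [hμΩ] at heq hlim2
  refine ⟨heq, fun k ψ hψ => ?_⟩
  obtain ⟨B, hB⟩ := exists_bound_stressFlux C U₀ k
  have hzero : ∀ n, ∫ y in Ω, fderiv ℝ ψ y (stressFlux k (U (ns n) y - U₀)) = 0 := by
    intro n
    rw [setIntegral_eq_integral_of_forall_compl_eq_zero, (hU (ns n)).divFree k ψ hψ]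
    intro y hy
    rw [(hU (ns n)).eq_off y hy, sub_self, stressFlux_zero, map_zero]
  have hbd : Integrable (fun y => ‖fderiv ℝ ψ y‖ * B) (volume.restrict Ω) :=
    (((hψ.1.continuous_fderiv (by simp)).integrable_of_hasCompactSupport
      (hψ.2.fderiv ℝ)).norm.mul_const B).integrableOn
  have hconv := tendsto_integral_of_dominated_convergence (μ := volume.restrict Ω)
    (F := fun n y => fderiv ℝ ψ y (stressFlux k (U (ns n) y - U₀)))
    (f := fun y => fderiv ℝ ψ y (stressFlux k ((u y, u y ^ 2) - U₀)))
    (fun y => ‖fderiv ℝ ψ y‖ * B) (fun n => ?_) hbd (fun n => ae_of_all _ fun y => ?_) ?_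
  · simp only [hzero] at hconv
    exact (tendsto_nhds_unique hconv tendsto_const_nhds)
  · exact Continuous.aestronglyMeasurable ((hψ.1.continuous_fderiv (by simp)).clm_apply
      ((continuous_stressFlux k).comp ((hU (ns n)).continuous.sub continuous_const)))
  · exact ((fderiv ℝ ψ y).le_opNorm _).trans
      (mul_le_mul_of_nonneg_left (hB _ ((hU (ns n)).mem y)) (norm_nonneg _))
  · filter_upwards [hlim2] with y hy
    exact ((fderiv ℝ ψ y).continuous.tendsto _).comp
      (((continuous_stressFlux k).tendsto _).comp (hy.sub_const U₀))

end Limit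

/-- Infinitely many bounded solutions of the nonlinear constraint and the linear system which
coincide with a given relaxed state in the mean. -/
theorem exists_infinitely_many_fields {Ω : Set (Plane × ℝ)} (hΩ : IsOpen Ω) (hne : Ω.Nonempty)
    {C : ℝ} {U₀ : ℂ × ℂ} (hU₀ : U₀ ∈ relaxedStates C) :
    ∃ V : ℕ → Plane × ℝ → ℂ, (∀ n, StronglyMeasurable (V n)) ∧
      (∀ n, ∀ᵐ y ∂volume.restrict Ω, ‖V n y‖ ^ 2 = C) ∧
      (∀ n (k : Fin 3) (ψ : Plane × ℝ → ℝ), IsTestFunction ψ →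
        ∫ y in Ω, fderiv ℝ ψ y (stressFlux k ((V n y, V n y ^ 2) - U₀)) = 0) ∧
      ∀ m n, m ≠ n → ¬ ∀ᵐ y ∂volume.restrict Ω, V m y = V n y := by
  classical
  -- A finite measure with the null sets of the volume on `Ω` puts bounded fields into L² even when
  -- `Ω` has infinite volume.
  set μ : Measure (Plane × ℝ) := (volume.restrict Ω).toFinite with hμdef
  have hμΩ : ae μ = ae (volume.restrict Ω) := ae_toFinite
  have hμ : μ ≪ volume :=
    (toFinite_absolutelyContinuous _).trans Measure.absolutelyContinuous_restrict
  have hΩμ : μ Ωᶜ = 0 := by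
    apply toFinite_absolutelyContinuous
    rw [Measure.restrict_apply hΩ.measurableSet.compl, compl_inter_self, measure_empty]
  have hμ0 : 0 < μ.real univ := by
    refine ENNReal.toReal_pos ?_ (measure_ne_top _ _)
    intro h
    have h1 : volume.restrict Ω univ = 0 := absolutelyContinuous_toFinite _ h
    rw [Measure.restrict_apply_univ] at h1
    exact (hΩ.measure_pos volume hne).ne' h1
  let u₀ : Lp ℂ 2 μ := (memLp_const U₀.1).toLp _
  have hu₀ : u₀ =ᵐ[μ] fun _ => U₀.1 := MemLp.coeFn_toLp _
  set X := {u : Lp ℂ 2 μ | ∃ U, IsRelaxedField C U₀ Ω U ∧ u =ᵐ[μ] fun y => (U y).1}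
  set S : Set (Lp ℂ 2 μ) := {u | u ∈ closure X ∧ ‖u‖ ^ 2 = C * μ.real univ} with hS
  have hu₀norm : ‖u₀‖ ^ 2 < C * μ.real univ := by
    rw [norm_toLp_sq, integral_const, smul_eq_mul, mul_comm]
    exact mul_lt_mul_of_pos_right (norm_sq_lt_of_mem_relaxedStates hU₀) hμ0
  -- Were `S` finite, a maximal limit tested against all differences `u - u₀` with u ∈ S would be
  -- tested against its own difference, making ‖u - u₀‖² at most an `ε` chosen smaller than all
  -- these numbers.
  have hinf : S.Infinite := by
    intro hfin
    have hev : ∀ᶠ ε in 𝓝[>] (0 : ℝ), ∀ u ∈ S, ε < ‖u - u₀‖ ^ 2 := by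
      refine (Filter.eventually_all_finite hfin).2 fun u hu => ?_
      refine (Filter.Eventually.filter_mono nhdsWithin_le_nhds (gt_mem_nhds ?_))
      have : u ≠ u₀ := by
        rintro rfl
        exact hu₀norm.ne hu.2
      exact pow_pos (norm_pos_iff.2 (sub_ne_zero.2 this)) 2
    obtain ⟨ε, hε, hε0⟩ := (hev.and self_mem_nhdsWithin).exists
    obtain ⟨u, hu, hun, horth⟩ := exists_maximal_limit hμ hΩ hΩμ hU₀
      (hfin.toFinset.image fun u => u - u₀) (mem_Ioi.1 hε0) u₀ hu₀
    have hm : u ∈ S := ⟨hu, hun⟩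
    have h1 := horth (u - u₀) (Finset.mem_image_of_mem _ (hfin.mem_toFinset.2 hm))
    rw [real_inner_self_eq_norm_sq, abs_of_nonneg (sq_nonneg _)] at h1
    exact (hε u hm).not_ge h1
  let e := hinf.natEmbedding
  have hp := fun n => maximal_limit_properties (Ω := Ω) (C := C) (U₀ := U₀) hμΩ (e n).2.1 (e n).2.2
  refine ⟨fun n => (e n : Lp ℂ 2 μ), fun n => Lp.stronglyMeasurable _, fun n => (hp n).1,
    fun n => (hp n).2, fun m n hmn h => hmn ?_⟩
  rw [← hμΩ] at h
  exact e.injective (Subtype.ext (Lp.ext h))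

/-! ### Solutions from fan subsolutions -/

/-- The region between the planes `x₂ = νl t` and `x₂ = νr t`. -/
def fanRegion (νl νr : ℝ) : Set (Plane × ℝ) :=
  {z | 0 < z.2 ∧ νl * z.2 < z.1 1 ∧ z.1 1 < νr * z.2}

theorem isOpen_fanRegion (νl νr : ℝ) : IsOpen (fanRegion νl νr) := by
  have h : ∀ f g : Plane × ℝ → ℝ, Continuous f → Continuous g → IsOpen {z | f z < g z} :=
    fun _ _ => isOpen_lt
  exact (h (fun _ => 0) (fun z => z.2) (by fun_prop) (by fun_prop)).inter
    ((h (fun z => νl * z.2) (fun z => z.1 1) (by fun_prop) (by fun_prop)).inter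
      (h (fun z => z.1 1) (fun z => νr * z.2) (by fun_prop) (by fun_prop)))

theorem fanRegion_nonempty {νl νr : ℝ} (h : νl < νr) : (fanRegion νl νr).Nonempty :=
  ⟨(!₂[0, (νl + νr) / 2], 1), by simp only [fanRegion, mem_ofPred_eq]; norm_num; constructor <;>
    linarith⟩

theorem fanRegion_subset_spaceTime (νl νr : ℝ) : fanRegion νl νr ⊆ spaceTime := fun _ h => h.1

theorem measurableSet_spaceTime : MeasurableSet spaceTime :=
  (isOpen_lt (by fun_prop) (by fun_prop)).measurableSet

theorem restrict_fanRegion_eq (νl νr : ℝ) :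
    spaceTimeMeasure.restrict (fanRegion νl νr) = volume.restrict (fanRegion νl νr) := by
  rw [spaceTimeMeasure, Measure.restrict_restrict_of_subset (fanRegion_subset_spaceTime νl νr)]

theorem ae_ne_interface (ν : ℝ) : ∀ᵐ z ∂spaceTimeMeasure, z.1 1 ≠ ν * z.2 := by
  refine ae_restrict_of_ae ?_
  let L : Plane × ℝ →L[ℝ] ℝ := (EuclideanSpace.proj (𝕜 := ℝ) (1 : Fin 2)).comp
    (ContinuousLinearMap.fst ℝ Plane ℝ) - ν • ContinuousLinearMap.snd ℝ Plane ℝ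
  have h0 := Measure.addHaar_submodule (volume : Measure (Plane × ℝ))
    (LinearMap.ker L.toLinearMap) ?_
  · rw [ae_iff]
    convert h0 using 2
    ext z
    simp [L, sub_eq_zero]
  · intro h
    have : ((EuclideanSpace.single 1 1, 0) : Plane × ℝ) ∈ (⊤ : Submodule ℝ (Plane × ℝ)) := trivial
    rw [← h] at this
    simp [L] at this

theorem fanField_cases {νl νr : ℝ} {z : Plane × ℝ} (hz : z ∈ spaceTime) (hne : z.1 1 ≠ νr * z.2)
    (h : νl < νr) :
    (z ∉ fanRegion νl νr ∧ ∀ {A : Type} (a b c : A), fanField νl νr a b c z = a) ∨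
    (z ∈ fanRegion νl νr ∧ ∀ {A : Type} (a b c : A), fanField νl νr a b c z = b) ∨
    (z ∉ fanRegion νl νr ∧ ∀ {A : Type} (a b c : A), fanField νl νr a b c z = c) := by
  have hlt : νl * z.2 < νr * z.2 := mul_lt_mul_of_pos_right h hz
  by_cases h1 : z.1 1 ≤ νl * z.2
  · exact Or.inl ⟨fun hh => hh.2.1.not_ge h1, fun a b c => by simp [fanField, h1]⟩
  · by_cases h2 : z.1 1 ≤ νr * z.2
    · exact Or.inr (Or.inl ⟨⟨hz, not_le.1 h1, lt_of_le_of_ne h2 hne⟩, fun a b c => by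
        simp [fanField, h1, h2]⟩)
    · exact Or.inr (Or.inr ⟨fun hh => h2 hh.2.2.le, fun a b c => by simp [fanField, h1, h2]⟩)

theorem ae_fanField_cases {νl νr : ℝ} (h : νl < νr) : ∀ᵐ z ∂spaceTimeMeasure,
    (z ∉ fanRegion νl νr ∧ ∀ {A : Type} (a b c : A), fanField νl νr a b c z = a) ∨
    (z ∈ fanRegion νl νr ∧ ∀ {A : Type} (a b c : A), fanField νl νr a b c z = b) ∨
    (z ∉ fanRegion νl νr ∧ ∀ {A : Type} (a b c : A), fanField νl νr a b c z = c) := by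
  filter_upwards [ae_ne_interface νr, ae_restrict_mem measurableSet_spaceTime] with z h1 h2
  exact fanField_cases h2 h1 h

theorem stronglyMeasurable_fanField {A : Type*} [TopologicalSpace A]
    [TopologicalSpace.PseudoMetrizableSpace A] (νl νr : ℝ) {a b c : Plane × ℝ → A}
    (ha : StronglyMeasurable a) (hb : StronglyMeasurable b) (hc : StronglyMeasurable c) :
    StronglyMeasurable fun z => fanField νl νr (a z) (b z) (c z) z := by
  have hm : ∀ ν : ℝ, MeasurableSet {z : Plane × ℝ | z.1 1 ≤ ν * z.2} := fun ν =>
    (isClosed_le (by fun_prop) (by fun_prop)).measurableSet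
  exact StronglyMeasurable.ite (hm νl) ha (StronglyMeasurable.ite (hm νr) hb hc)

theorem integrable_fderiv_of_bounded {μ : Measure (Plane × ℝ)} [IsFiniteMeasureOnCompacts μ]
    {ψ : Plane × ℝ → ℝ} (hψ : IsTestFunction ψ)
    {G : Plane × ℝ → Plane × ℝ} (hG : AEStronglyMeasurable G μ) {B : ℝ}
    (hB : ∀ᵐ z ∂μ, ‖G z‖ ≤ B) : Integrable (fun z => fderiv ℝ ψ z (G z)) μ := by
  have hc : Continuous (fderiv ℝ ψ) := hψ.1.continuous_fderiv (by simp)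
  refine Integrable.mono' ((hc.integrable_of_hasCompactSupport
    (hψ.2.fderiv ℝ)).norm.mul_const B)
    (isBoundedBilinearMap_apply.continuous.comp_aestronglyMeasurable
      (hc.aestronglyMeasurable.prodMk hG)) ?_
  filter_upwards [hB] with z hz
  exact ((fderiv ℝ ψ z).le_opNorm _).trans (mul_le_mul_of_nonneg_left hz (norm_nonneg _))

/-- A flux that differs in the fan region from a piecewise constant one by a divergence-free
oscillation satisfies the same balance. -/
theorem integral_oscillating_fanField {ψ : Plane × ℝ → ℝ} (hψ : IsTestFunction ψ) {νl νr : ℝ}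
    (hν : νl < νr) (A B C : Plane × ℝ) {G W : Plane × ℝ → Plane × ℝ}
    (hW : StronglyMeasurable W) {M : ℝ} (hM : ∀ᵐ z ∂volume.restrict (fanRegion νl νr), ‖W z‖ ≤ M)
    (h0 : ∫ z in fanRegion νl νr, fderiv ℝ ψ z (W z) = 0) (c : ℝ)
    (hG : ∀ᵐ z ∂spaceTimeMeasure,
      G z = fanField νl νr A B C z + (fanRegion νl νr).indicator (fun z => c • W z) z) :
    Integrable (fun z => fderiv ℝ ψ z (G z)) spaceTimeMeasure ∧
    (∫ z, fderiv ℝ ψ z (G z) ∂spaceTimeMeasure) + ∫ x, riemannData A.2 C.2 x * ψ (x, 0)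
      = (νl * (B.2 - A.2) - (B.1 1 - A.1 1)) * interfaceIntegral νl ψ
        + (νr * (C.2 - B.2) - (C.1 1 - B.1 1)) * interfaceIntegral νr ψ := by
  have hfm : IsFiniteMeasureOnCompacts spaceTimeMeasure := by
    unfold spaceTimeMeasure; infer_instance
  have hΩ := (isOpen_fanRegion νl νr).measurableSet
  have i1 : Integrable (fun z => fderiv ℝ ψ z (fanField νl νr A B C z)) spaceTimeMeasure := by
    refine integrable_fderiv_of_bounded hψ (stronglyMeasurable_fanField νl νr
      stronglyMeasurable_const stronglyMeasurable_const
      stronglyMeasurable_const).aestronglyMeasurable (B := ‖A‖ + ‖B‖ + ‖C‖) (ae_of_all _ fun z => ?_)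
    have := norm_nonneg A
    have := norm_nonneg B
    have := norm_nonneg C
    unfold fanField
    split_ifs <;> linarith
  have i2 : Integrable (fun z => (fanRegion νl νr).indicator (fun z => fderiv ℝ ψ z (W z)) z)
      spaceTimeMeasure := by
    refine IntegrableOn.integrable_indicator ?_ hΩ
    rw [IntegrableOn, restrict_fanRegion_eq]
    exact integrable_fderiv_of_bounded hψ hW.aestronglyMeasurable hM
  have e : (fun z => fderiv ℝ ψ z (G z)) =ᵐ[spaceTimeMeasure] fun z =>
      fderiv ℝ ψ z (fanField νl νr A B C z)
        + c * (fanRegion νl νr).indicator (fun z => fderiv ℝ ψ z (W z)) z := by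
    filter_upwards [hG] with z hz
    rw [hz, map_add]
    by_cases h : z ∈ fanRegion νl νr
    · simp [h]
    · simp [h]
  refine ⟨(i1.add (i2.const_mul c)).congr e.symm, ?_⟩
  rw [integral_congr_ae e, integral_add i1 (i2.const_mul c), integral_const_mul,
    integral_indicator hΩ, restrict_fanRegion_eq, h0, mul_zero, add_zero,
    integral_fanField hψ hν]

/-! ### From oscillating complex fields to solutions of the Euler system -/

/-- The plane vector with the given complex coordinate. -/
noncomputable def planeVector (c : ℂ) : Plane := !₂[c.re, c.im]

theorem norm_planeVector_sq (c : ℂ) : ‖planeVector c‖ ^ 2 = ‖c‖ ^ 2 := by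
  rw [EuclideanSpace.norm_sq_eq, ← Complex.normSq_eq_norm_sq, Complex.normSq_apply]
  simp [planeVector, Fin.sum_univ_two, sq]

theorem continuous_planeVector : Continuous planeVector := by
  unfold planeVector
  refine (PiLp.continuous_toLp 2 _).comp (continuous_pi fun i => ?_)
  fin_cases i
  · exact Complex.continuous_re
  · exact Complex.continuous_im

theorem fderiv_apply_pair {F : Type*} [NormedAddCommGroup F] [NormedSpace ℝ F]
    (ψ : Plane × ℝ → F) (z : Plane × ℝ) (w : Plane) (r : ℝ) :
    fderiv ℝ ψ z (w, r) = spaceDeriv ψ z w + r • timeDeriv ψ z := by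
  rw [spaceDeriv, timeDeriv, ← map_smul, ← map_add]
  simp

theorem spaceDeriv_smul (ψ : Plane × ℝ → ℝ) (z : Plane × ℝ) (a : ℝ) (w : Plane) :
    spaceDeriv ψ z (a • w) = a * spaceDeriv ψ z w := by
  rw [spaceDeriv, spaceDeriv, ← smul_eq_mul, ← map_smul, Prod.smul_mk, smul_zero]

theorem IsTestFunction.component {φ : Plane × ℝ → Plane} (hφ : IsTestFunction φ) (i : Fin 2) :
    IsTestFunction fun z => φ z i :=
  ⟨(EuclideanSpace.proj (𝕜 := ℝ) i : Plane →L[ℝ] ℝ).contDiff.comp hφ.1,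
    hφ.2.comp_left (g := fun x : Plane => x i) rfl⟩

theorem IsTestFunction.fderiv_component {φ : Plane × ℝ → Plane} (hφ : IsTestFunction φ)
    (i : Fin 2) (z u : Plane × ℝ) : fderiv ℝ (fun z => φ z i) z u = fderiv ℝ φ z u i := by
  have h := ((EuclideanSpace.proj (𝕜 := ℝ) i : Plane →L[ℝ] ℝ).hasFDerivAt.comp z
    ((hφ.1.differentiable (by simp)) z).hasFDerivAt).fderiv
  exact congrArg (fun L => L u) h

/-- The complex state of the fan region. -/
noncomputable def fanState (w β κ₁ κ₂ : ℝ) : ℂ × ℂ :=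
  ((⟨w, β⟩ : ℂ), (⟨w, β⟩ : ℂ) ^ 2 - ((κ₁ - κ₂ : ℝ) : ℂ))

/-- For this state v² - z equals κ₁ - κ₂, so the point is |κ₁ - κ₂| < κ₁ + κ₂. -/
theorem fanState_mem {w β κ₁ κ₂ : ℝ} (h₁ : 0 < κ₁) (h₂ : 0 < κ₂) :
    fanState w β κ₁ κ₂ ∈ relaxedStates (w ^ 2 + β ^ 2 + κ₁ + κ₂) := by
  simp only [relaxedStates, fanState, mem_ofPred_eq, sub_sub_cancel, Complex.norm_real,
    Real.norm_eq_abs, ← Complex.normSq_eq_norm_sq, Complex.normSq_apply]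
  have : |κ₁ - κ₂| < κ₁ + κ₂ := abs_lt.2 ⟨by linarith, by linarith⟩
  nlinarith

/-- Oscillating velocities in the fan region with constant modulus, weakly compatible with the
state of a fan subsolution. -/
structure IsFanVelocity (w β κ₁ κ₂ νl νr : ℝ) (V : Plane × ℝ → ℂ) : Prop where
  stronglyMeasurable : StronglyMeasurable V
  norm_sq : ∀ᵐ y ∂volume.restrict (fanRegion νl νr), ‖V y‖ ^ 2 = w ^ 2 + β ^ 2 + κ₁ + κ₂
  divFree : ∀ (k : Fin 3) (ψ : Plane × ℝ → ℝ), IsTestFunction ψ →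
    ∫ y in fanRegion νl νr,
      fderiv ℝ ψ y (stressFlux k ((V y, V y ^ 2) - fanState w β κ₁ κ₂)) = 0

section Assembly

variable {γ ρl ρr ρ β κ₁ κ₂ νl νr : ℝ} {vl vr : Plane} {V : Plane × ℝ → ℂ}

theorem IsFanVelocity.exists_bound (hV : IsFanVelocity (vl 0) β κ₁ κ₂ νl νr V) (k : Fin 3) :
    ∃ M, ∀ᵐ y ∂volume.restrict (fanRegion νl νr),
      ‖stressFlux k ((V y, V y ^ 2) - fanState (vl 0) β κ₁ κ₂)‖ ≤ M := by
  set C := vl 0 ^ 2 + β ^ 2 + κ₁ + κ₂ with hC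
  -- The state (V, V²) satisfies the constraint with equality, so it is a relaxed state only for a
  -- larger constant.
  obtain ⟨M, hM⟩ := exists_bound_stressFlux (C + 1) (fanState (vl 0) β κ₁ κ₂) k
  refine ⟨M, hV.norm_sq.mono fun y hy => hM _ ?_⟩
  simp [relaxedStates, hy]
  linarith

theorem IsFanVelocity.stronglyMeasurable_stressFlux
    (hV : IsFanVelocity (vl 0) β κ₁ κ₂ νl νr V) (k : Fin 3) :
    StronglyMeasurable fun y => stressFlux k ((V y, V y ^ 2) - fanState (vl 0) β κ₁ κ₂) := by
  have hc : Continuous fun c : ℂ => stressFlux k ((c, c ^ 2) - fanState (vl 0) β κ₁ κ₂) :=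
    (continuous_stressFlux k).comp (by fun_prop)
  exact hc.comp_stronglyMeasurable hV.stronglyMeasurable

/-- The balance of a flux which is obtained from the flux of a fan subsolution by an oscillation. -/
theorem IsFanVelocity.balance (hV : IsFanVelocity (vl 0) β κ₁ κ₂ νl νr V) (hν : νl < νr)
    {ψ : Plane × ℝ → ℝ} (hψ : IsTestFunction ψ) (A B C : Plane × ℝ)
    {G H : Plane × ℝ → Plane × ℝ} (k : Fin 3) (c : ℝ)
    (hG : ∀ᵐ z ∂spaceTimeMeasure, G z = fanField νl νr A (H z) C z)
    (hH : ∀ z, ‖V z‖ ^ 2 = vl 0 ^ 2 + β ^ 2 + κ₁ + κ₂ →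
      H z = B + c • stressFlux k ((V z, V z ^ 2) - fanState (vl 0) β κ₁ κ₂)) :
    Integrable (fun z => fderiv ℝ ψ z (G z)) spaceTimeMeasure ∧
    (∫ z, fderiv ℝ ψ z (G z) ∂spaceTimeMeasure) + ∫ x, riemannData A.2 C.2 x * ψ (x, 0)
      = (νl * (B.2 - A.2) - (B.1 1 - A.1 1)) * interfaceIntegral νl ψ
        + (νr * (C.2 - B.2) - (C.1 1 - B.1 1)) * interfaceIntegral νr ψ := by
  obtain ⟨M, hM⟩ := hV.exists_bound k
  refine integral_oscillating_fanField hψ hν A B C (hV.stronglyMeasurable_stressFlux k) hM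
    (hV.divFree k ψ hψ) c ?_
  have hn := hV.norm_sq
  rw [← restrict_fanRegion_eq, ae_restrict_iff' (isOpen_fanRegion νl νr).measurableSet] at hn
  filter_upwards [hG, hn, ae_fanField_cases hν] with z h1 h2 h3
  rw [h1]
  rcases h3 with ⟨h, e⟩ | ⟨h, e⟩ | ⟨h, e⟩
  · rw [e, e, indicator_of_notMem h, add_zero]
  · rw [e, e, indicator_of_mem h, hH z (h2 h)]
  · rw [e, e, indicator_of_notMem h, add_zero]

/-- The mass flux. -/
theorem IsFanVelocity.mass (hV : IsFanVelocity (vl 0) β κ₁ κ₂ νl νr V)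
    (hs : IsFanSubsolution γ ρl vl ρr vr ρ β κ₁ κ₂ νl νr)
    {ψ : Plane × ℝ → ℝ} (hψ : IsTestFunction ψ) :
    (∫ z, (fanField νl νr ρl ρ ρr z * timeDeriv ψ z + fanField νl νr ρl ρ ρr z
      * spaceDeriv ψ z (fanField νl νr vl (planeVector (V z)) vr z)) ∂spaceTimeMeasure)
      + ∫ x, riemannData ρl ρr x * ψ (x, 0) = 0 := by
  have key := (hV.balance hs.speed_lt hψ (ρl • vl, ρl) (ρ • !₂[vl 0, β], ρ) (ρr • vr, ρr)
    (G := fun z => fanField νl νr (ρl • vl, ρl) (ρ • planeVector (V z), ρ) (ρr • vr, ρr) z)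
    (H := fun z => (ρ • planeVector (V z), ρ)) 0 ρ (ae_of_all _ fun _ => rfl) ?_).2
  · have h1 := hs.mass_left
    have h2 := hs.mass_right
    simp only [PiLp.smul_apply, smul_eq_mul, Matrix.cons_val_one, Matrix.cons_val_zero] at key
    rw [h1, h2, sub_self, sub_self, zero_mul, zero_mul, add_zero] at key
    refine Eq.trans ?_ key
    congr 2 with z
    simp only [fanField]
    split_ifs <;> rw [fderiv_apply_pair, spaceDeriv_smul, smul_eq_mul, add_comm]
  · intro z _
    refine Prod.ext ?_ ?_
    · ext i
      fin_cases i <;> simp [stressFlux, planeVector, fanState] <;> ring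
    · simp [stressFlux]

/-- The flux of the momentum component `i`. -/
theorem IsFanVelocity.momentum (hV : IsFanVelocity (vl 0) β κ₁ κ₂ νl νr V)
    (hs : IsFanSubsolution γ ρl vl ρr vr ρ β κ₁ κ₂ νl νr) (h0 : vl 0 = vr 0)
    {ψ : Plane × ℝ → ℝ} (hψ : IsTestFunction ψ) (i : Fin 2)
    {v : Plane × ℝ → Plane} {r : Plane × ℝ → ℝ}
    (hv : v = fun z => fanField νl νr vl (planeVector (V z)) vr z)
    (hr : r = fun z => fanField νl νr ρl ρ ρr z) :
    Integrable (fun z => fderiv ℝ ψ z ((r z * v z i) • v z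
        + pressure γ (r z) • EuclideanSpace.single i 1, r z * v z i)) spaceTimeMeasure ∧
    (∫ z, fderiv ℝ ψ z ((r z * v z i) • v z
        + pressure γ (r z) • EuclideanSpace.single i 1, r z * v z i) ∂spaceTimeMeasure)
      + ∫ x, riemannData (ρl * vl i) (ρr * vr i) x * ψ (x, 0) = 0 := by
  let f : ℝ → Plane → Plane × ℝ := fun a u =>
    ((a * u i) • u + pressure γ a • EuclideanSpace.single i 1, a * u i)
  have hG : ∀ z, f (r z) (v z)
      = fanField νl νr (f ρl vl) (f ρ (planeVector (V z))) (f ρr vr) z := by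
    intro z
    rw [hv, hr]
    simp only [fanField]
    split_ifs <;> rfl
  have m1 := hs.mass_left
  have m2 := hs.mass_right
  have m3 := hs.momentum_left
  have m4 := hs.momentum_right
  have hnorm : ∀ z, ‖V z‖ ^ 2 = vl 0 ^ 2 + β ^ 2 + κ₁ + κ₂ →
      (V z).re ^ 2 + (V z).im ^ 2 = vl 0 ^ 2 + β ^ 2 + κ₁ + κ₂ := fun z hz => by
    rw [← hz, ← Complex.normSq_eq_norm_sq, Complex.normSq_apply]; ring
  fin_cases i
  -- V ⊗ V is its traceless part plus C / 2 times the identity. For the averaged state the same sum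
  -- has the diagonal entries `vl 0 ^ 2 + κ₂` and `β ^ 2 + κ₁`.
  · have hH : ∀ z, ‖V z‖ ^ 2 = vl 0 ^ 2 + β ^ 2 + κ₁ + κ₂ → f ρ (planeVector (V z))
        = (!₂[ρ * (vl 0 ^ 2 + κ₂) + pressure γ ρ, ρ * vl 0 * β], ρ * vl 0)
          + ρ • stressFlux 1 ((V z, V z ^ 2) - fanState (vl 0) β κ₁ κ₂) := by
      intro z hz
      have hz' := hnorm z hz
      refine Prod.ext ?_ ?_
      · ext j
        fin_cases j
        · simp [f, stressFlux, planeVector, fanState, sq, Complex.mul_re]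
          linear_combination (ρ / 2) * hz'
        · simp [f, stressFlux, planeVector, fanState, sq, Complex.mul_im]
          ring
      · simp [f, stressFlux, planeVector, fanState]
        ring
    obtain ⟨hi, key⟩ := hV.balance hs.speed_lt hψ (f ρl vl) _ (f ρr vr)
      (G := fun z => f (r z) (v z)) 1 ρ (ae_of_all _ hG) hH
    refine ⟨hi, key.trans ?_⟩
    simp [f, ← h0]
    -- The tangential velocity has the same mean on all three sides, so the tangential conditions
    -- are multiples of the mass conditions.
    linear_combination (vl 0 * interfaceIntegral νl ψ) * m1
      + (vl 0 * interfaceIntegral νr ψ) * m2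
  · have hH : ∀ z, ‖V z‖ ^ 2 = vl 0 ^ 2 + β ^ 2 + κ₁ + κ₂ → f ρ (planeVector (V z))
        = (!₂[ρ * vl 0 * β, ρ * (β ^ 2 + κ₁) + pressure γ ρ], ρ * β)
          + ρ • stressFlux 2 ((V z, V z ^ 2) - fanState (vl 0) β κ₁ κ₂) := by
      intro z hz
      have hz' := hnorm z hz
      refine Prod.ext ?_ ?_
      · ext j
        fin_cases j
        · simp [f, stressFlux, planeVector, fanState, sq, Complex.mul_im]
          ring
        · simp [f, stressFlux, planeVector, fanState, sq, Complex.mul_re]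
          linear_combination (ρ / 2) * hz'
      · simp [f, stressFlux, planeVector, fanState]
        ring
    obtain ⟨hi, key⟩ := hV.balance hs.speed_lt hψ (f ρl vl) _ (f ρr vr)
      (G := fun z => f (r z) (v z)) 2 ρ (ae_of_all _ hG) hH
    refine ⟨hi, key.trans ?_⟩
    simp [f]
    linear_combination (interfaceIntegral νl ψ) * m3 + (interfaceIntegral νr ψ) * m4

/-- The energy flux. -/
theorem IsFanVelocity.energy_ineq (hV : IsFanVelocity (vl 0) β κ₁ κ₂ νl νr V)
    (hs : IsFanSubsolution γ ρl vl ρr vr ρ β κ₁ κ₂ νl νr)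
    {ψ : Plane × ℝ → ℝ} (hψ : IsTestFunction ψ) (hpos : ∀ x t, 0 ≤ t → 0 ≤ ψ (x, t))
    {v : Plane × ℝ → Plane} {r : Plane × ℝ → ℝ}
    (hv : v = fun z => fanField νl νr vl (planeVector (V z)) vr z)
    (hr : r = fun z => fanField νl νr ρl ρ ρr z) :
    0 ≤ (∫ z, (energy γ (r z) (v z) * timeDeriv ψ z
        + (energy γ (r z) (v z) + pressure γ (r z)) * spaceDeriv ψ z (v z)) ∂spaceTimeMeasure)
      + ∫ x, riemannData (energy γ ρl vl) (energy γ ρr vr) x * ψ (x, 0) := by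
  let f : ℝ → Plane → Plane × ℝ := fun a u =>
    ((energy γ a u + pressure γ a) • u, energy γ a u)
  have hG : ∀ z, f (r z) (v z)
      = fanField νl νr (f ρl vl) (f ρ (planeVector (V z))) (f ρr vr) z := by
    intro z
    rw [hv, hr]
    simp only [fanField]
    split_ifs <;> rfl
  set E := ρ * internalEnergy γ ρ + ρ * ((vl 0 ^ 2 + β ^ 2 + κ₁ + κ₂) / 2) with hE
  have m1 := hs.energy_left
  have m2 := hs.energy_right
  rw [← hE] at m1 m2
  have key := (hV.balance hs.speed_lt hψ (f ρl vl)
    ((E + pressure γ ρ) • !₂[vl 0, β], E) (f ρr vr)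
    (G := fun z => f (r z) (v z)) (H := fun z => f ρ (planeVector (V z))) 0 (E + pressure γ ρ)
    (ae_of_all _ hG) (fun z hz => ?_)).2
  · have e : ∀ z, energy γ (r z) (v z) * timeDeriv ψ z
        + (energy γ (r z) (v z) + pressure γ (r z)) * spaceDeriv ψ z (v z)
        = fderiv ℝ ψ z (f (r z) (v z)) := by
      intro z
      rw [fderiv_apply_pair, spaceDeriv_smul, smul_eq_mul, add_comm]
    simp only [e]
    refine le_of_le_of_eq ?_ key.symm
    refine add_nonneg (mul_nonneg ?_ (interfaceIntegral_nonneg hpos))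
      (mul_nonneg ?_ (interfaceIntegral_nonneg hpos))
    · simp [f]
      linarith
    · simp [f]
      linarith
  -- The constant modulus makes the energy density constant, so the energy flux oscillates like the
  -- mass flux.
  · have hEz : energy γ ρ (planeVector (V z)) = E := by
      rw [energy, norm_planeVector_sq, hz]
    simp only [f, hEz]
    refine Prod.ext ?_ ?_
    · ext j
      fin_cases j <;> simp [stressFlux, planeVector, fanState] <;> ring
    · simp [stressFlux]

theorem IsFanVelocity.ae_norm_le (hV : IsFanVelocity (vl 0) β κ₁ κ₂ νl νr V) (hν : νl < νr) :
    ∀ᵐ z ∂spaceTimeMeasure, ‖fanField νl νr vl (planeVector (V z)) vr z‖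
      ≤ ‖vl‖ + √(vl 0 ^ 2 + β ^ 2 + κ₁ + κ₂) + ‖vr‖ := by
  have hn := hV.norm_sq
  rw [← restrict_fanRegion_eq, ae_restrict_iff' (isOpen_fanRegion νl νr).measurableSet] at hn
  filter_upwards [hn, ae_fanField_cases hν] with z h2 h3
  have := norm_nonneg vl
  have := norm_nonneg vr
  have := Real.sqrt_nonneg (vl 0 ^ 2 + β ^ 2 + κ₁ + κ₂)
  rcases h3 with ⟨h, e⟩ | ⟨h, e⟩ | ⟨h, e⟩
  · rw [e]; linarith
  · have h4 : ‖planeVector (V z)‖ ≤ √(vl 0 ^ 2 + β ^ 2 + κ₁ + κ₂) :=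
      Real.le_sqrt_of_sq_le (by rw [norm_planeVector_sq, h2 h])
    rw [e]; linarith
  · rw [e]; linarith

theorem IsFanVelocity.isAdmissibleSolution (hV : IsFanVelocity (vl 0) β κ₁ κ₂ νl νr V)
    (hs : IsFanSubsolution γ ρl vl ρr vr ρ β κ₁ κ₂ νl νr) (h0 : vl 0 = vr 0)
    (hρl : 0 < ρl) (hρr : 0 < ρr) :
    IsAdmissibleSolution γ (riemannData ρl ρr) (riemannData vl vr)
      (fun z => fanField νl νr ρl ρ ρr z)
      (fun z => fanField νl νr vl (planeVector (V z)) vr z) where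
  memLp_density := by
    refine memLp_top_of_bound (stronglyMeasurable_fanField νl νr stronglyMeasurable_const
      stronglyMeasurable_const stronglyMeasurable_const).aestronglyMeasurable (ρl + ρ + ρr)
      (ae_of_all _ fun z => ?_)
    have := hs.density_pos
    unfold fanField
    split_ifs <;> rw [Real.norm_of_nonneg (by positivity)] <;> linarith
  memLp_velocity := memLp_top_of_bound (stronglyMeasurable_fanField νl νr stronglyMeasurable_const
      (continuous_planeVector.comp_stronglyMeasurable hV.stronglyMeasurable)
      stronglyMeasurable_const).aestronglyMeasurable _ (hV.ae_norm_le hs.speed_lt)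
  density_nonneg := ae_of_all _ fun z => by
    have := hs.density_pos
    unfold fanField
    split_ifs <;> positivity
  mass := fun ψ hψ => hV.mass hs hψ
  momentum := fun φ hφ => by
    set v : Plane × ℝ → Plane := fun z => fanField νl νr vl (planeVector (V z)) vr z with hv
    set r : Plane × ℝ → ℝ := fun z => fanField νl νr ρl ρ ρr z with hr
    obtain ⟨i0, e0⟩ := hV.momentum hs h0 (hφ.component 0) 0 hv hr
    obtain ⟨i1, e1⟩ := hV.momentum hs h0 (hφ.component 1) 1 hv hr
    have hi : ∀ (i : Fin 2) (a b : ℝ),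
        Integrable fun x => riemannData a b x * φ (x, 0) i := fun i a b => by
      have hc : Integrable fun x : Plane => φ (x, 0) i :=
        (((hφ.component i).1.continuous.comp
          (by fun_prop : Continuous fun x : Plane => (x, (0 : ℝ))))).integrable_of_hasCompactSupport
          (hasCompactSupport_comp_of_leftInverse (hφ.component i).2 continuous_fst fun _ => rfl)
      refine hc.bdd_mul (c := |a| + |b|) (StronglyMeasurable.ite
        (isOpen_lt (by fun_prop) continuous_const).measurableSet stronglyMeasurable_const
        stronglyMeasurable_const).aestronglyMeasurable (ae_of_all _ fun x => ?_)
      have := abs_nonneg a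
      have := abs_nonneg b
      unfold riemannData
      split_ifs <;> rw [Real.norm_eq_abs] <;> linarith
    have e2 : ∫ x, riemannData ρl ρr x * inner ℝ (riemannData vl vr x) (φ (x, 0))
        = (∫ x, riemannData (ρl * vl 0) (ρr * vr 0) x * φ (x, 0) 0)
          + ∫ x, riemannData (ρl * vl 1) (ρr * vr 1) x * φ (x, 0) 1 := by
      rw [← integral_add (hi 0 _ _) (hi 1 _ _)]
      congr 1 with x
      unfold riemannData
      split_ifs <;> simp [PiLp.inner_apply, Fin.sum_univ_two] <;> ring
    have e3 : ∫ z, (r z * inner ℝ (v z) (timeDeriv φ z) + r z * inner ℝ (v z)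
        (spaceDeriv φ z (v z)) + pressure γ (r z) * spaceDiv φ z) ∂spaceTimeMeasure
        = (∫ z, fderiv ℝ (fun z => φ z 0) z ((r z * v z 0) • v z
          + pressure γ (r z) • EuclideanSpace.single 0 1, r z * v z 0) ∂spaceTimeMeasure)
        + ∫ z, fderiv ℝ (fun z => φ z 1) z ((r z * v z 1) • v z
          + pressure γ (r z) • EuclideanSpace.single 1 1, r z * v z 1) ∂spaceTimeMeasure := by
      rw [← integral_add i0 i1]
      congr 1 with z
      have hsplit : ∀ (a b : ℝ) (u u' : Plane), fderiv ℝ φ z (a • u + b • u', a)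
          = a • spaceDeriv φ z u + b • spaceDeriv φ z u' + a • timeDeriv φ z := by
        intro a b u u'
        rw [fderiv_apply_pair]
        simp only [spaceDeriv, ← map_smul, ← map_add]
        simp
      rw [hφ.fderiv_component, hφ.fderiv_component, hsplit, hsplit]
      simp [spaceDiv, PiLp.inner_apply, Fin.sum_univ_two]
      ring
    rw [e2, e3]
    linear_combination e0 + e1
  energy_ineq := fun ψ hψ hpos => by
    refine (hV.energy_ineq hs hψ hpos rfl rfl).trans_eq ?_
    congr 2 with x
    unfold riemannData
    split_ifs <;> rfl

end Assembly

/-- All solutions share one subsolution and hence one piecewise constant density; they differ only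
by the oscillating velocity in the fan region. -/
theorem hasInfinitelyManySolutions {γ ρl ρr : ℝ} {vl vr : Plane} (hγ : 1 ≤ γ) (hρl : 0 < ρl)
    (hρr : 0 < ρr) (h0 : vl 0 = vr 0)
    (h : velocityJump ρl (pressure γ ρl) ρr (pressure γ ρr) < vl 1 - vr 1) :
    HasInfinitelyManySolutions γ (riemannData ρl ρr) (riemannData vl vr) := by
  obtain ⟨ρ, β, κ₁, κ₂, νl, νr, hs⟩ := exists_fanSubsolution hγ hρl hρr h0 h
  obtain ⟨V, hm, hn, hd, hne⟩ := exists_infinitely_many_fields (isOpen_fanRegion νl νr)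
    (fanRegion_nonempty hs.speed_lt)
    (fanState_mem (w := vl 0) (β := β) hs.defect_one_pos hs.defect_two_pos)
  refine ⟨fun _ z => fanField νl νr ρl ρ ρr z,
    fun n z => fanField νl νr vl (planeVector (V n z)) vr z, fun n => ⟨?_, ?_⟩, ?_⟩
  · exact IsFanVelocity.isAdmissibleSolution ⟨hm n, hn n, hd n⟩ hs h0 hρl hρr
  · refine ⟨min ρl (min ρ ρr), lt_min hρl (lt_min hs.density_pos hρr), ae_of_all _ fun z => ?_⟩
    simp only [fanField]
    split_ifs <;> simp
  · intro m n hmn hae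
    refine hne m n hmn ?_
    rw [← restrict_fanRegion_eq, ae_restrict_iff' (isOpen_fanRegion νl νr).measurableSet]
    filter_upwards [hae, ae_fanField_cases hs.speed_lt] with z hz h3 hzΩ
    rcases h3 with ⟨h, -⟩ | ⟨-, e⟩ | ⟨h, -⟩
    · exact absurd hzΩ h
    · have h4 := hz.2
      rw [e, e] at h4
      refine Complex.ext ?_ ?_
      · simpa [planeVector] using congrArg (fun u : Plane => u 0) h4
      · simpa [planeVector] using congrArg (fun u : Plane => u 1) h4
    · exact absurd hzΩ h

end IsentropicEuler

theorem theorem1 (γ : ℝ) (hγ : 1 ≤ γ) (ρl ρr : ℝ) (hρl : 0 < ρl) (hρr : 0 < ρr)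
    (vl vr : IsentropicEuler.Plane) :
    (IsentropicEuler.HasTwoShockSolution γ ρl vl ρr vr ↔
      vl 0 = vr 0 ∧
      vr 1 - vl 1 < -√((ρl - ρr) *
        (IsentropicEuler.pressure γ ρl - IsentropicEuler.pressure γ ρr) / (ρl * ρr))) ∧
    (vl 0 = vr 0 →
      vr 1 - vl 1 < -√((ρl - ρr) *
        (IsentropicEuler.pressure γ ρl - IsentropicEuler.pressure γ ρr) / (ρl * ρr)) →
      IsentropicEuler.HasInfinitelyManySolutions γ
        (IsentropicEuler.riemannData ρl ρr) (IsentropicEuler.riemannData vl vr)) := by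
  rw [IsentropicEuler.velocityJump_lt_iff]
  exact ⟨IsentropicEuler.hasTwoShockSolution_iff hγ hρl hρr,
    IsentropicEuler.hasInfinitelyManySolutions hγ hρl hρr⟩
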